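/- \textbf{Setting.} Consider $x_{t+1}=Ax_t+Bu_t+\Xi w_t$ with $A\in\mathbb R^{n\times n}$, $B\in\mathbb R^{n\times m}$, $\Xi\in\mathbb R^{n\times k}$. Let $Q,Q_f\succeq 0$ and $R\succ 0$ be symmetric, $\lambda>0$, $N\ge 1$, $\hat w^{(1)},\dots,\hat w^{(N)}\in\mathbb R^k$, $\nu=\frac1N\sum_i\delta_{\hat w^{(i)}}$, $\bar w=\mathbb E_\nu[w]$, $\Sigma=\mathbb E_\nu[ww^\top]$. Let $\Pi$ be the set of sequences $\pi=(\pi_0,\pi_1,\dots)$ of measurable maps $\pi_t:\mathbb R^n\to\mathbb R^m$, and $\Gamma$ the set of sequences $\gamma=(\gamma_0,\gamma_1,\dots)$ of measurable maps $\gamma_t$ from $\mathbb R^n$ to the Borel probability measures on $\mathbb R^k$; under $(\pi,\gamma)$ one has $u_t=\pi_t(x_t)$ and, given the past, $w_t\sim\mu_t=\gamma_t(x_t)$. For a function $g$ on $\mathbb R^n$ put $$J_{\bm x,T}[g](\pi,\gamma)=\frac1T\,\mathbb E^{\pi,\gamma}\Big[\sum_{t=0}^{T-1}\big(x_t^\top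 Qx_t+u_t^\top Ru_t-\lambda W_2(\mu_t,\nu)^2\big)+g(x_T)\,\Big|\,x_0=\bm x\Big]\in[-\infty,\infty],$$ where $W_2$ is the Wasserstein distance of order $2$ for the Euclidean norm; the value is $-\infty$ whenever the expected penalty $\mathbb E^{\pi,\gamma}[\sum_{t<T}\lambda W_2(\mu_t,\nu)^2]$ is infinite. Let $\Phi=BR^{-1}B^\top-\frac1\lambda\Xi\Xi^\top$ and let $P^{(0)}=Q_f$, $P^{(j+1)}=Q+A^\top(I+P^{(j)}\Phi)^{-1}P^{(j)}A$, so that $P_t=P^{(T-t)}$ is the Riccati recursion with horizon $T$. \textbf{Assumptions.} (1) $\lambda I-\Xi^\top P^{(j)}\Xi\succ0$ for all $j\ge0$; (2) the empirical distribution is $\nu$ at every stage; (3) $\Phi\succeq0$ and $(A,\Phi^{1/2})$ is stabilizable; (4) $(A,Q^{1/2})$ is observable. Let $P_{ss}=\lim_{j\to\infty}P^{(j)}$ (the limit exists), and assume that $\lambda I-\Xi^\top P_{ss}\Xi$ is nonsingular, so that the objects below are defined. Put $M=(I+P_{ss}\Phi)^{-1}$, $$r_{ss}=(I-A^\top M)^{-1}A^\top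 MP_{ss}\Xi\bar w,\quad K_{ss}=-R^{-1}B^\top MP_{ss}A,\quad L_{ss}=-R^{-1}B^\top M(P_{ss}\Xi\bar w+r_{ss}),$$ $$\pi^\star_{ss}(\bm x)=K_{ss}\bm x+L_{ss},\qquad \gamma^\star_{ss}(\bm x)=\frac1N\sum_{i=1}^N\delta_{w^{\star,(i)}(\bm x)},$$ $$w^{\star,(i)}(\bm x)=(\lambda I-\Xi^\top P_{ss}\Xi)^{-1}\big(\Xi^\top P_{ss}(A\bm x+BK_{ss}\bm x+BL_{ss})+\Xi^\top r_{ss}+\lambda\hat w^{(i)}\big),$$ regarded also as stationary policies, $h(\bm x)=\bm x^\top P_{ss}\bm x+2r_{ss}^\top\bm x$, and $$\tilde J_{\bm x,\infty}(\pi,\gamma;h)=\limsup_{T\to\infty}J_{\bm x,T}[h](\pi,\gamma),\qquad J_{\bm x,\infty}(\pi,\gamma)=\limsup_{T\to\infty}J_{\bm x,T}[0](\pi,\gamma).$$ A pair $(\pi^0,\gamma^0)\in C\times D$ is called optimal for $\min_{\pi\in C}\max_{\gamma\in D}J(\pi,\gamma)$ if $\gamma^0$ maximizes $J(\pi^0,\cdot)$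 over $D$ and $\pi^0$ minimizes $\sup_{\gamma\in D}J(\cdot,\gamma)$ over $C$. \textbf{Theorem.} \label{thm:inf} Under these assumptions, the steady-state average cost $\rho:=\limsup_{T\to\infty}\inf_{\pi\in\Pi}\sup_{\gamma\in\Gamma}J_{\bm x,T}[g_f](\pi,\gamma)$, where $g_f(\bm y)=\bm y^\top Q_f\bm y$, is independent of $\bm x$ and equal to $$\mathrm{tr}\big[(I-\tfrac1\lambda\Xi^\top P_{ss}\Xi)^{-1}\Xi^\top P_{ss}\Xi\Sigma\big]+\bar w^\top\Xi^\top\big[M-(I-\tfrac1\lambda P_{ss}\Xi\Xi^\top)^{-1}\big]P_{ss}\Xi\bar w+(2\bar w^\top\Xi^\top-r_{ss}^\top\Phi)Mr_{ss},$$ and for every $\bm x\in\mathbb R^n$: (a) for all $(\pi,\gamma)\in\Pi\times\Gamma$, $\ \tilde J_{\bm x,\infty}(\pi^\star_{ss},\gamma;h)\le\rho\le\tilde J_{\bm x,\infty}(\pi,\gamma^\star_{ss};h)$; (b) $(\pi^\star_{ss},\gamma^\star_{ss})$ is optimal for $\min_{\pi\in\Pi}\max_{\gamma\in\Gamma}\tilde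 J_{\bm x,\infty}(\pi,\gamma;h)$, and the optimal value of this problem is $\rho$; (c) for all $\bar\Pi\subset\Pi$ and $\bar\Gamma\subset\Gamma$ that contain $\pi^\star_{ss}$ and $\gamma^\star_{ss}$ respectively and satisfy $$\limsup_{T\to\infty}\tfrac1T\mathbb E^{\pi^\star_{ss},\gamma}[h(x_T)\mid x_0=\bm x]=0\ \ \forall\gamma\in\bar\Gamma,\qquad \limsup_{T\to\infty}\tfrac1T\mathbb E^{\pi,\gamma^\star_{ss}}[h(x_T)\mid x_0=\bm x]=0\ \ \forall\pi\in\bar\Pi,$$ the pair $(\pi^\star_{ss},\gamma^\star_{ss})$ is optimal for $\min_{\pi\in\bar\Pi}\max_{\gamma\in\bar\Gamma}J_{\bm x,\infty}(\pi,\gamma)$, and the optimal value of this problem is $\rho$. -/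

import Mathlib

open MeasureTheory ProbabilityTheory Filter Topology Matrix

noncomputable section

/-- A matrix is (Schur) stable if all its complex eigenvalues have absolute value less than one. -/
def IsStableMatrix {n : ℕ} (M : Matrix (Fin n) (Fin n) ℝ) : Prop :=
  ∀ z ∈ spectrum ℂ (M.map (fun a : ℝ => (a : ℂ))), ‖z‖ < 1

/-- `(A, B)` is stabilizable: some feedback gain `K` makes `A + B K` stable. -/
def IsStabilizable {n p : ℕ} (A : Matrix (Fin n) (Fin n) ℝ) (B : Matrix (Fin n) (Fin p) ℝ) :
    Prop :=
  ∃ K : Matrix (Fin p) (Fin n) ℝ, IsStableMatrix (A + B * K)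

/-- `(A, C)` is observable: only the zero initial state of `x ↦ A x` has zero output
`C (A ^ i) x` at all times. -/
def IsObservablePair {n p : ℕ} (A : Matrix (Fin n) (Fin n) ℝ) (C : Matrix (Fin p) (Fin n) ℝ) :
    Prop :=
  ∀ x : Fin n → ℝ, (∀ i : ℕ, C *ᵥ ((A ^ i) *ᵥ x) = 0) → x = 0

/-- `S` is the (unique) positive semidefinite square root of `M`. -/
def IsPSDSqrt {n : ℕ} (S M : Matrix (Fin n) (Fin n) ℝ) : Prop :=
  S.PosSemidef ∧ S * S = M

/-- The empirical distribution `(1 / N) ∑ δ_{w i}`. -/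
def empirical {N k : ℕ} (w : Fin N → Fin k → ℝ) : Measure (Fin k → ℝ) :=
  (N : ENNReal)⁻¹ • ∑ i, Measure.dirac (w i)

/-- The Wasserstein distance of order two, for the Euclidean distance
`‖x - y‖² = (x - y) ⬝ᵥ (x - y)`, with values in `[0, ∞]`. -/
def W2 {k : ℕ} (μ ν : Measure (Fin k → ℝ)) : ENNReal :=
  ⨅ (η : Measure ((Fin k → ℝ) × (Fin k → ℝ))) (_ : η.map Prod.fst = μ) (_ : η.map Prod.snd = ν),
    (∫⁻ z, ENNReal.ofReal ((z.1 - z.2) ⬝ᵥ (z.1 - z.2)) ∂η) ^ ((1 : ℝ) / 2)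

/-- The expectation `∫ f⁺ dμ - ∫ f⁻ dμ` of a real function, in `[-∞, ∞]`. -/
def extExpect {E : Type*} [MeasurableSpace E] (μ : Measure E) (f : E → ℝ) : EReal :=
  ((∫⁻ x, ENNReal.ofReal (f x) ∂μ : ENNReal) : EReal)
    - ((∫⁻ x, ENNReal.ofReal (-f x) ∂μ : ENNReal) : EReal)

/-- Deterministic Markov control policies `π = (π_0, π_1, …)`. -/
structure ControlPolicy (n m : ℕ) where
  act : ℕ → (Fin n → ℝ) → (Fin m → ℝ)
  measurable_act : ∀ t, Measurable (act t)

/-- Deterministic Markov opponent policies `γ = (γ_0, γ_1, …)`: every `γ_t` maps a state to a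
probability measure, measurably. -/
structure OpponentPolicy (n k : ℕ) where
  act : ℕ → Kernel (Fin n → ℝ) (Fin k → ℝ)
  isMarkov_act : ∀ t, IsMarkovKernel (act t)

/-- The data of the problem: system matrices `A, B, Ξ`, cost matrices `Q, Qf, R`, penalty
parameter `lam`, and sample points `what 0, …, what (N - 1)` of the disturbance. -/
structure MinimaxLQ (n m k N : ℕ) where
  A : Matrix (Fin n) (Fin n) ℝ
  B : Matrix (Fin n) (Fin m) ℝ
  Ξ : Matrix (Fin n) (Fin k) ℝ
  Q : Matrix (Fin n) (Fin n) ℝ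
  Qf : Matrix (Fin n) (Fin n) ℝ
  R : Matrix (Fin m) (Fin m) ℝ
  lam : ℝ
  what : Fin N → Fin k → ℝ

namespace MinimaxLQ

variable {n m k N : ℕ} (S : MinimaxLQ n m k N)

/-- The empirical distribution of the sample. -/
def nu : Measure (Fin k → ℝ) := empirical S.what

/-- The mean `E_ν[w]`. -/
def wbar : Fin k → ℝ := (N : ℝ)⁻¹ • ∑ i, S.what i

/-- The second moment matrix `E_ν[w wᵀ]`. -/
def Sig : Matrix (Fin k) (Fin k) ℝ := (N : ℝ)⁻¹ • ∑ i, vecMulVec (S.what i) (S.what i)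

/-- `Φ = B R⁻¹ Bᵀ - (1 / λ) Ξ Ξᵀ`. -/
def Phi : Matrix (Fin n) (Fin n) ℝ := S.B * S.R⁻¹ * S.Bᵀ - (1 / S.lam) • (S.Ξ * S.Ξᵀ)

/-- The Riccati recursion in time-to-go: in the problem with horizon `T` one has
`P_t = riccati (T - t)`. -/
def riccati : ℕ → Matrix (Fin n) (Fin n) ℝ
  | 0 => S.Qf
  | j + 1 => S.Q + S.Aᵀ * (1 + riccati j * S.Phi)⁻¹ * riccati j * S.A

/-- The steady-state solution `P_ss = lim_{T → ∞} P_t`. -/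
def Pss : Matrix (Fin n) (Fin n) ℝ := limUnder atTop S.riccati

/-- `M = (I + P_ss Φ)⁻¹`, an abbreviation for the formulas below. -/
def Mss : Matrix (Fin n) (Fin n) ℝ := (1 + S.Pss * S.Phi)⁻¹

/-- `r_ss = [I - Aᵀ M]⁻¹ Aᵀ M P_ss Ξ w̄`. -/
def rss : Fin n → ℝ :=
  ((1 - S.Aᵀ * S.Mss)⁻¹ * S.Aᵀ * S.Mss * S.Pss * S.Ξ) *ᵥ S.wbar

/-- `K_ss = -R⁻¹ Bᵀ M P_ss A`. -/
def Kss : Matrix (Fin m) (Fin n) ℝ := -(S.R⁻¹ * S.Bᵀ * S.Mss * S.Pss * S.A)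

/-- `L_ss = -R⁻¹ Bᵀ M (P_ss Ξ w̄ + r_ss)`. -/
def Lss : Fin m → ℝ :=
  -((S.R⁻¹ * S.Bᵀ * S.Mss) *ᵥ (S.Pss *ᵥ (S.Ξ *ᵥ S.wbar) + S.rss))

/-- The stationary control law `π*_ss(x) = K_ss x + L_ss`. -/
def controlSS (x : Fin n → ℝ) : Fin m → ℝ := S.Kss *ᵥ x + S.Lss

/-- The worst-case support points
`w^{*,(i)}(x) = (λ I - Ξᵀ P_ss Ξ)⁻¹ (Ξᵀ P_ss (A x + B K_ss x + B L_ss) + Ξᵀ r_ss + λ ŵ^{(i)})`. -/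
def worstPoint (x : Fin n → ℝ) (i : Fin N) : Fin k → ℝ :=
  (S.lam • (1 : Matrix (Fin k) (Fin k) ℝ) - S.Ξᵀ * S.Pss * S.Ξ)⁻¹ *ᵥ
    (S.Ξᵀ *ᵥ (S.Pss *ᵥ (S.A *ᵥ x + S.B *ᵥ (S.Kss *ᵥ x) + S.B *ᵥ S.Lss))
      + S.Ξᵀ *ᵥ S.rss + S.lam • S.what i)

/-- The bias `h(x) = xᵀ P_ss x + 2 r_ssᵀ x`. -/
def bias (x : Fin n → ℝ) : ℝ := x ⬝ᵥ (S.Pss *ᵥ x) + 2 * (S.rss ⬝ᵥ x)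

/-- The closed form of the steady-state average cost. -/
def rho : ℝ :=
  trace ((1 - (1 / S.lam) • (S.Ξᵀ * S.Pss * S.Ξ))⁻¹ * (S.Ξᵀ * S.Pss * S.Ξ) * S.Sig)
    + S.wbar ⬝ᵥ ((S.Ξᵀ * (S.Mss - (1 - (1 / S.lam) • (S.Pss * S.Ξ * S.Ξᵀ))⁻¹)
        * S.Pss * S.Ξ) *ᵥ S.wbar)
    + ((2 : ℝ) • (S.Ξ *ᵥ S.wbar) - S.Phi *ᵥ S.rss) ⬝ᵥ (S.Mss *ᵥ S.rss)

/-- The law of the state `x_t` of `x_{t+1} = A x_t + B u_t + Ξ w_t`, `u_t = π_t(x_t)`,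
`w_t ∼ γ_t(x_t)`, when `x_0 = x`. -/
def stateLaw (x : Fin n → ℝ) (π : ControlPolicy n m) (γ : OpponentPolicy n k) :
    ℕ → Measure (Fin n → ℝ)
  | 0 => Measure.dirac x
  | t + 1 => (stateLaw x π γ t).bind fun y =>
      (γ.act t y).map fun w => S.A *ᵥ y + S.B *ᵥ π.act t y + S.Ξ *ᵥ w

/-- `E[∑_{t < T} (x_tᵀ Q x_t + u_tᵀ R u_t)]`, in `[0, ∞]` (for positive semidefinite `Q`, `R`). -/
def runningCost (x : Fin n → ℝ) (π : ControlPolicy n m) (γ : OpponentPolicy n k) (T : ℕ) :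
    ENNReal :=
  ∑ t ∈ Finset.range T, ∫⁻ y, ENNReal.ofReal
    (y ⬝ᵥ (S.Q *ᵥ y) + π.act t y ⬝ᵥ (S.R *ᵥ π.act t y)) ∂(S.stateLaw x π γ t)

/-- `E[∑_{t < T} λ W₂(μ_t, ν)²]`, with `μ_t = γ_t(x_t)`, in `[0, ∞]`. -/
def penaltyCost (x : Fin n → ℝ) (π : ControlPolicy n m) (γ : OpponentPolicy n k) (T : ℕ) :
    ENNReal :=
  ∑ t ∈ Finset.range T, ∫⁻ y, ENNReal.ofReal S.lam * W2 (γ.act t y) S.nu ^ 2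
    ∂(S.stateLaw x π γ t)

/-- `(1 / T) E[∑_{t < T} (x_tᵀ Q x_t + u_tᵀ R u_t - λ W₂(μ_t, ν)²) + g(x_T) | x_0 = x]`.
Addition in `EReal` satisfies `⊥ + ⊤ = ⊥`, hence the value is `-∞` whenever the expected penalty
is infinite. -/
def meanCost (g : (Fin n → ℝ) → ℝ) (x : Fin n → ℝ) (π : ControlPolicy n m)
    (γ : OpponentPolicy n k) (T : ℕ) : EReal :=
  ((1 / (T : ℝ) : ℝ) : EReal) *
    ((S.runningCost x π γ T : EReal) - (S.penaltyCost x π γ T : EReal)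
      + extExpect (S.stateLaw x π γ T) g)

/-- The finite-horizon cost `J^λ_{x,T}(π, γ)`, with terminal cost `x_Tᵀ Qf x_T`. -/
def finiteCost (x : Fin n → ℝ) (π : ControlPolicy n m) (γ : OpponentPolicy n k) (T : ℕ) : EReal :=
  S.meanCost (fun y => y ⬝ᵥ (S.Qf *ᵥ y)) x π γ T

/-- The steady-state average cost `limsup_{T → ∞} min_π max_γ J^λ_{x,T}(π, γ)`. -/
def steadyStateCost (x : Fin n → ℝ) : EReal :=
  limsup (fun T : ℕ => ⨅ π : ControlPolicy n m, ⨆ γ : OpponentPolicy n k, S.finiteCost x π γ T)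
    atTop

/-- The average cost `J^λ_{x,∞}(π, γ)`. -/
def averageCost (x : Fin n → ℝ) (π : ControlPolicy n m) (γ : OpponentPolicy n k) : EReal :=
  limsup (S.meanCost (fun _ => 0) x π γ) atTop

/-- The extended average cost `J̃^λ_{x,∞}(π, γ; h)` with the bias `h`. -/
def extAverageCost (x : Fin n → ℝ) (π : ControlPolicy n m) (γ : OpponentPolicy n k) : EReal :=
  limsup (S.meanCost S.bias x π γ) atTop

/-- `limsup_{T → ∞} (1 / T) E[h(x_T) | x_0 = x]`. -/
def biasGrowth (x : Fin n → ℝ) (π : ControlPolicy n m) (γ : OpponentPolicy n k) : EReal :=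
  limsup (fun T : ℕ => ((1 / (T : ℝ) : ℝ) : EReal) * extExpect (S.stateLaw x π γ T) S.bias) atTop

/-- The stationary policy `(π*_ss, π*_ss, …)`. -/
def controlPolicySS : ControlPolicy n m where
  act := fun _ => S.controlSS
  measurable_act := fun _ => by
    have h : Continuous S.controlSS := by
      unfold controlSS
      fun_prop
    exact h.measurable

theorem measurable_empirical_worstPoint :
    Measurable fun x : Fin n → ℝ => empirical (S.worstPoint x) := by
  refine Measure.measurable_of_measurable_coe _ fun s hs => ?_
  have hw : ∀ i, Measurable fun x => S.worstPoint x i := by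
    intro i
    have h : Continuous fun x => S.worstPoint x i := by
      unfold worstPoint
      fun_prop
    exact h.measurable
  simp only [empirical, Measure.smul_apply, Measure.finsetSum_apply, smul_eq_mul]
  refine Measurable.const_mul (Finset.measurable_sum _ fun i _ => ?_) _
  exact (Measure.measurable_coe hs).comp (Measure.measurable_dirac.comp (hw i))

/-- The stationary worst-case policy `γ*_ss(x) = (1 / N) ∑ δ_{w^{*,(i)}(x)}`. -/
def opponentPolicySS [NeZero N] : OpponentPolicy n k where
  act := fun _ => ⟨fun x => empirical (S.worstPoint x), S.measurable_empirical_worstPoint⟩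
  isMarkov_act := fun _ => ⟨fun x => ⟨by
    have hN : (N : ENNReal) ≠ 0 := by exact_mod_cast NeZero.ne N
    simp only [Kernel.coe_mk, empirical, Measure.smul_apply, Measure.finsetSum_apply,
      measure_univ, Finset.sum_const, Finset.card_univ, Fintype.card_fin, smul_eq_mul, nsmul_eq_mul,
      mul_one]
    exact ENNReal.inv_mul_cancel hN (ENNReal.natCast_ne_top N)⟩⟩

end MinimaxLQ

/-- `(π₀, γ₀)` is optimal for `min_{π ∈ C} max_{γ ∈ D} J(π, γ)`: both policies are feasible, `γ₀`
attains the inner maximum at `π₀`, and `π₀` attains the outer minimum. -/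
def IsMinimaxOptimal {α β : Type*} (J : α → β → EReal) (C : Set α) (D : Set β) (π₀ : α) (γ₀ : β) :
    Prop :=
  π₀ ∈ C ∧ γ₀ ∈ D ∧ (∀ γ ∈ D, J π₀ γ ≤ J π₀ γ₀) ∧
    ∀ π ∈ C, (⨆ γ ∈ D, J π₀ γ) ≤ ⨆ γ ∈ D, J π γ

end

/-! The proof is dynamic programming with quadratic value functions `V y = yᵀPy + 2rᵀy`.

One stage. If the undisturbed next state is `z`, weak duality for optimal transport bounds `E_μ V(z
+ Ξw) - λ W₂(μ, ν)²` by the average over the sample points `v` of `sup_w (V(z + Ξw) - λ|w - v|²)`.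
Positive definiteness of `λI - ΞᵀPΞ` makes each inner problem strictly concave, with an affine
maximizer, and the empirical law of the maximizers attains the bound. The saddle point is described
by a costate `p` and a mean next state `y` with `p = Py + r` and `y = Ax + Ξw̄ - Φp`. The control is
`-R⁻¹Bᵀp`, the mean disturbance is `w̄ + λ⁻¹Ξᵀp`, and the value is again quadratic plus a constant
(`mean_envelope`). Conversely, with the disturbance laws fixed at the saddle point, the stage cost
is convex in the control and stationary at the minimizing one (`le_cost_of_response`).

Many stages. Telescoping gives two inequalities: the minimizing control against every opponent
(`IsValueSequence.upper_bound`), and every control against the saddle opponent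
(`IsValueSequence.lower_bound`). With the finite-horizon coefficients they give the exact game
value. With the constants `P_ss`, `r_ss` they give `ρ + h(x)/T` as upper and lower bounds for the
mean cost with terminal cost `h`.

Limits. Writing `Φ = F²` turns the recursion into the Riccati recursion of a linear-quadratic
regulator with input matrix `F`. Stabilizability bounds its iterates from zero, observability makes
their limit positive definite, and a Lyapunov argument gives a stable closed loop and convergence
from every positive semidefinite start. The linear terms then converge, as a perturbed stable
recursion. Continuity of the stage constant and a Cesàro mean give `ρ`.

For (a) and (b) the two stationary bounds form a saddle point. For (c) the terminal `h` is removed: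
`h` is bounded below because `P_ss` is positive definite, which handles the upper bound, and the
growth condition handles the lower one. -/

section LinearAlgebra

/-! ### Quadratic forms and invertibility of `I + PΦ`. -/

variable {n m k p : ℕ}

theorem dotProduct_mulVec_comm {P : Matrix (Fin n) (Fin n) ℝ} (hP : Pᵀ = P) (x y : Fin n → ℝ) :
    x ⬝ᵥ (P *ᵥ y) = y ⬝ᵥ (P *ᵥ x) := by
  rw [dotProduct_mulVec, ← mulVec_transpose, hP, dotProduct_comm]

theorem dotProduct_mulVec_eq_transpose (B : Matrix (Fin n) (Fin m) ℝ) (x : Fin n → ℝ)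
    (y : Fin m → ℝ) : x ⬝ᵥ (B *ᵥ y) = (Bᵀ *ᵥ x) ⬝ᵥ y := by
  rw [dotProduct_mulVec, ← mulVec_transpose]

theorem Matrix.PosSemidef.transpose_eq {P : Matrix (Fin n) (Fin n) ℝ} (hP : P.PosSemidef) :
    Pᵀ = P := by
  simpa [conjTranspose_eq_transpose_of_trivial] using hP.isHermitian.eq

theorem Matrix.PosSemidef.quad_nonneg {P : Matrix (Fin n) (Fin n) ℝ} (hP : P.PosSemidef)
    (x : Fin n → ℝ) : 0 ≤ x ⬝ᵥ (P *ᵥ x) := by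
  simpa using hP.dotProduct_mulVec_nonneg x

theorem posSemidef_of_quad {P : Matrix (Fin n) (Fin n) ℝ} (hP : Pᵀ = P)
    (h : ∀ x, 0 ≤ x ⬝ᵥ (P *ᵥ x)) : P.PosSemidef :=
  PosSemidef.of_dotProduct_mulVec_nonneg
    (by rw [IsHermitian, conjTranspose_eq_transpose_of_trivial, hP]) (by simpa using h)

theorem posDef_of_quad {P : Matrix (Fin n) (Fin n) ℝ} (hP : Pᵀ = P)
    (h : ∀ x, x ≠ 0 → 0 < x ⬝ᵥ (P *ᵥ x)) : P.PosDef :=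
  PosDef.of_dotProduct_mulVec_pos
    (by rw [IsHermitian, conjTranspose_eq_transpose_of_trivial, hP]) (by simpa using h)

theorem Matrix.PosDef.quad_pos {P : Matrix (Fin n) (Fin n) ℝ} (hP : P.PosDef)
    {x : Fin n → ℝ} (hx : x ≠ 0) : 0 < x ⬝ᵥ (P *ᵥ x) := by
  simpa using hP.dotProduct_mulVec_pos hx

theorem dotProduct_self_nonneg' (x : Fin n → ℝ) : 0 ≤ x ⬝ᵥ x :=
  Finset.sum_nonneg fun i _ => mul_self_nonneg (x i)

/-- Moving one factor `F` to the other side of the determinant gives `I + FPF`, which is positive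
definite although `PF²` need not be symmetric. -/
theorem isUnit_det_one_add_mul {P F : Matrix (Fin n) (Fin n) ℝ} (hP : P.PosSemidef)
    (hF : Fᵀ = F) : IsUnit (1 + P * (F * F)).det := by
  rw [← Matrix.mul_assoc, det_one_add_mul_comm, ← Matrix.isUnit_iff_isUnit_det]
  have h : (F * (P * F)).PosSemidef := by
    have := hP.mul_mul_conjTranspose_same F
    rwa [conjTranspose_eq_transpose_of_trivial, hF, Matrix.mul_assoc] at this
  exact (PosDef.one.add_posSemidef h).isUnit

theorem isUnit_det_one_add_mul' {P F : Matrix (Fin n) (Fin n) ℝ} (hP : P.PosSemidef)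
    (hF : Fᵀ = F) : IsUnit (1 + (F * F) * P).det := by
  rw [det_one_add_mul_comm]
  exact isUnit_det_one_add_mul hP hF

/-- The push-through identity, from `P(I + ΦP) = (I + PΦ)P`. -/
theorem inv_one_add_mul_mul {P Φ : Matrix (Fin n) (Fin n) ℝ} (h : IsUnit (1 + P * Φ).det) :
    (1 + P * Φ)⁻¹ * P = P * (1 + Φ * P)⁻¹ := by
  have h' : IsUnit (1 + Φ * P).det := by rwa [det_one_add_mul_comm]
  have e : P * (1 + Φ * P) = (1 + P * Φ) * P := by noncomm_ring
  calc (1 + P * Φ)⁻¹ * P = (1 + P * Φ)⁻¹ * (P * (1 + Φ * P)) * (1 + Φ * P)⁻¹ := by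
        rw [Matrix.mul_assoc, Matrix.mul_assoc, Matrix.mul_nonsing_inv _ h', Matrix.mul_one]
    _ = P * (1 + Φ * P)⁻¹ := by
        rw [e, ← Matrix.mul_assoc, Matrix.nonsing_inv_mul _ h, Matrix.one_mul]

theorem transpose_inv_one_add_mul {P Φ : Matrix (Fin n) (Fin n) ℝ} (hP : Pᵀ = P) (hΦ : Φᵀ = Φ) :
    ((1 + P * Φ)⁻¹)ᵀ = (1 + Φ * P)⁻¹ := by
  rw [transpose_nonsing_inv, transpose_add, transpose_mul, hP, hΦ, transpose_one]

end LinearAlgebra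

/-! ### The Riccati map as the value of a one-step regulator with input matrix `F` and `Φ = F²`. -/

section Riccati

variable {n p : ℕ}

/-- One step of the Riccati recursion. -/
noncomputable def riccatiMap (A Φ Q P : Matrix (Fin n) (Fin n) ℝ) : Matrix (Fin n) (Fin n) ℝ :=
  Q + Aᵀ * (1 + P * Φ)⁻¹ * P * A

/-- The closed-loop matrix `(I + Φ P)⁻¹ A`. -/
noncomputable def closedLoop (A Φ P : Matrix (Fin n) (Fin n) ℝ) : Matrix (Fin n) (Fin n) ℝ :=
  (1 + Φ * P)⁻¹ * A

variable {A F Q P : Matrix (Fin n) (Fin n) ℝ}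

/-- Exhibits the closed-loop successor `y` as the result of applying the input `-FPy` to `x ↦ Ax +
Fv`; this is `(I + F²P)y = Ax` rearranged. -/
theorem closedLoop_mulVec (hP : P.PosSemidef) (hF : Fᵀ = F) (x : Fin n → ℝ) :
    closedLoop A (F * F) P *ᵥ x
      = A *ᵥ x + F *ᵥ (-(F *ᵥ (P *ᵥ (closedLoop A (F * F) P *ᵥ x)))) := by
  have h : (1 + F * F * P) * closedLoop A (F * F) P = A := by
    rw [closedLoop, ← Matrix.mul_assoc, Matrix.mul_nonsing_inv _ (isUnit_det_one_add_mul' hP hF),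
      Matrix.one_mul]
  have h2 : A *ᵥ x = (1 + F * F * P) *ᵥ (closedLoop A (F * F) P *ᵥ x) := by
    rw [mulVec_mulVec, h]
  rw [h2, add_mulVec, one_mulVec, mulVec_neg, mulVec_mulVec, mulVec_mulVec]
  simp [Matrix.mul_assoc]

/-- The regulator cost `xᵀQx + |v|² + (Ax + Fv)ᵀP(Ax + Fv)` at the input `v = -FPy`, with `y` the
closed-loop successor; the next lemma shows that this input is optimal. -/
theorem quad_riccatiMap (hP : P.PosSemidef) (hF : Fᵀ = F) (x : Fin n → ℝ) :
    x ⬝ᵥ (riccatiMap A (F * F) Q P *ᵥ x)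
      = x ⬝ᵥ (Q *ᵥ x) + (F *ᵥ (P *ᵥ (closedLoop A (F * F) P *ᵥ x)))
          ⬝ᵥ (F *ᵥ (P *ᵥ (closedLoop A (F * F) P *ᵥ x)))
        + (closedLoop A (F * F) P *ᵥ x) ⬝ᵥ (P *ᵥ (closedLoop A (F * F) P *ᵥ x)) := by
  have h1 : x ⬝ᵥ (riccatiMap A (F * F) Q P *ᵥ x)
      = x ⬝ᵥ (Q *ᵥ x) + (A *ᵥ x) ⬝ᵥ (P *ᵥ (closedLoop A (F * F) P *ᵥ x)) := by
    rw [riccatiMap, add_mulVec, dotProduct_add, Matrix.mul_assoc Aᵀ,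
      inv_one_add_mul_mul (isUnit_det_one_add_mul hP hF), Matrix.mul_assoc, Matrix.mul_assoc,
      ← mulVec_mulVec, dotProduct_mulVec_eq_transpose Aᵀ, transpose_transpose, ← mulVec_mulVec]
    rfl
  have h2 : A *ᵥ x = closedLoop A (F * F) P *ᵥ x
      + F *ᵥ (F *ᵥ (P *ᵥ (closedLoop A (F * F) P *ᵥ x))) := by
    have h := closedLoop_mulVec (A := A) hP hF x
    rw [mulVec_neg, ← sub_eq_add_neg] at h
    exact sub_eq_iff_eq_add.1 h.symm
  rw [h1]
  generalize closedLoop A (F * F) P *ᵥ x = y at *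
  rw [h2, add_dotProduct, ← hF, ← dotProduct_mulVec_eq_transpose, hF]
  ring

/-- Completing the square: an input that differs from the optimal one by `d` costs `|d|² +
(Fd)ᵀP(Fd)` more. -/
theorem quad_riccatiMap_le (hP : P.PosSemidef) (hF : Fᵀ = F) (x v : Fin n → ℝ) :
    x ⬝ᵥ (riccatiMap A (F * F) Q P *ᵥ x)
      ≤ x ⬝ᵥ (Q *ᵥ x) + v ⬝ᵥ v + (A *ᵥ x + F *ᵥ v) ⬝ᵥ (P *ᵥ (A *ᵥ x + F *ᵥ v)) := by
  rw [quad_riccatiMap hP hF]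
  have h2 := closedLoop_mulVec (A := A) hP hF x
  generalize closedLoop A (F * F) P *ᵥ x = y at *
  obtain ⟨d, rfl⟩ : ∃ d, v = -(F *ᵥ (P *ᵥ y)) + d := ⟨v + F *ᵥ (P *ᵥ y), by abel⟩
  have h3 : A *ᵥ x + F *ᵥ (-(F *ᵥ (P *ᵥ y)) + d) = y + F *ᵥ d := by
    rw [mulVec_add, ← add_assoc, ← h2]
  rw [h3]
  have e1 : y ⬝ᵥ (P *ᵥ (F *ᵥ d)) = (F *ᵥ d) ⬝ᵥ (P *ᵥ y) :=
    dotProduct_mulVec_comm hP.transpose_eq _ _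
  have e2 : (F *ᵥ d) ⬝ᵥ (P *ᵥ y) = d ⬝ᵥ (F *ᵥ (P *ᵥ y)) := by
    rw [dotProduct_mulVec_eq_transpose F, hF]
  have e3 := dotProduct_comm (F *ᵥ (P *ᵥ y)) d
  have e4 := hP.quad_nonneg (F *ᵥ d)
  have e5 := dotProduct_self_nonneg' d
  simp only [mulVec_add, dotProduct_add, add_dotProduct, neg_dotProduct, dotProduct_neg]
  rw [e1, e2, e3]
  linarith

theorem transpose_riccatiMap (hQ : Q.PosSemidef) (hP : P.PosSemidef) (hF : Fᵀ = F) :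
    (riccatiMap A (F * F) Q P)ᵀ = riccatiMap A (F * F) Q P := by
  have hFF : (F * F)ᵀ = F * F := by rw [transpose_mul, hF]
  rw [riccatiMap, transpose_add, hQ.transpose_eq, transpose_mul, transpose_mul, transpose_mul,
    transpose_inv_one_add_mul hP.transpose_eq hFF, transpose_transpose, hP.transpose_eq,
    Matrix.mul_assoc Aᵀ, inv_one_add_mul_mul (isUnit_det_one_add_mul hP hF)]
  simp only [Matrix.mul_assoc]

theorem posSemidef_riccatiMap (hQ : Q.PosSemidef) (hP : P.PosSemidef) (hF : Fᵀ = F) :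
    (riccatiMap A (F * F) Q P).PosSemidef := by
  refine posSemidef_of_quad (transpose_riccatiMap hQ hP hF) fun x => ?_
  rw [quad_riccatiMap hP hF]
  have := hQ.quad_nonneg x
  have := hP.quad_nonneg (closedLoop A (F * F) P *ᵥ x)
  have := dotProduct_self_nonneg' (F *ᵥ (P *ᵥ (closedLoop A (F * F) P *ᵥ x)))
  linarith

/-- The input that is optimal for `P'` is admissible for `P` and is no more expensive there. -/
theorem quad_riccatiMap_mono {P' : Matrix (Fin n) (Fin n) ℝ} (hP : P.PosSemidef)
    (hP' : P'.PosSemidef) (hF : Fᵀ = F) (h : ∀ x, x ⬝ᵥ (P *ᵥ x) ≤ x ⬝ᵥ (P' *ᵥ x))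
    (x : Fin n → ℝ) :
    x ⬝ᵥ (riccatiMap A (F * F) Q P *ᵥ x) ≤ x ⬝ᵥ (riccatiMap A (F * F) Q P' *ᵥ x) := by
  rw [quad_riccatiMap hP' hF]
  refine (quad_riccatiMap_le hP hF x
    (-(F *ᵥ (P' *ᵥ (closedLoop A (F * F) P' *ᵥ x))))).trans ?_
  rw [← closedLoop_mulVec hP' hF, neg_dotProduct, dotProduct_neg, neg_neg]
  have := h (closedLoop A (F * F) P' *ᵥ x)
  linarith

theorem posSemidef_iterate_riccatiMap (hQ : Q.PosSemidef) (hP : P.PosSemidef) (hF : Fᵀ = F)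
    (j : ℕ) : ((riccatiMap A (F * F) Q)^[j] P).PosSemidef := by
  induction j with
  | zero => exact hP
  | succ j ih => rw [Function.iterate_succ_apply']; exact posSemidef_riccatiMap hQ ih hF

/-- The value of the Riccati iteration is at most the cost of a stationary linear feedback. -/
theorem quad_iterate_riccatiMap_le_sum (hQ : Q.PosSemidef) (hP : P.PosSemidef) (hF : Fᵀ = F)
    (K : Matrix (Fin n) (Fin n) ℝ) (j : ℕ) (x : Fin n → ℝ) :
    x ⬝ᵥ ((riccatiMap A (F * F) Q)^[j] P *ᵥ x)
      ≤ ∑ t ∈ Finset.range j, ((((A + F * K) ^ t) *ᵥ x) ⬝ᵥ (Q *ᵥ (((A + F * K) ^ t) *ᵥ x))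
          + (K *ᵥ (((A + F * K) ^ t) *ᵥ x)) ⬝ᵥ (K *ᵥ (((A + F * K) ^ t) *ᵥ x)))
        + (((A + F * K) ^ j) *ᵥ x) ⬝ᵥ (P *ᵥ (((A + F * K) ^ j) *ᵥ x)) := by
  induction j generalizing x with
  | zero => simp
  | succ j ih =>
    rw [Function.iterate_succ_apply']
    refine (quad_riccatiMap_le (posSemidef_iterate_riccatiMap hQ hP hF j) hF x (K *ᵥ x)).trans ?_
    have e : A *ᵥ x + F *ᵥ (K *ᵥ x) = (A + F * K) *ᵥ x := by
      rw [add_mulVec, mulVec_mulVec]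
    have := ih ((A + F * K) *ᵥ x)
    rw [e, Finset.sum_range_succ']
    simp only [mulVec_mulVec _ _ (A + F * K), ← pow_succ, pow_zero, one_mulVec] at this ⊢
    simp only [mulVec_mulVec] at this ⊢
    linarith

/-- Comparison of the Riccati iteration with a fixed point of the Riccati map. -/
theorem quad_iterate_riccatiMap_le (hQ : Q.PosSemidef) (hP : P.PosSemidef) (hF : Fᵀ = F)
    {X : Matrix (Fin n) (Fin n) ℝ} (hX : X.PosSemidef) (hfix : riccatiMap A (F * F) Q X = X)
    (j : ℕ) (x : Fin n → ℝ) :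
    x ⬝ᵥ ((riccatiMap A (F * F) Q)^[j] P *ᵥ x)
      ≤ x ⬝ᵥ (X *ᵥ x)
        - ((closedLoop A (F * F) X ^ j) *ᵥ x) ⬝ᵥ (X *ᵥ ((closedLoop A (F * F) X ^ j) *ᵥ x))
        + ((closedLoop A (F * F) X ^ j) *ᵥ x) ⬝ᵥ (P *ᵥ ((closedLoop A (F * F) X ^ j) *ᵥ x)) := by
  induction j generalizing x with
  | zero => simp
  | succ j ih =>
    rw [Function.iterate_succ_apply']
    -- Use the input that is optimal for the fixed point `X`; its stage cost is exactly the decrease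
    -- of the `X`-form along the closed loop.
    refine (quad_riccatiMap_le (posSemidef_iterate_riccatiMap hQ hP hF j) hF x
      (-(F *ᵥ (X *ᵥ (closedLoop A (F * F) X *ᵥ x))))).trans ?_
    have h1 := quad_riccatiMap (A := A) (Q := Q) hX hF x
    rw [hfix] at h1
    have h2 := ih (closedLoop A (F * F) X *ᵥ x)
    rw [← closedLoop_mulVec hX hF, neg_dotProduct, dotProduct_neg, neg_neg]
    rw [mulVec_mulVec _ (closedLoop A (F * F) X ^ j), ← pow_succ] at h2
    linarith

end Riccati

/-! ### Convergence of the Riccati iteration. -/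

section Convergence

variable {n m k : ℕ}

theorem tendsto_matrix_inv {α : Type*} {l : Filter α} {P : α → Matrix (Fin n) (Fin n) ℝ}
    {X : Matrix (Fin n) (Fin n) ℝ} (h : Tendsto P l (𝓝 X)) (hX : IsUnit X.det) :
    Tendsto (fun a => (P a)⁻¹) l (𝓝 X⁻¹) := by
  refine (continuousAt_matrix_inv X ?_).tendsto.comp h
  rw [Ring.inverse_eq_inv']
  exact continuousAt_inv₀ hX.ne_zero

theorem tendsto_matrix_mul {α : Type*} {l : Filter α} {P : α → Matrix (Fin n) (Fin m) ℝ}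
    {P' : α → Matrix (Fin m) (Fin k) ℝ} {X : Matrix (Fin n) (Fin m) ℝ}
    {Y : Matrix (Fin m) (Fin k) ℝ} (h : Tendsto P l (𝓝 X)) (h' : Tendsto P' l (𝓝 Y)) :
    Tendsto (fun a => P a * P' a) l (𝓝 (X * Y)) := by
  have hc : Continuous fun z : Matrix (Fin n) (Fin m) ℝ × Matrix (Fin m) (Fin k) ℝ => z.1 * z.2 :=
    continuous_fst.matrix_mul continuous_snd
  exact (hc.tendsto (X, Y)).comp (h.prodMk_nhds h')

theorem tendsto_matrix_mulVec {α : Type*} {l : Filter α} {P : α → Matrix (Fin n) (Fin m) ℝ}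
    {v : α → Fin m → ℝ} {X : Matrix (Fin n) (Fin m) ℝ} {y : Fin m → ℝ}
    (h : Tendsto P l (𝓝 X)) (h' : Tendsto v l (𝓝 y)) :
    Tendsto (fun a => P a *ᵥ v a) l (𝓝 (X *ᵥ y)) := by
  have hc : Continuous fun z : Matrix (Fin n) (Fin m) ℝ × (Fin m → ℝ) => z.1 *ᵥ z.2 :=
    continuous_fst.matrix_mulVec continuous_snd
  exact (hc.tendsto (X, y)).comp (h.prodMk_nhds h')

theorem tendsto_dotProduct {α : Type*} {l : Filter α} {u v : α → Fin m → ℝ} {x y : Fin m → ℝ}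
    (h : Tendsto u l (𝓝 x)) (h' : Tendsto v l (𝓝 y)) :
    Tendsto (fun a => u a ⬝ᵥ v a) l (𝓝 (x ⬝ᵥ y)) := by
  have hc : Continuous fun z : (Fin m → ℝ) × (Fin m → ℝ) => z.1 ⬝ᵥ z.2 :=
    continuous_fst.dotProduct continuous_snd
  exact (hc.tendsto (x, y)).comp (h.prodMk_nhds h')

/-- Reduces entrywise convergence of symmetric matrices to convergence of their quadratic forms,
where monotonicity and squeezing are available. -/
theorem apply_eq_polarization {P : Matrix (Fin n) (Fin n) ℝ} (hP : Pᵀ = P) (i j : Fin n) :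
    P i j = ((Pi.single i 1 + Pi.single j 1) ⬝ᵥ (P *ᵥ (Pi.single i 1 + Pi.single j 1))
      - (Pi.single i 1 : Fin n → ℝ) ⬝ᵥ (P *ᵥ Pi.single i 1)
      - (Pi.single j 1 : Fin n → ℝ) ⬝ᵥ (P *ᵥ Pi.single j 1)) / 2 := by
  have h : P j i = P i j := by conv_lhs => rw [← hP, transpose_apply]
  simp only [mulVec_add, add_dotProduct, dotProduct_add, mulVec_single_one, single_one_dotProduct,
    col_apply, h]
  ring

theorem exists_tendsto_of_quad {P : ℕ → Matrix (Fin n) (Fin n) ℝ} (hP : ∀ t, (P t)ᵀ = P t)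
    (h : ∀ x, ∃ ℓ, Tendsto (fun t => x ⬝ᵥ (P t *ᵥ x)) atTop (𝓝 ℓ)) :
    ∃ X, Tendsto P atTop (𝓝 X) := by
  choose ℓ hℓ using h
  refine ⟨Matrix.of fun i j => (ℓ (Pi.single i 1 + Pi.single j 1) - ℓ (Pi.single i 1)
    - ℓ (Pi.single j 1)) / 2, tendsto_pi_nhds.2 fun i => tendsto_pi_nhds.2 fun j => ?_⟩
  refine Tendsto.congr (fun t => (apply_eq_polarization (hP t) i j).symm) ?_
  exact (((hℓ _).sub (hℓ _)).sub (hℓ _)).div_const 2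

theorem tendsto_of_quad {P : ℕ → Matrix (Fin n) (Fin n) ℝ} {X : Matrix (Fin n) (Fin n) ℝ}
    (hP : ∀ t, (P t)ᵀ = P t) (hX : Xᵀ = X)
    (h : ∀ x, Tendsto (fun t => x ⬝ᵥ (P t *ᵥ x)) atTop (𝓝 (x ⬝ᵥ (X *ᵥ x)))) :
    Tendsto P atTop (𝓝 X) := by
  refine tendsto_pi_nhds.2 fun i => tendsto_pi_nhds.2 fun j => ?_
  rw [apply_eq_polarization hX i j]
  refine Tendsto.congr (fun t => (apply_eq_polarization (hP t) i j).symm) ?_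
  exact (((h _).sub (h _)).sub (h _)).div_const 2

theorem tendsto_quad {α : Type*} {l : Filter α} {P : α → Matrix (Fin n) (Fin n) ℝ}
    {X : Matrix (Fin n) (Fin n) ℝ} (h : Tendsto P l (𝓝 X)) (x : Fin n → ℝ) :
    Tendsto (fun t => x ⬝ᵥ (P t *ᵥ x)) l (𝓝 (x ⬝ᵥ (X *ᵥ x))) :=
  tendsto_dotProduct tendsto_const_nhds (tendsto_matrix_mulVec h tendsto_const_nhds)

theorem abs_quad_le (P : Matrix (Fin n) (Fin n) ℝ) (x : Fin n → ℝ) :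
    |x ⬝ᵥ (P *ᵥ x)| ≤ (∑ i, ∑ j, |P i j|) * ‖x‖ ^ 2 := by
  simp only [dotProduct, mulVec, Finset.mul_sum, Finset.sum_mul]
  refine (Finset.abs_sum_le_sum_abs _ _).trans (Finset.sum_le_sum fun i _ =>
    (Finset.abs_sum_le_sum_abs _ _).trans (Finset.sum_le_sum fun j _ => ?_))
  have hi : |x i| ≤ ‖x‖ := norm_le_pi_norm x i
  have hj : |x j| ≤ ‖x‖ := norm_le_pi_norm x j
  rw [abs_mul, abs_mul]
  calc |x i| * (|P i j| * |x j|) = |P i j| * (|x i| * |x j|) := by ring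
    _ ≤ |P i j| * (‖x‖ * ‖x‖) := by gcongr
    _ = |P i j| * ‖x‖ ^ 2 := by ring

theorem norm_sq_le_dotProduct_self (x : Fin n → ℝ) : ‖x‖ ^ 2 ≤ x ⬝ᵥ x := by
  have h : ‖x‖ ≤ √(x ⬝ᵥ x) := by
    refine (pi_norm_le_iff_of_nonneg (Real.sqrt_nonneg _)).2 fun i => ?_
    refine Real.le_sqrt_of_sq_le ?_
    rw [Real.norm_eq_abs, sq_abs, dotProduct, sq]
    exact Finset.single_le_sum (f := fun i => x i * x i)
      (fun i _ => mul_self_nonneg (x i)) (Finset.mem_univ i)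
  calc ‖x‖ ^ 2 ≤ √(x ⬝ᵥ x) ^ 2 := by gcongr
    _ = x ⬝ᵥ x := Real.sq_sqrt (dotProduct_self_nonneg' x)

/-- `δ` is the minimum of the form on the compact unit sphere, extended by homogeneity. The sphere
is empty only in dimension zero. -/
theorem Matrix.PosDef.exists_pos_le_quad {P : Matrix (Fin n) (Fin n) ℝ} (hP : P.PosDef) :
    ∃ δ > 0, ∀ x : Fin n → ℝ, δ * ‖x‖ ^ 2 ≤ x ⬝ᵥ (P *ᵥ x) := by
  rcases (Metric.sphere (0 : Fin n → ℝ) 1).eq_empty_or_nonempty with he | hne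
  · refine ⟨1, one_pos, fun x => ?_⟩
    rcases eq_or_ne x 0 with rfl | hx
    · simp
    · exfalso
      have : ‖x‖⁻¹ • x ∈ Metric.sphere (0 : Fin n → ℝ) 1 := by
        simp [norm_smul, inv_mul_cancel₀ (norm_ne_zero_iff.2 hx)]
      rw [he] at this
      exact this
  · have hc : Continuous fun x : Fin n → ℝ => x ⬝ᵥ (P *ᵥ x) := by fun_prop
    obtain ⟨y, hy, hmin⟩ := (isCompact_sphere (0 : Fin n → ℝ) 1).exists_isMinOn hne hc.continuousOn
    have hy0 : y ≠ 0 := by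
      rintro rfl
      simp at hy
    refine ⟨y ⬝ᵥ (P *ᵥ y), hP.quad_pos hy0, fun x => ?_⟩
    rcases eq_or_ne x 0 with rfl | hx
    · simp
    · have hx' := norm_ne_zero_iff.2 hx
      have hm : ‖x‖⁻¹ • x ∈ Metric.sphere (0 : Fin n → ℝ) 1 := by
        simp [norm_smul, inv_mul_cancel₀ hx']
      have h := isMinOn_iff.1 hmin _ hm
      simp only [mulVec_smul, smul_dotProduct, dotProduct_smul, smul_eq_mul] at h
      have hp : 0 < ‖x‖ ^ 2 := by positivity
      calc y ⬝ᵥ (P *ᵥ y) * ‖x‖ ^ 2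
          ≤ (‖x‖⁻¹ * (‖x‖⁻¹ * (x ⬝ᵥ (P *ᵥ x)))) * ‖x‖ ^ 2 := by gcongr
        _ = x ⬝ᵥ (P *ᵥ x) := by field_simp

section Stable

attribute [local instance] Matrix.linftyOpNormedRing Matrix.linftyOpNormedAlgebra

/-- Gelfand's formula for the complexification, whose powers have the same `ℓ∞` operator norm as the
real powers. The rate `q` lies strictly between the spectral radius and one. -/
theorem IsStableMatrix.exists_norm_pow_mulVec_le {M : Matrix (Fin n) (Fin n) ℝ}
    (hM : IsStableMatrix M) :
    ∃ C q : ℝ, 0 ≤ C ∧ 0 ≤ q ∧ q < 1 ∧ ∀ (t : ℕ) (x : Fin n → ℝ),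
      ‖(M ^ t) *ᵥ x‖ ≤ C * q ^ t * ‖x‖ := by
  rcases Nat.eq_zero_or_pos n with rfl | hn
  · refine ⟨0, 0, le_rfl, le_rfl, one_pos, fun t x => ?_⟩
    rw [Subsingleton.elim ((M ^ t) *ᵥ x) 0]
    simp
  have : Nonempty (Fin n) := ⟨⟨0, hn⟩⟩
  set a : Matrix (Fin n) (Fin n) ℂ := M.map (fun a : ℝ => (a : ℂ)) with ha
  have hpow : ∀ t, a ^ t = (M ^ t).map (fun a : ℝ => (a : ℂ)) := fun t =>
    (Matrix.map_pow M Complex.ofRealHom t).symm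
  have hnorm : ∀ t, ‖M ^ t‖ = ‖a ^ t‖ := by
    intro t
    rw [hpow, Matrix.linfty_opNorm_def, Matrix.linfty_opNorm_def]
    simp
  have : CompleteSpace (Matrix (Fin n) (Fin n) ℂ) := FiniteDimensional.complete ℂ _
  have hr : spectralRadius ℂ a < (1 : NNReal) :=
    spectrum.spectralRadius_lt_of_forall_lt a fun z hz => by exact_mod_cast hM z hz
  obtain ⟨q, hq, hq1⟩ := ENNReal.lt_iff_exists_nnreal_btwn.1 hr
  have hev : ∀ᶠ t : ℕ in atTop, ‖M ^ t‖ ≤ 1 * ‖(q : ℝ) ^ t‖ := by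
    filter_upwards [(spectrum.pow_nnnorm_pow_one_div_tendsto_nhds_spectralRadius a).eventually_lt_const hq,
      eventually_gt_atTop 0] with t ht ht0
    have h1 : (‖a ^ t‖₊ : ENNReal) ≤ (q : ENNReal) ^ t := by
      have h2 := ENNReal.rpow_le_rpow ht.le (z := (t : ℝ)) (by positivity)
      rwa [← ENNReal.rpow_mul, one_div, inv_mul_cancel₀ (by positivity), ENNReal.rpow_one,
        ENNReal.rpow_natCast] at h2
    rw [hnorm, one_mul, Real.norm_of_nonneg (by positivity)]
    exact_mod_cast h1
  obtain ⟨C, hC, hb⟩ := Asymptotics.bound_of_isBigO_nat_atTop (Asymptotics.IsBigO.of_bound 1 hev)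
  -- A nonvanishing comparison sequence is what turns the eventual bound into a bound for all `t`.
  have hq0 : (q : ℝ) ≠ 0 := by
    have : (0 : ENNReal) < q := zero_le.trans_lt hq
    exact_mod_cast this.ne'
  refine ⟨C, q, hC.le, q.2, by exact_mod_cast hq1, fun t x => ?_⟩
  refine (Matrix.linfty_opNorm_mulVec _ _).trans ?_
  gcongr
  have := hb (x := t) (pow_ne_zero t hq0)
  rwa [Real.norm_of_nonneg (by positivity)] at this

end Stable

variable {A F Q P : Matrix (Fin n) (Fin n) ℝ}

theorem tendsto_riccatiMap {α : Type*} {l : Filter α} {P : α → Matrix (Fin n) (Fin n) ℝ}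
    {X : Matrix (Fin n) (Fin n) ℝ} (h : Tendsto P l (𝓝 X)) (hX : X.PosSemidef) (hF : Fᵀ = F) :
    Tendsto (fun a => riccatiMap A (F * F) Q (P a)) l (𝓝 (riccatiMap A (F * F) Q X)) := by
  refine tendsto_const_nhds.add (tendsto_matrix_mul (tendsto_matrix_mul (tendsto_matrix_mul
    tendsto_const_nhds (tendsto_matrix_inv ?_ (isUnit_det_one_add_mul hX hF))) h)
    tendsto_const_nhds)
  exact tendsto_const_nhds.add (tendsto_matrix_mul h tendsto_const_nhds)

/-- The first iterate is at least the zero start, and the Riccati map preserves the order. -/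
theorem quad_iterate_riccatiMap_zero_mono (hQ : Q.PosSemidef) (hF : Fᵀ = F) (x : Fin n → ℝ) :
    Monotone fun j => x ⬝ᵥ ((riccatiMap A (F * F) Q)^[j] 0 *ᵥ x) := by
  refine monotone_nat_of_le_succ fun j => ?_
  induction j generalizing x with
  | zero => simpa using (posSemidef_riccatiMap (A := A) hQ PosSemidef.zero hF).quad_nonneg x
  | succ j ih =>
    rw [Function.iterate_succ_apply', Function.iterate_succ_apply' _ (j + 1)]
    exact quad_riccatiMap_mono (posSemidef_iterate_riccatiMap hQ PosSemidef.zero hF _)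
      (posSemidef_iterate_riccatiMap hQ PosSemidef.zero hF _) hF ih x

/-- The optimal cost is at most that of a stabilizing feedback, which is dominated by a geometric
series. -/
theorem bddAbove_quad_iterate_riccatiMap_zero (hQ : Q.PosSemidef) (hF : Fᵀ = F)
    (hstab : IsStabilizable A F) (x : Fin n → ℝ) :
    BddAbove (Set.range fun j => x ⬝ᵥ ((riccatiMap A (F * F) Q)^[j] 0 *ᵥ x)) := by
  obtain ⟨K, hK⟩ := hstab
  obtain ⟨C, q, hC, hq, hq1, hb⟩ := hK.exists_norm_pow_mulVec_le
  set c := ∑ i, ∑ j, |(Q + Kᵀ * K) i j| with hc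
  have hc0 : 0 ≤ c := Finset.sum_nonneg fun i _ => Finset.sum_nonneg fun j _ => abs_nonneg _
  have hq2 : q ^ 2 < 1 := by nlinarith
  refine ⟨c * (C * ‖x‖) ^ 2 * (1 - q ^ 2)⁻¹, ?_⟩
  rintro _ ⟨j, rfl⟩
  refine (quad_iterate_riccatiMap_le_sum hQ PosSemidef.zero hF K j x).trans ?_
  rw [zero_mulVec, dotProduct_zero, add_zero]
  calc _ ≤ ∑ t ∈ Finset.range j, c * (C * ‖x‖) ^ 2 * (q ^ 2) ^ t := by
        refine Finset.sum_le_sum fun t _ => ?_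
        have e : ∀ y : Fin n → ℝ, y ⬝ᵥ (Q *ᵥ y) + (K *ᵥ y) ⬝ᵥ (K *ᵥ y)
            = y ⬝ᵥ ((Q + Kᵀ * K) *ᵥ y) := fun y => by
          rw [add_mulVec, dotProduct_add, ← mulVec_mulVec, dotProduct_mulVec_eq_transpose Kᵀ,
            transpose_transpose]
        rw [e]
        refine (le_abs_self _).trans ((abs_quad_le _ _).trans ?_)
        calc c * ‖((A + F * K) ^ t) *ᵥ x‖ ^ 2 ≤ c * (C * q ^ t * ‖x‖) ^ 2 := by
              gcongr
              exact hb t x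
          _ = c * (C * ‖x‖) ^ 2 * (q ^ 2) ^ t := by ring
    _ ≤ c * (C * ‖x‖) ^ 2 * (1 - q ^ 2)⁻¹ := by
        rw [← Finset.mul_sum]
        gcongr
        rw [← tsum_geometric_of_lt_one (by positivity) hq2]
        exact (summable_geometric_of_lt_one (by positivity) hq2).sum_le_tsum _
          fun _ _ => by positivity

/-- Zero optimal cost forces every optimal input to vanish, so the optimal trajectory is the free
one `Aⁱx`, and its state costs vanish too. -/
theorem quad_iterate_riccatiMap_zero_eq_zero (hQ : Q.PosSemidef) (hF : Fᵀ = F) (j : ℕ)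
    (x : Fin n → ℝ) (h : x ⬝ᵥ ((riccatiMap A (F * F) Q)^[j] 0 *ᵥ x) = 0) :
    ∀ i < j, ((A ^ i) *ᵥ x) ⬝ᵥ (Q *ᵥ ((A ^ i) *ᵥ x)) = 0 := by
  induction j generalizing x with
  | zero => simp
  | succ j ih =>
    have hP := posSemidef_iterate_riccatiMap (A := A) (P := 0) hQ PosSemidef.zero hF j
    rw [Function.iterate_succ_apply', quad_riccatiMap hP hF] at h
    have h0 := closedLoop_mulVec (A := A) hP hF x
    generalize closedLoop A (F * F) ((riccatiMap A (F * F) Q)^[j] 0) *ᵥ x = y at h h0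
    have h1 := hQ.quad_nonneg x
    have h2 := hP.quad_nonneg y
    have h3 := dotProduct_self_nonneg' (F *ᵥ (((riccatiMap A (F * F) Q)^[j] 0) *ᵥ y))
    have h4 : F *ᵥ (((riccatiMap A (F * F) Q)^[j] 0) *ᵥ y) = 0 :=
      dotProduct_self_eq_zero.1 (by linarith)
    rw [h4, neg_zero, mulVec_zero, add_zero] at h0
    intro i hi
    rcases i with _ | i
    · simp only [pow_zero, one_mulVec]
      linarith
    · rw [pow_succ, ← mulVec_mulVec, ← h0]
      exact ih y (by linarith) i (by omega)

/-- The Riccati iteration started at zero converges to a positive definite fixed point. -/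
theorem exists_posDef_fixedPoint {G : Matrix (Fin n) (Fin n) ℝ} (hQ : Q.PosSemidef) (hF : Fᵀ = F)
    (hstab : IsStabilizable A F) (hG : IsPSDSqrt G Q) (hobs : IsObservablePair A G) :
    ∃ X : Matrix (Fin n) (Fin n) ℝ, X.PosDef ∧ riccatiMap A (F * F) Q X = X ∧
      Tendsto (fun j => (riccatiMap A (F * F) Q)^[j] 0) atTop (𝓝 X) := by
  have hPs := posSemidef_iterate_riccatiMap (A := A) (P := 0) hQ PosSemidef.zero hF
  obtain ⟨X, hX⟩ := exists_tendsto_of_quad (fun j => (hPs j).transpose_eq) fun x =>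
    ⟨_, tendsto_atTop_ciSup (quad_iterate_riccatiMap_zero_mono hQ hF x)
      (bddAbove_quad_iterate_riccatiMap_zero hQ hF hstab x)⟩
  have hXt : Xᵀ = X := by
    refine tendsto_nhds_unique ?_ hX
    have hc : Continuous fun M : Matrix (Fin n) (Fin n) ℝ => Mᵀ := continuous_id.matrix_transpose
    refine Tendsto.congr (fun j => (hPs j).transpose_eq) ((hc.tendsto X).comp hX)
  have hle : ∀ j x, x ⬝ᵥ ((riccatiMap A (F * F) Q)^[j] 0 *ᵥ x) ≤ x ⬝ᵥ (X *ᵥ x) := fun j x =>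
    (quad_iterate_riccatiMap_zero_mono hQ hF x).ge_of_tendsto (tendsto_quad hX x) j
  have hX0 : X.PosSemidef := posSemidef_of_quad hXt fun x => by simpa using hle 0 x
  refine ⟨X, posDef_of_quad hXt fun x hx => ?_, ?_, hX⟩
  -- A null vector of `X` has zero cost at every horizon, hence zero output along the free
  -- trajectory; observability makes it zero.
  · refine lt_of_le_of_ne (hX0.quad_nonneg x) fun h => hx (hobs x fun i => ?_)
    have h1 := quad_iterate_riccatiMap_zero_eq_zero hQ hF (i + 1) x
      (le_antisymm ((hle _ x).trans h.ge) ((hPs _).quad_nonneg x)) i (by omega)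
    rw [← hG.2, ← mulVec_mulVec, dotProduct_mulVec_eq_transpose, hG.1.transpose_eq] at h1
    exact dotProduct_self_eq_zero.1 h1
  · refine tendsto_nhds_unique ((tendsto_riccatiMap hX hX0 hF).congr fun j => ?_)
      (hX.comp (tendsto_add_atTop_nat 1))
    exact (Function.iterate_succ_apply' _ _ _).symm

/-- `V = xᵀXx` is a Lyapunov function. For a suitable `T`, the cost collected over `T` steps is
already half of `V`, so `V` at least halves every `T` steps. -/
theorem tendsto_quad_closedLoop_pow {X : Matrix (Fin n) (Fin n) ℝ} (hQ : Q.PosSemidef)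
    (hF : Fᵀ = F) (hX : X.PosDef) (hfix : riccatiMap A (F * F) Q X = X)
    (hlim : Tendsto (fun j => (riccatiMap A (F * F) Q)^[j] 0) atTop (𝓝 X)) (x : Fin n → ℝ) :
    Tendsto (fun j => (closedLoop A (F * F) X ^ j) *ᵥ x) atTop (𝓝 0) := by
  obtain ⟨δ, hδ, hδX⟩ := hX.exists_pos_le_quad
  -- The iterates from zero converge to `X`, so some iterate differs from `X` by a form of size at
  -- most `(δ/2)‖y‖²`, which is at most half of `yᵀXy`.
  have hkey : ∃ T, ∀ y : Fin n → ℝ,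
      y ⬝ᵥ (X *ᵥ y) ≤ 2 * (y ⬝ᵥ ((riccatiMap A (F * F) Q)^[T] 0 *ᵥ y)) := by
    have h0 : Tendsto (fun j => ∑ i, ∑ l, |(X - (riccatiMap A (F * F) Q)^[j] 0) i l|) atTop
        (𝓝 (∑ i, ∑ l, |(X - X) i l|)) := by
      refine tendsto_finsetSum _ fun i _ => tendsto_finsetSum _ fun l _ => Tendsto.abs ?_
      have h1 := tendsto_pi_nhds.1 (tendsto_pi_nhds.1 (hlim.const_sub X) i) l
      exact h1
    simp only [sub_self, Matrix.zero_apply, abs_zero, Finset.sum_const_zero] at h0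
    obtain ⟨T, hT⟩ := (h0.eventually_lt_const (half_pos hδ)).exists
    refine ⟨T, fun y => ?_⟩
    have h1 := (le_abs_self _).trans (abs_quad_le (X - (riccatiMap A (F * F) Q)^[T] 0) y)
    rw [sub_mulVec, dotProduct_sub] at h1
    have h2 := hδX y
    have h3 : (∑ i, ∑ l, |(X - (riccatiMap A (F * F) Q)^[T] 0) i l|) * ‖y‖ ^ 2
        ≤ δ / 2 * ‖y‖ ^ 2 := by gcongr
    linarith
  obtain ⟨T, hT⟩ := hkey
  set V : ℕ → ℝ := fun j =>
    ((closedLoop A (F * F) X ^ j) *ᵥ x) ⬝ᵥ (X *ᵥ ((closedLoop A (F * F) X ^ j) *ᵥ x)) with hV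
  have hV0 : ∀ j, 0 ≤ V j := fun j => hX.posSemidef.quad_nonneg _
  have hcl : ∀ s j, V (j + s) ≤ V j
      - ((closedLoop A (F * F) X ^ j) *ᵥ x) ⬝ᵥ ((riccatiMap A (F * F) Q)^[s] 0 *ᵥ
          ((closedLoop A (F * F) X ^ j) *ᵥ x)) := by
    intro s j
    have h := quad_iterate_riccatiMap_le (P := 0) hQ PosSemidef.zero hF hX.posSemidef hfix s
      ((closedLoop A (F * F) X ^ j) *ᵥ x)
    rw [zero_mulVec, dotProduct_zero, mulVec_mulVec _ (closedLoop A (F * F) X ^ s), ← pow_add,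
      add_comm s j] at h
    linarith
  have hanti : Antitone V := antitone_nat_of_succ_le fun j => (hcl 1 j).trans
    (sub_le_self _ ((posSemidef_iterate_riccatiMap hQ PosSemidef.zero hF 1).quad_nonneg _))
  have hlimV := tendsto_atTop_ciInf hanti ⟨0, by rintro _ ⟨j, rfl⟩; exact hV0 j⟩
  set ℓ := ⨅ j, V j
  -- Pass to the limit in `V (j + T) ≤ V j / 2`.
  have hle : ℓ ≤ ℓ / 2 := by
    refine le_of_tendsto_of_tendsto' (hlimV.comp (tendsto_add_atTop_nat T)) (hlimV.div_const 2)
      fun j => ?_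
    have h1 := hcl T j
    have h2 := hT ((closedLoop A (F * F) X ^ j) *ᵥ x)
    simp only [Function.comp_apply, hV] at *
    linarith
  have hl0 : ℓ = 0 := le_antisymm (by linarith) (le_ciInf hV0)
  rw [hl0] at hlimV
  rw [tendsto_zero_iff_norm_tendsto_zero]
  have h1 : Tendsto (fun j => ‖(closedLoop A (F * F) X ^ j) *ᵥ x‖ ^ 2) atTop (𝓝 0) := by
    refine squeeze_zero (fun j => by positivity) (fun j => ?_) (by simpa using hlimV.const_mul δ⁻¹)
    rw [inv_mul_eq_div, le_div_iff₀ hδ, mul_comm]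
    exact hδX _
  have h2 := h1.sqrt
  simpa [Real.sqrt_sq (norm_nonneg _)] using h2

/-- The Riccati iteration converges from every positive semidefinite initial value. -/
theorem tendsto_iterate_riccatiMap {X : Matrix (Fin n) (Fin n) ℝ} (hQ : Q.PosSemidef)
    (hP : P.PosSemidef) (hF : Fᵀ = F) (hX : X.PosDef) (hfix : riccatiMap A (F * F) Q X = X)
    (hlim : Tendsto (fun j => (riccatiMap A (F * F) Q)^[j] 0) atTop (𝓝 X)) :
    Tendsto (fun j => (riccatiMap A (F * F) Q)^[j] P) atTop (𝓝 X) := by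
  have hmono : ∀ j x, x ⬝ᵥ ((riccatiMap A (F * F) Q)^[j] 0 *ᵥ x)
      ≤ x ⬝ᵥ ((riccatiMap A (F * F) Q)^[j] P *ᵥ x) := by
    intro j
    induction j with
    | zero => simpa using hP.quad_nonneg
    | succ j ih =>
      rw [Function.iterate_succ_apply', Function.iterate_succ_apply']
      exact quad_riccatiMap_mono (posSemidef_iterate_riccatiMap hQ PosSemidef.zero hF j)
        (posSemidef_iterate_riccatiMap hQ hP hF j) hF ih
  refine tendsto_of_quad (fun j => (posSemidef_iterate_riccatiMap hQ hP hF j).transpose_eq)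
    hX.posSemidef.transpose_eq fun x => ?_
  -- Squeeze between the iterates from zero and the comparison with `X`, whose two correction terms
  -- vanish along the stable closed loop.
  refine tendsto_of_tendsto_of_tendsto_of_le_of_le (tendsto_quad hlim x) ?_
    (fun j => hmono j x) (fun j => quad_iterate_riccatiMap_le hQ hP hF hX.posSemidef hfix j x)
  have h0 := tendsto_quad_closedLoop_pow hQ hF hX hfix hlim x
  have hq : ∀ Y : Matrix (Fin n) (Fin n) ℝ, Tendsto (fun j =>
      ((closedLoop A (F * F) X ^ j) *ᵥ x) ⬝ᵥ (Y *ᵥ ((closedLoop A (F * F) X ^ j) *ᵥ x)))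
      atTop (𝓝 0) := fun Y => by
    have := tendsto_dotProduct h0 (tendsto_matrix_mulVec (tendsto_const_nhds (x := Y)) h0)
    rwa [zero_dotProduct] at this
  simpa using (tendsto_const_nhds.sub (hq X)).add (hq P)

end Convergence

/-! ### Perturbed stable linear recursions. -/

section AffineRecursion

variable {n m : ℕ}

theorem norm_mulVec_le_sum_abs (M : Matrix (Fin n) (Fin m) ℝ) (x : Fin m → ℝ) :
    ‖M *ᵥ x‖ ≤ (∑ i, ∑ j, |M i j|) * ‖x‖ := by
  have h0 : 0 ≤ ∑ i, ∑ j, |M i j| :=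
    Finset.sum_nonneg fun i _ => Finset.sum_nonneg fun j _ => abs_nonneg _
  refine (pi_norm_le_iff_of_nonneg (by positivity)).2 fun i => ?_
  calc ‖(M *ᵥ x) i‖ ≤ ∑ j, |M i j| * ‖x‖ := by
        rw [Real.norm_eq_abs, mulVec, dotProduct]
        refine (Finset.abs_sum_le_sum_abs _ _).trans (Finset.sum_le_sum fun j _ => ?_)
        rw [abs_mul]
        gcongr
        exact norm_le_pi_norm x j
    _ = (∑ j, |M i j|) * ‖x‖ := by rw [Finset.sum_mul]
    _ ≤ _ := by
        gcongr
        exact Finset.single_le_sum (f := fun i => ∑ j, |M i j|)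
          (fun i _ => Finset.sum_nonneg fun j _ => abs_nonneg _) (Finset.mem_univ i)

theorem tendsto_sum_abs_zero {M : ℕ → Matrix (Fin n) (Fin m) ℝ} (h : Tendsto M atTop (𝓝 0)) :
    Tendsto (fun t => ∑ i, ∑ j, |M t i j|) atTop (𝓝 0) := by
  have h0 : Tendsto (fun t => ∑ i, ∑ j, |M t i j|) atTop
      (𝓝 (∑ i, ∑ j, |(0 : Matrix (Fin n) (Fin m) ℝ) i j|)) :=
    tendsto_finsetSum _ fun i _ => tendsto_finsetSum _ fun j _ =>
      (tendsto_pi_nhds.1 (tendsto_pi_nhds.1 h i) j).abs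
  simpa using h0

theorem tendsto_zero_of_le_mul_add {a δ : ℕ → ℝ} {θ : ℝ} (ha : ∀ j, 0 ≤ a j) (hθ : 0 ≤ θ)
    (hθ1 : θ < 1) (hδ : Tendsto δ atTop (𝓝 0)) (h : ∀ᶠ j in atTop, a (j + 1) ≤ θ * a j + δ j) :
    Tendsto a atTop (𝓝 0) := by
  refine Metric.tendsto_atTop.2 fun ε hε => ?_
  -- With input below `(1 - θ)ε/2` the recursion `a ↦ θa + δ` stays below `ε/2` plus a geometric
  -- remainder.
  obtain ⟨J, hJ⟩ := eventually_atTop.1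
    (h.and (hδ.eventually_lt_const (mul_pos (sub_pos.2 hθ1) (half_pos hε))))
  have hk : ∀ k, a (J + k) ≤ ε / 2 + θ ^ k * a J := by
    intro k
    induction k with
    | zero => simpa using (half_pos hε).le
    | succ k ih =>
      obtain ⟨h1, h2⟩ := hJ (J + k) (by omega)
      have h3 := mul_le_mul_of_nonneg_left ih hθ
      rw [← add_assoc, pow_succ]
      nlinarith
  have hlim : Tendsto (fun k => ε / 2 + θ ^ k * a J) atTop (𝓝 (ε / 2 + 0 * a J)) :=
    ((tendsto_pow_atTop_nhds_zero_of_lt_one hθ hθ1).mul_const _).const_add _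
  obtain ⟨K, hK⟩ := eventually_atTop.1
    (hlim.eventually_lt_const (u := ε) (by rw [zero_mul, add_zero]; exact half_lt_self hε))
  refine ⟨J + K, fun j hj => ?_⟩
  have h1 := hk (j - J)
  have h2 := hK (j - J) (by omega)
  rw [show J + (j - J) = j by omega] at h1
  rw [Real.dist_eq, sub_zero, abs_of_nonneg (ha j)]
  linarith

/-- A perturbed linear recursion with stable limit dynamics and vanishing input tends to zero. -/
theorem tendsto_zero_of_recursion {F : Matrix (Fin n) (Fin n) ℝ} {G : ℕ → Matrix (Fin n) (Fin n) ℝ}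
    {e d : ℕ → Fin n → ℝ} (hF : Tendsto (fun j => F ^ j) atTop (𝓝 0)) (hG : Tendsto G atTop (𝓝 F))
    (hd : Tendsto d atTop (𝓝 0)) (he : ∀ j, e (j + 1) = G j *ᵥ e j + d j) :
    Tendsto e atTop (𝓝 0) := by
  obtain ⟨p, hp, hp1⟩ := (((tendsto_sum_abs_zero hF).eventually_lt_const
    (half_pos one_pos)).and (eventually_ge_atTop 1)).exists
  -- An adapted norm: `N(Fv)` telescopes to `N v - ‖v‖ + ‖Fᵖv‖`, and `p` was chosen so that `‖Fᵖv‖ ≤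
  -- ‖v‖/2`. Thus `F` contracts `N` at rate `1 - 1/(2C)`.
  set N : (Fin n → ℝ) → ℝ := fun v => ∑ i ∈ Finset.range p, ‖(F ^ i) *ᵥ v‖ with hN
  set C : ℝ := 1 + ∑ i ∈ Finset.range p, ∑ a, ∑ b, |(F ^ i) a b| with hC
  have hC1 : 1 ≤ C := by
    rw [hC, le_add_iff_nonneg_right]
    exact Finset.sum_nonneg fun i _ => Finset.sum_nonneg fun a _ => Finset.sum_nonneg
      fun b _ => abs_nonneg _
  have hNadd : ∀ u v, N (u + v) ≤ N u + N v := fun u v => by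
    simp only [hN, ← Finset.sum_add_distrib, mulVec_add]
    exact Finset.sum_le_sum fun i _ => norm_add_le _ _
  have hNC : ∀ v, N v ≤ C * ‖v‖ := fun v => by
    calc N v ≤ ∑ i ∈ Finset.range p, (∑ a, ∑ b, |(F ^ i) a b|) * ‖v‖ :=
          Finset.sum_le_sum fun i _ => norm_mulVec_le_sum_abs _ _
      _ ≤ C * ‖v‖ := by
          rw [← Finset.sum_mul]
          gcongr
          linarith
  have hNge : ∀ v, ‖v‖ ≤ N v := fun v => by
    have := Finset.single_le_sum (f := fun i => ‖(F ^ i) *ᵥ v‖) (fun i _ => norm_nonneg _)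
      (Finset.mem_range.2 hp1)
    simpa using this
  have hNF : ∀ v, N (F *ᵥ v) ≤ (1 - 1 / (2 * C)) * N v := fun v => by
    have h1 : N (F *ᵥ v) + ‖v‖ = N v + ‖(F ^ p) *ᵥ v‖ := by
      have h2 := Finset.sum_range_succ (fun i => ‖(F ^ i) *ᵥ v‖) p
      rw [Finset.sum_range_succ'] at h2
      simp only [pow_zero, one_mulVec, pow_succ, ← mulVec_mulVec] at h2
      exact h2
    have h3 := norm_mulVec_le_sum_abs (F ^ p) v
    have h4 : (∑ i, ∑ j, |(F ^ p) i j|) * ‖v‖ ≤ 1 / 2 * ‖v‖ := by gcongr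
    have h5 : 1 / (2 * C) * N v ≤ 1 / 2 * ‖v‖ := by
      calc 1 / (2 * C) * N v ≤ 1 / (2 * C) * (C * ‖v‖) := by
            gcongr
            exact hNC v
        _ = 1 / 2 * ‖v‖ := by field_simp
    linarith
  have hGF : Tendsto (fun j => C * ∑ a, ∑ b, |(G j - F) a b|) atTop (𝓝 0) := by
    have := tendsto_sum_abs_zero (M := fun j => G j - F) (by simpa using hG.sub_const F)
    simpa using this.const_mul C
  have hNlim : Tendsto (fun j => N (e j)) atTop (𝓝 0) := by
    -- Half of the contraction margin `1/(2C)` is spent on the perturbation `G j - F`.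
    refine tendsto_zero_of_le_mul_add (θ := 1 - 1 / (4 * C)) (δ := fun j => C * ‖d j‖)
      (fun j => Finset.sum_nonneg fun i _ => norm_nonneg _) ?_ ?_ ?_ ?_
    · rw [sub_nonneg, div_le_one (by positivity)]
      linarith
    · have : 0 < 1 / (4 * C) := by positivity
      linarith
    · simpa using (tendsto_zero_iff_norm_tendsto_zero.1 hd).const_mul C
    · filter_upwards [hGF.eventually_lt_const (u := 1 / (4 * C)) (by positivity)] with j hj
      have e1 : e (j + 1) = F *ᵥ e j + (G j - F) *ᵥ e j + d j := by
        rw [he, sub_mulVec]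
        abel
      have h1 := hNadd (F *ᵥ e j + (G j - F) *ᵥ e j) (d j)
      have h2 := hNadd (F *ᵥ e j) ((G j - F) *ᵥ e j)
      have h3 := hNF (e j)
      have h4 := hNC (d j)
      have h5 : N ((G j - F) *ᵥ e j) ≤ 1 / (4 * C) * N (e j) := by
        calc N ((G j - F) *ᵥ e j) ≤ C * ((∑ a, ∑ b, |(G j - F) a b|) * ‖e j‖) := by
              refine (hNC _).trans ?_
              gcongr
              exact norm_mulVec_le_sum_abs _ _
          _ = (C * ∑ a, ∑ b, |(G j - F) a b|) * ‖e j‖ := by ring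
          _ ≤ 1 / (4 * C) * N (e j) := by
              gcongr
              exact hNge _
      have h6 : 1 / (2 * C) = 1 / (4 * C) + 1 / (4 * C) := by field_simp; norm_num
      rw [e1]
      rw [h6] at h3
      linarith
  rw [tendsto_zero_iff_norm_tendsto_zero]
  exact squeeze_zero (fun j => norm_nonneg _) (fun j => hNge _) hNlim

/-- A null vector of `I - F` would be fixed by all powers of `F`, which tend to zero. -/
theorem isUnit_det_one_sub_of_tendsto {F : Matrix (Fin n) (Fin n) ℝ}
    (hF : Tendsto (fun j => F ^ j) atTop (𝓝 0)) : IsUnit (1 - F).det := by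
  rw [isUnit_iff_ne_zero]
  intro h
  obtain ⟨v, hv, hv0⟩ := exists_mulVec_eq_zero_iff.2 h
  rw [sub_mulVec, one_mulVec, sub_eq_zero] at hv0
  have h1 : ∀ j, (F ^ j) *ᵥ v = v := fun j => by
    induction j with
    | zero => simp
    | succ j ih => rw [pow_succ, ← mulVec_mulVec, ← hv0, ih]
  have h2 := tendsto_matrix_mulVec hF (tendsto_const_nhds (x := v))
  simp only [h1, zero_mulVec] at h2
  exact hv (tendsto_nhds_unique tendsto_const_nhds h2)

end AffineRecursion

/-! ### The saddle point of the one-step game. -/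

noncomputable section OneStep

namespace MinimaxLQ

variable {n m k N : ℕ} (S : MinimaxLQ n m k N) (P : Matrix (Fin n) (Fin n) ℝ) (r : Fin n → ℝ)

/-- The quadratic function `xᵀ P x + 2 rᵀ x`. -/
def quad (x : Fin n → ℝ) : ℝ := x ⬝ᵥ (P *ᵥ x) + 2 * (r ⬝ᵥ x)

/-- The matrix `(I + P Φ)⁻¹`. -/
def gain : Matrix (Fin n) (Fin n) ℝ := (1 + P * S.Phi)⁻¹

/-- The minimizing control of the one-step game with terminal cost `quad P r`. -/
def control (x : Fin n → ℝ) : Fin m → ℝ :=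
  -(S.R⁻¹ * S.Bᵀ * S.gain P * P * S.A) *ᵥ x
    + -((S.R⁻¹ * S.Bᵀ * S.gain P) *ᵥ (P *ᵥ (S.Ξ *ᵥ S.wbar) + r))

/-- The curvature `λ I - Ξᵀ P Ξ` of the opponent's problem. -/
def curvature : Matrix (Fin k) (Fin k) ℝ :=
  S.lam • (1 : Matrix (Fin k) (Fin k) ℝ) - S.Ξᵀ * P * S.Ξ

/-- The opponent's best response to the undisturbed next state `z` for the sample point `v`. -/
def response (z : Fin n → ℝ) (v : Fin k → ℝ) : Fin k → ℝ :=
  (S.curvature P)⁻¹ *ᵥ (S.Ξᵀ *ᵥ (P *ᵥ z) + S.Ξᵀ *ᵥ r + S.lam • v)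

/-- The penalized value `quad P r (z + Ξ w) - λ |w - v|²` at the opponent's best response. -/
def envelope (z : Fin n → ℝ) (v : Fin k → ℝ) : ℝ :=
  quad P r (z + S.Ξ *ᵥ S.response P r z v)
    - S.lam * ((S.response P r z v - v) ⬝ᵥ (S.response P r z v - v))

/-- The undisturbed next state under the minimizing control. -/
def drift (x : Fin n → ℝ) : Fin n → ℝ := S.A *ᵥ x + S.B *ᵥ S.control P r x

/-- The linear coefficient of the value function one stage earlier. -/
def nextLinear : Fin n → ℝ := (S.Aᵀ * S.gain P) *ᵥ (P *ᵥ (S.Ξ *ᵥ S.wbar) + r)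

/-- The constant gained in one stage. -/
def stageConst : ℝ :=
  trace ((1 - (1 / S.lam) • (S.Ξᵀ * P * S.Ξ))⁻¹ * (S.Ξᵀ * P * S.Ξ) * S.Sig)
    + S.wbar ⬝ᵥ ((S.Ξᵀ * (S.gain P - (1 - (1 / S.lam) • (P * S.Ξ * S.Ξᵀ))⁻¹)
        * P * S.Ξ) *ᵥ S.wbar)
    + ((2 : ℝ) • (S.Ξ *ᵥ S.wbar) - S.Phi *ᵥ r) ⬝ᵥ (S.gain P *ᵥ r)

variable {P r}

theorem quad_add (hP : Pᵀ = P) (y d : Fin n → ℝ) :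
    quad P r (y + d) = quad P r y + 2 * ((P *ᵥ y + r) ⬝ᵥ d) + d ⬝ᵥ (P *ᵥ d) := by
  have h1 := dotProduct_mulVec_comm hP y d
  have h2 := dotProduct_comm d (P *ᵥ y)
  simp only [quad, mulVec_add, dotProduct_add, add_dotProduct]
  linarith

variable (hlam : 0 < S.lam) (hP : Pᵀ = P) (hD : (S.curvature P).PosDef)

include hD in
-- The first-order condition of the opponent's problem; `eq_response` is its uniqueness.
theorem curvature_mulVec_response (z : Fin n → ℝ) (v : Fin k → ℝ) :
    S.curvature P *ᵥ S.response P r z v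
      = S.Ξᵀ *ᵥ (P *ᵥ z) + S.Ξᵀ *ᵥ r + S.lam • v := by
  rw [response, mulVec_mulVec,
    Matrix.mul_nonsing_inv _ ((Matrix.isUnit_iff_isUnit_det _).1 hD.isUnit), one_mulVec]

include hD in
theorem eq_response {z : Fin n → ℝ} {v w : Fin k → ℝ}
    (h : S.curvature P *ᵥ w = S.Ξᵀ *ᵥ (P *ᵥ z) + S.Ξᵀ *ᵥ r + S.lam • v) :
    w = S.response P r z v := by
  rw [response, ← h, mulVec_mulVec,
    Matrix.nonsing_inv_mul _ ((Matrix.isUnit_iff_isUnit_det _).1 hD.isUnit), one_mulVec]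

include hP hD in
-- The objective is quadratic in `w` with Hessian `-2(λI - ΞᵀPΞ)`, so a deviation `d` from the
-- stationary point loses `dᵀ(λI - ΞᵀPΞ)d ≥ 0`.
theorem quad_sub_le_envelope (z : Fin n → ℝ) (v w : Fin k → ℝ) :
    quad P r (z + S.Ξ *ᵥ w) - S.lam * ((w - v) ⬝ᵥ (w - v)) ≤ S.envelope P r z v := by
  have h := S.curvature_mulVec_response (r := r) hD z v
  rw [envelope]
  generalize S.response P r z v = w₀ at *
  obtain ⟨d, rfl⟩ : ∃ d, w = w₀ + d := ⟨w - w₀, by abel⟩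
  have e1 : z + S.Ξ *ᵥ (w₀ + d) = (z + S.Ξ *ᵥ w₀) + S.Ξ *ᵥ d := by rw [mulVec_add, add_assoc]
  have e2 : w₀ + d - v = (w₀ - v) + d := by abel
  have h1 := congrArg (fun u => u ⬝ᵥ d) h
  have h2 := hD.posSemidef.quad_nonneg d
  have h3 := dotProduct_comm d w₀
  have h6 := dotProduct_comm d v
  simp only [curvature, sub_mulVec, smul_mulVec, one_mulVec, sub_dotProduct, add_dotProduct,
    smul_dotProduct, smul_eq_mul, dotProduct_sub, dotProduct_smul, ← mulVec_mulVec] at h1 h2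
  have h4 : d ⬝ᵥ (S.Ξᵀ *ᵥ (P *ᵥ (S.Ξ *ᵥ d))) = (S.Ξ *ᵥ d) ⬝ᵥ (P *ᵥ (S.Ξ *ᵥ d)) := by
    rw [dotProduct_mulVec_eq_transpose S.Ξᵀ, transpose_transpose]
  have h5 : ∀ u : Fin n → ℝ, (S.Ξᵀ *ᵥ u) ⬝ᵥ d = u ⬝ᵥ (S.Ξ *ᵥ d) := fun u =>
    (dotProduct_mulVec_eq_transpose S.Ξ u d).symm
  rw [h4] at h2
  rw [h5, h5, h5] at h1
  rw [e1, quad_add hP, e2, mulVec_add]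
  simp only [add_dotProduct, dotProduct_add, sub_dotProduct, dotProduct_sub] at *
  rw [h3, h6]
  linarith

theorem transpose_Phi (hR : S.R.PosDef) : S.Phiᵀ = S.Phi := by
  rw [Phi, transpose_sub, transpose_smul, transpose_mul, transpose_mul, transpose_mul,
    transpose_nonsing_inv, hR.posSemidef.transpose_eq, transpose_transpose, transpose_transpose,
    Matrix.mul_assoc]

variable (P r) in
/-- The costate at the saddle point. -/
def costate (x : Fin n → ℝ) : Fin n → ℝ :=
  S.gain P *ᵥ (P *ᵥ (S.A *ᵥ x + S.Ξ *ᵥ S.wbar) + r)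

variable (P r) in
/-- The mean of the next state at the saddle point. -/
def nextMean (x : Fin n → ℝ) : Fin n → ℝ :=
  (S.gain P)ᵀ *ᵥ (S.A *ᵥ x + S.Ξ *ᵥ S.wbar - S.Phi *ᵥ r)

variable (hR : S.R.PosDef) (hU : IsUnit (1 + P * S.Phi).det)

include hP hR hU in
theorem one_add_mulVec_nextMean (x : Fin n → ℝ) :
    (1 + S.Phi * P) *ᵥ S.nextMean P r x = S.A *ᵥ x + S.Ξ *ᵥ S.wbar - S.Phi *ᵥ r := by
  have hU' : IsUnit (1 + S.Phi * P).det := by rwa [det_one_add_mul_comm]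
  rw [nextMean, gain, transpose_inv_one_add_mul hP (S.transpose_Phi hR), mulVec_mulVec,
    Matrix.mul_nonsing_inv _ hU', one_mulVec]

include hP hR hU in
-- Identifies the costate as half the gradient of the terminal function at the mean next state. With
-- `nextMean_eq` it forms the Hamiltonian system of the saddle point.
theorem costate_eq (x : Fin n → ℝ) : S.costate P r x = P *ᵥ S.nextMean P r x + r := by
  have h : (1 + P * S.Phi) *ᵥ (P *ᵥ S.nextMean P r x + r)
      = P *ᵥ (S.A *ᵥ x + S.Ξ *ᵥ S.wbar) + r := by
    have h1 := congrArg (fun u => P *ᵥ u) (S.one_add_mulVec_nextMean (r := r) hP hR hU x)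
    simp only [add_mulVec, one_mulVec, mulVec_add, mulVec_sub, ← mulVec_mulVec] at h1 ⊢
    linear_combination h1
  rw [costate, gain, ← h, mulVec_mulVec, Matrix.nonsing_inv_mul _ hU, one_mulVec]

include hP hR hU in
theorem nextMean_eq (x : Fin n → ℝ) :
    S.nextMean P r x = S.A *ᵥ x + S.Ξ *ᵥ S.wbar - S.Phi *ᵥ S.costate P r x := by
  have h1 := S.one_add_mulVec_nextMean (r := r) hP hR hU x
  rw [add_mulVec, one_mulVec, ← mulVec_mulVec] at h1
  rw [S.costate_eq hP hR hU, mulVec_add, ← sub_sub, sub_right_comm, ← h1]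
  abel

theorem control_eq (x : Fin n → ℝ) :
    S.control P r x = -(S.R⁻¹ *ᵥ (S.Bᵀ *ᵥ S.costate P r x)) := by
  simp only [control, costate, mulVec_add, ← mulVec_mulVec, neg_mulVec]
  abel

include hP hR hU in
-- The two summands of `Φ` separate: `BR⁻¹Bᵀp` is the control action, and `λ⁻¹ΞΞᵀp` is the shift of
-- the mean disturbance.
theorem nextMean_eq_drift_add (x : Fin n → ℝ) :
    S.nextMean P r x = S.drift P r x
      + S.Ξ *ᵥ (S.wbar + S.lam⁻¹ • (S.Ξᵀ *ᵥ S.costate P r x)) := by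
  rw [S.nextMean_eq hP hR hU, drift, control_eq, Phi]
  simp only [sub_mulVec, mulVec_add, mulVec_neg, smul_mulVec, mulVec_smul, ← mulVec_mulVec,
    one_div]
  abel

include hlam hP hD hR hU in
/-- The best responses at the saddle point are the mean plus a linear image of the deviations of
the sample points. -/
theorem response_eq (x : Fin n → ℝ) (v : Fin k → ℝ) :
    S.response P r (S.drift P r x) v
      = S.wbar + S.lam⁻¹ • (S.Ξᵀ *ᵥ S.costate P r x)
        + (S.lam • (S.curvature P)⁻¹) *ᵥ (v - S.wbar) := by
  -- It is enough to check the stationarity equation: the mean part solves it by the Hamiltonian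
  -- system, the deviation part by inverting the curvature.
  refine (S.eq_response hD ?_).symm
  have h1 : S.curvature P *ᵥ ((S.lam • (S.curvature P)⁻¹) *ᵥ (v - S.wbar))
      = S.lam • (v - S.wbar) := by
    rw [smul_mulVec, mulVec_smul, mulVec_mulVec,
      Matrix.mul_nonsing_inv _ ((Matrix.isUnit_iff_isUnit_det _).1 hD.isUnit), one_mulVec]
  have h2 := congrArg (fun u => S.Ξᵀ *ᵥ u) (S.costate_eq (r := r) hP hR hU x)
  rw [S.nextMean_eq_drift_add hP hR hU] at h2
  simp only [mulVec_add, mulVec_smul] at h2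
  rw [mulVec_add, h1, curvature, sub_mulVec, smul_mulVec, one_mulVec, smul_add, smul_smul,
    mul_inv_cancel₀ hlam.ne', one_smul, smul_sub]
  simp only [mulVec_add, mulVec_smul, ← mulVec_mulVec]
  conv_lhs => rw [add_sub_assoc, add_assoc]
  nth_rewrite 1 [h2]
  abel

theorem sum_sub_wbar [NeZero N] : ∑ i, (S.what i - S.wbar) = 0 := by
  have hN : (N : ℝ) ≠ 0 := by exact_mod_cast NeZero.ne N
  rw [Finset.sum_sub_distrib, Finset.sum_const, Finset.card_univ, Fintype.card_fin, wbar,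
    ← Nat.cast_smul_eq_nsmul ℝ, smul_smul, mul_inv_cancel₀ hN, one_smul, sub_self]

include hlam hP hD hR hU in
theorem mean_response [NeZero N] (x : Fin n → ℝ) :
    (N : ℝ)⁻¹ • ∑ i, S.response P r (S.drift P r x) (S.what i)
      = S.wbar + S.lam⁻¹ • (S.Ξᵀ *ᵥ S.costate P r x) := by
  have hN : (N : ℝ) ≠ 0 := by exact_mod_cast NeZero.ne N
  simp only [S.response_eq hlam hP hD hR hU]
  rw [Finset.sum_add_distrib, ← mulVec_sum, S.sum_sub_wbar, mulVec_zero, add_zero,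
    Finset.sum_const, Finset.card_univ, Fintype.card_fin, ← Nat.cast_smul_eq_nsmul ℝ, smul_smul,
    inv_mul_cancel₀ hN, one_smul]

end MinimaxLQ

end OneStep

/-! ### The value of the one-step game. -/

noncomputable section OneStepValue

namespace MinimaxLQ

variable {n m k N : ℕ} (S : MinimaxLQ n m k N) {P : Matrix (Fin n) (Fin n) ℝ} {r : Fin n → ℝ}

theorem one_sub_eq_smul_curvature (hlam : 0 < S.lam) (P : Matrix (Fin n) (Fin n) ℝ) :
    1 - (1 / S.lam) • (S.Ξᵀ * P * S.Ξ) = S.lam⁻¹ • S.curvature P := by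
  rw [curvature, smul_sub, smul_smul, inv_mul_cancel₀ hlam.ne', one_smul, one_div]

theorem isUnit_det_one_sub (hlam : 0 < S.lam) (hD : (S.curvature P).PosDef) :
    IsUnit (1 - (1 / S.lam) • (S.Ξᵀ * P * S.Ξ)).det := by
  rw [← Matrix.isUnit_iff_isUnit_det, S.one_sub_eq_smul_curvature hlam]
  exact (hD.smul (inv_pos.2 hlam)).isUnit

theorem isUnit_det_one_sub' (hlam : 0 < S.lam) (hD : (S.curvature P).PosDef) :
    IsUnit (1 - (1 / S.lam) • (P * S.Ξ * S.Ξᵀ)).det := by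
  have h := det_one_sub_mul_comm (P * S.Ξ) ((1 / S.lam) • S.Ξᵀ)
  rw [Matrix.mul_smul, Matrix.smul_mul, ← Matrix.mul_assoc] at h
  rw [h]
  exact S.isUnit_det_one_sub hlam hD

theorem inv_one_sub_eq (hlam : 0 < S.lam) (hD : (S.curvature P).PosDef) :
    (1 - (1 / S.lam) • (S.Ξᵀ * P * S.Ξ))⁻¹ = S.lam • (S.curvature P)⁻¹ := by
  refine Matrix.inv_eq_right_inv ?_
  rw [S.one_sub_eq_smul_curvature hlam, smul_mul_smul_comm, inv_mul_cancel₀ hlam.ne', one_smul,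
    Matrix.mul_nonsing_inv _ ((Matrix.isUnit_iff_isUnit_det _).1 hD.isUnit)]

theorem inv_curvature_mul_comm (hD : (S.curvature P).PosDef) :
    (S.curvature P)⁻¹ * (S.Ξᵀ * P * S.Ξ) = (S.Ξᵀ * P * S.Ξ) * (S.curvature P)⁻¹ := by
  have hu := (Matrix.isUnit_iff_isUnit_det _).1 hD.isUnit
  have h : S.Ξᵀ * P * S.Ξ = S.lam • 1 - S.curvature P := by rw [curvature, sub_sub_cancel]
  rw [h, Matrix.mul_sub, Matrix.sub_mul, Matrix.nonsing_inv_mul _ hu, Matrix.mul_nonsing_inv _ hu]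
  simp

/-- A push-through identity: it expresses the `n × n` inverse in the closed form of `ρ` by the `k ×
k` curvature that the computation produces. -/
theorem inv_one_sub_mul (hlam : 0 < S.lam) (hD : (S.curvature P).PosDef) :
    (1 - (1 / S.lam) • (P * S.Ξ * S.Ξᵀ))⁻¹ * (P * S.Ξ)
      = P * S.Ξ * (S.lam • (S.curvature P)⁻¹) := by
  have hu1 := S.isUnit_det_one_sub hlam hD
  have hu2 := S.isUnit_det_one_sub' hlam hD
  rw [← S.inv_one_sub_eq hlam hD]
  have e : (1 - (1 / S.lam) • (P * S.Ξ * S.Ξᵀ)) * (P * S.Ξ)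
      = (P * S.Ξ) * (1 - (1 / S.lam) • (S.Ξᵀ * P * S.Ξ)) := by
    rw [Matrix.sub_mul, Matrix.mul_sub, Matrix.one_mul, Matrix.mul_one, Matrix.smul_mul,
      Matrix.mul_smul]
    simp only [Matrix.mul_assoc]
  calc _ = (1 - (1 / S.lam) • (P * S.Ξ * S.Ξᵀ))⁻¹
        * ((P * S.Ξ) * (1 - (1 / S.lam) • (S.Ξᵀ * P * S.Ξ)))
        * (1 - (1 / S.lam) • (S.Ξᵀ * P * S.Ξ))⁻¹ := by
        rw [Matrix.mul_assoc _ (P * S.Ξ * _), Matrix.mul_assoc (P * S.Ξ),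
          Matrix.mul_nonsing_inv _ hu1, Matrix.mul_one]
    _ = _ := by rw [← e, ← Matrix.mul_assoc, Matrix.nonsing_inv_mul _ hu2, Matrix.one_mul]

theorem sum_quad_sub_wbar [NeZero N] (H : Matrix (Fin k) (Fin k) ℝ) :
    (N : ℝ)⁻¹ * ∑ i, (S.what i - S.wbar) ⬝ᵥ (H *ᵥ (S.what i - S.wbar))
      = trace (H * S.Sig) - S.wbar ⬝ᵥ (H *ᵥ S.wbar) := by
  have hN : (N : ℝ) ≠ 0 := by exact_mod_cast NeZero.ne N
  have h1 : trace (H * S.Sig) = (N : ℝ)⁻¹ * ∑ i, S.what i ⬝ᵥ (H *ᵥ S.what i) := by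
    rw [Sig, Matrix.mul_smul, trace_smul, Matrix.mul_sum, trace_sum, smul_eq_mul]
    simp only [mul_vecMulVec, trace_vecMulVec]
    simp only [dotProduct_comm (H *ᵥ _)]
  have h2 : ∑ i, (S.what i - S.wbar) ⬝ᵥ (H *ᵥ (S.what i - S.wbar))
      = ∑ i, S.what i ⬝ᵥ (H *ᵥ S.what i) - N * (S.wbar ⬝ᵥ (H *ᵥ S.wbar)) := by
    have e : ∀ i, (S.what i - S.wbar) ⬝ᵥ (H *ᵥ (S.what i - S.wbar))
        = S.what i ⬝ᵥ (H *ᵥ S.what i) - S.wbar ⬝ᵥ (H *ᵥ S.wbar)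
          - ((S.what i - S.wbar) ⬝ᵥ (H *ᵥ S.wbar)
            + S.wbar ⬝ᵥ (H *ᵥ (S.what i - S.wbar))) := fun i => by
      simp only [mulVec_sub, dotProduct_sub, sub_dotProduct]
      ring
    simp only [e]
    rw [Finset.sum_sub_distrib, Finset.sum_add_distrib, ← sum_dotProduct, ← dotProduct_sum,
      ← mulVec_sum, S.sum_sub_wbar, Finset.sum_sub_distrib]
    simp
  rw [h2, h1, mul_sub, inv_mul_cancel_left₀ hN]

variable (hlam : 0 < S.lam) (hP : Pᵀ = P) (hD : (S.curvature P).PosDef) (hR : S.R.PosDef)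
  (hU : IsUnit (1 + P * S.Phi).det)

include hlam hP hD hR hU in
-- Expands the envelope in the deviation `v - w̄`: averaging over the sample removes the linear term
-- and turns the quadratic one into a trace.
theorem envelope_drift_eq (x : Fin n → ℝ) (v : Fin k → ℝ) :
    S.envelope P r (S.drift P r x) v
      = quad P r (S.nextMean P r x)
        - S.lam⁻¹ * ((S.Ξᵀ *ᵥ S.costate P r x) ⬝ᵥ (S.Ξᵀ *ᵥ S.costate P r x))
        + 2 * ((S.Ξᵀ *ᵥ S.costate P r x) ⬝ᵥ (v - S.wbar))
        + (v - S.wbar) ⬝ᵥ ((S.Ξᵀ * P * S.Ξ * (S.lam • (S.curvature P)⁻¹)) *ᵥ (v - S.wbar)) := by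
  have hu := (Matrix.isUnit_iff_isUnit_det _).1 hD.isUnit
  set s := (S.lam • (S.curvature P)⁻¹) *ᵥ (v - S.wbar) with hs
  set g := S.Ξᵀ *ᵥ S.costate P r x with hg
  have hres : S.response P r (S.drift P r x) v = S.wbar + S.lam⁻¹ • g + s :=
    S.response_eq hlam hP hD hR hU x v
  have e1 : S.drift P r x + S.Ξ *ᵥ (S.wbar + S.lam⁻¹ • g + s) = S.nextMean P r x + S.Ξ *ᵥ s := by
    rw [S.nextMean_eq_drift_add hP hR hU, mulVec_add _ _ s, add_assoc]
  have e2 : S.wbar + S.lam⁻¹ • g + s - v = S.lam⁻¹ • g + (s - (v - S.wbar)) := by abel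
  -- This is `(λI - ΞᵀPΞ)s = λ(v - w̄)` solved for the `ΞᵀPΞ` term.
  have hSs : (S.Ξᵀ * P * S.Ξ) *ᵥ s = S.lam • (s - (v - S.wbar)) := by
    have h : S.curvature P *ᵥ s = S.lam • (v - S.wbar) := by
      rw [hs, smul_mulVec, mulVec_smul, mulVec_mulVec, Matrix.mul_nonsing_inv _ hu, one_mulVec]
    rw [curvature, sub_mulVec, smul_mulVec, one_mulVec] at h
    rw [smul_sub, ← h, sub_sub_cancel]
  have e3 : (S.Ξ *ᵥ s) ⬝ᵥ (P *ᵥ (S.Ξ *ᵥ s)) = s ⬝ᵥ (S.lam • (s - (v - S.wbar))) := by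
    rw [← hSs, ← mulVec_mulVec, ← mulVec_mulVec, dotProduct_mulVec_eq_transpose S.Ξᵀ,
      transpose_transpose]
  have e4 : S.costate P r x ⬝ᵥ (S.Ξ *ᵥ s) = g ⬝ᵥ s := by
    rw [dotProduct_mulVec_eq_transpose]
  rw [envelope, hres, e1, quad_add hP, ← S.costate_eq hP hR hU, e3, e4, e2, ← mulVec_mulVec, ← hs,
    hSs]
  generalize v - S.wbar = w
  have c1 := dotProduct_comm g s
  have c2 := dotProduct_comm g w
  have c3 := dotProduct_comm s w
  have hl : S.lam * S.lam⁻¹ = 1 := mul_inv_cancel₀ hlam.ne'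
  simp only [dotProduct_add, add_dotProduct, dotProduct_sub, sub_dotProduct, dotProduct_smul,
    smul_dotProduct, smul_eq_mul, c1, c2, c3]
  linear_combination (-(S.lam⁻¹ * (g ⬝ᵥ g)) - 2 * (s ⬝ᵥ g) + 2 * (w ⬝ᵥ g)) * hl

include hP hR hU in
theorem transpose_gain_mul : (S.gain P * P)ᵀ = S.gain P * P := by
  rw [gain, transpose_mul, transpose_inv_one_add_mul hP (S.transpose_Phi hR), hP,
    inv_one_add_mul_mul hU]

include hP hR hU in
-- The left side is what remains of the stage value, apart from `xᵀQx` and the sample covariance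
-- terms, once the terms in `Φp` have cancelled.
theorem costate_dotProduct_add (x : Fin n → ℝ) :
    S.costate P r x ⬝ᵥ (S.A *ᵥ x + S.Ξ *ᵥ S.wbar) + r ⬝ᵥ S.nextMean P r x
      = x ⬝ᵥ ((S.Aᵀ * S.gain P * P * S.A) *ᵥ x) + 2 * (S.nextLinear P r ⬝ᵥ x)
        + (S.Ξ *ᵥ S.wbar) ⬝ᵥ ((S.gain P * P) *ᵥ (S.Ξ *ᵥ S.wbar))
        + ((2 : ℝ) • (S.Ξ *ᵥ S.wbar) - S.Phi *ᵥ r) ⬝ᵥ (S.gain P *ᵥ r) := by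
  have hH := S.transpose_gain_mul hP hR hU
  have e1 : x ⬝ᵥ ((S.Aᵀ * S.gain P * P * S.A) *ᵥ x)
      = (S.A *ᵥ x) ⬝ᵥ ((S.gain P * P) *ᵥ (S.A *ᵥ x)) := by
    rw [Matrix.mul_assoc S.Aᵀ, Matrix.mul_assoc S.Aᵀ, ← mulVec_mulVec, ← mulVec_mulVec,
      dotProduct_mulVec_eq_transpose S.Aᵀ, transpose_transpose]
  have e2 : S.nextLinear P r ⬝ᵥ x
      = (S.A *ᵥ x) ⬝ᵥ ((S.gain P * P) *ᵥ (S.Ξ *ᵥ S.wbar) + S.gain P *ᵥ r) := by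
    rw [nextLinear, dotProduct_comm, ← mulVec_mulVec, dotProduct_mulVec_eq_transpose S.Aᵀ,
      transpose_transpose, mulVec_add, mulVec_mulVec _ (S.gain P)]
  have e3 : ∀ a : Fin n → ℝ, r ⬝ᵥ ((S.gain P)ᵀ *ᵥ a) = a ⬝ᵥ (S.gain P *ᵥ r) := fun a => by
    rw [dotProduct_mulVec_eq_transpose, transpose_transpose, dotProduct_comm]
  have e4 : S.costate P r x = (S.gain P * P) *ᵥ (S.A *ᵥ x) + (S.gain P * P) *ᵥ (S.Ξ *ᵥ S.wbar)
      + S.gain P *ᵥ r := by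
    rw [costate, mulVec_add, mulVec_mulVec, mulVec_add]
  rw [e1, e2, e4, nextMean, e3, dotProduct_comm _ (S.A *ᵥ x + _)]
  have c1 := dotProduct_mulVec_comm hH (S.A *ᵥ x) (S.Ξ *ᵥ S.wbar)
  simp only [dotProduct_add, add_dotProduct, sub_dotProduct, smul_dotProduct, smul_eq_mul]
  linarith

include hlam hP hD hR hU in
/-- The value of the one-step game with terminal cost `quad P r`. -/
theorem mean_envelope [NeZero N] (x : Fin n → ℝ) :
    x ⬝ᵥ (S.Q *ᵥ x) + S.control P r x ⬝ᵥ (S.R *ᵥ S.control P r x)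
        + (N : ℝ)⁻¹ * ∑ i, S.envelope P r (S.drift P r x) (S.what i)
      = quad (riccatiMap S.A S.Phi S.Q P) (S.nextLinear P r) x + S.stageConst P r := by
  have hN : (N : ℝ) ≠ 0 := by exact_mod_cast NeZero.ne N
  have h1 : (N : ℝ)⁻¹ * ∑ i, S.envelope P r (S.drift P r x) (S.what i)
      = quad P r (S.nextMean P r x)
        - S.lam⁻¹ * ((S.Ξᵀ *ᵥ S.costate P r x) ⬝ᵥ (S.Ξᵀ *ᵥ S.costate P r x))
        + (trace ((S.Ξᵀ * P * S.Ξ * (S.lam • (S.curvature P)⁻¹)) * S.Sig)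
          - S.wbar ⬝ᵥ ((S.Ξᵀ * P * S.Ξ * (S.lam • (S.curvature P)⁻¹)) *ᵥ S.wbar)) := by
    simp only [S.envelope_drift_eq hlam hP hD hR hU]
    rw [Finset.sum_add_distrib, mul_add, S.sum_quad_sub_wbar, Finset.sum_add_distrib,
      ← Finset.mul_sum, ← dotProduct_sum, S.sum_sub_wbar]
    simp only [dotProduct_zero, mul_zero, add_zero, Finset.sum_const, Finset.card_univ,
      Fintype.card_fin, nsmul_eq_mul]
    rw [inv_mul_cancel_left₀ hN]
  -- The `λ⁻¹|Ξᵀp|²` here cancels the mean transport penalty in `h1`.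
  have h2 : S.control P r x ⬝ᵥ (S.R *ᵥ S.control P r x)
      = S.costate P r x ⬝ᵥ (S.Phi *ᵥ S.costate P r x)
        + S.lam⁻¹ * ((S.Ξᵀ *ᵥ S.costate P r x) ⬝ᵥ (S.Ξᵀ *ᵥ S.costate P r x)) := by
    rw [control_eq, mulVec_neg, dotProduct_neg, neg_dotProduct, neg_neg,
      mulVec_mulVec _ S.R S.R⁻¹,
      Matrix.mul_nonsing_inv _ ((Matrix.isUnit_iff_isUnit_det _).1 hR.isUnit), one_mulVec, Phi,
      sub_mulVec, dotProduct_sub, smul_mulVec, dotProduct_smul, smul_eq_mul, one_div,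
      ← mulVec_mulVec, ← mulVec_mulVec, ← mulVec_mulVec, dotProduct_mulVec_eq_transpose S.Ξ,
      dotProduct_mulVec_eq_transpose S.B, dotProduct_comm (S.R⁻¹ *ᵥ _)]
    ring
  have h3 : quad P r (S.nextMean P r x) = S.costate P r x ⬝ᵥ S.nextMean P r x
      + r ⬝ᵥ S.nextMean P r x := by
    rw [quad, S.costate_eq hP hR hU, add_dotProduct, dotProduct_comm (P *ᵥ _)]
    ring
  have h4 : S.Phi *ᵥ S.costate P r x = S.A *ᵥ x + S.Ξ *ᵥ S.wbar - S.nextMean P r x := by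
    rw [S.nextMean_eq hP hR hU, sub_sub_cancel]
  have h5 := S.costate_dotProduct_add (r := r) hP hR hU x
  have h6 : S.wbar ⬝ᵥ ((S.Ξᵀ * (S.gain P - (1 - (1 / S.lam) • (P * S.Ξ * S.Ξᵀ))⁻¹)
        * P * S.Ξ) *ᵥ S.wbar)
      = (S.Ξ *ᵥ S.wbar) ⬝ᵥ ((S.gain P * P) *ᵥ (S.Ξ *ᵥ S.wbar))
        - S.wbar ⬝ᵥ ((S.Ξᵀ * P * S.Ξ * (S.lam • (S.curvature P)⁻¹)) *ᵥ S.wbar) := by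
    have e : S.Ξᵀ * (S.gain P - (1 - (1 / S.lam) • (P * S.Ξ * S.Ξᵀ))⁻¹) * P * S.Ξ
        = S.Ξᵀ * (S.gain P * P * S.Ξ) - S.Ξᵀ * P * S.Ξ * (S.lam • (S.curvature P)⁻¹) := by
      rw [Matrix.mul_assoc, Matrix.mul_assoc, Matrix.sub_mul, S.inv_one_sub_mul hlam hD,
        Matrix.mul_sub]
      simp only [Matrix.mul_assoc]
    rw [e, sub_mulVec, dotProduct_sub, ← mulVec_mulVec, ← mulVec_mulVec,
      dotProduct_mulVec_eq_transpose S.Ξᵀ, transpose_transpose]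
  have h7 : (1 - (1 / S.lam) • (S.Ξᵀ * P * S.Ξ))⁻¹ * (S.Ξᵀ * P * S.Ξ)
      = S.Ξᵀ * P * S.Ξ * (S.lam • (S.curvature P)⁻¹) := by
    rw [S.inv_one_sub_eq hlam hD, Matrix.smul_mul, S.inv_curvature_mul_comm hD, Matrix.mul_smul]
  rw [h1, h2, h3, h4, quad, stageConst, h6, h7, riccatiMap, add_mulVec, dotProduct_add,
    dotProduct_sub]
  rw [gain] at h5
  simp only [gain]
  linarith

include hlam hP hD hR hU in
/-- Against the saddle-point response of the opponent, no control does better than the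
minimizing control. -/
theorem le_cost_of_response [NeZero N] (hP0 : P.PosSemidef) (x : Fin n → ℝ) (u : Fin m → ℝ) :
    quad (riccatiMap S.A S.Phi S.Q P) (S.nextLinear P r) x + S.stageConst P r
      ≤ x ⬝ᵥ (S.Q *ᵥ x) + u ⬝ᵥ (S.R *ᵥ u) + (N : ℝ)⁻¹ * ∑ i,
        (quad P r (S.A *ᵥ x + S.B *ᵥ u + S.Ξ *ᵥ S.response P r (S.drift P r x) (S.what i))
          - S.lam * ((S.response P r (S.drift P r x) (S.what i) - S.what i)
            ⬝ᵥ (S.response P r (S.drift P r x) (S.what i) - S.what i))) := by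
  have hN : (N : ℝ) ≠ 0 := by exact_mod_cast NeZero.ne N
  rw [← S.mean_envelope hlam hP hD hR hU]
  obtain ⟨d, rfl⟩ : ∃ d, u = S.control P r x + d := ⟨u - S.control P r x, by abel⟩
  have e1 : ∀ i, quad P r (S.A *ᵥ x + S.B *ᵥ (S.control P r x + d)
        + S.Ξ *ᵥ S.response P r (S.drift P r x) (S.what i))
      = quad P r (S.drift P r x + S.Ξ *ᵥ S.response P r (S.drift P r x) (S.what i))
        + 2 * ((P *ᵥ (S.drift P r x + S.Ξ *ᵥ S.response P r (S.drift P r x) (S.what i)) + r)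
          ⬝ᵥ (S.B *ᵥ d)) + (S.B *ᵥ d) ⬝ᵥ (P *ᵥ (S.B *ᵥ d)) := fun i => by
    rw [← quad_add hP, drift, mulVec_add S.B]
    congr 1
    abel
  -- The gradient of `V` averaged over the response atoms is the costate, because the atoms have the
  -- saddle-point mean. With `e3` this cancels the first-order terms in `d`, leaving only
  -- nonnegative quadratic ones.
  have e2 : (N : ℝ)⁻¹ * ∑ i,
      ((P *ᵥ (S.drift P r x + S.Ξ *ᵥ S.response P r (S.drift P r x) (S.what i)) + r)
          ⬝ᵥ (S.B *ᵥ d)) = S.costate P r x ⬝ᵥ (S.B *ᵥ d) := by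
    rw [← sum_dotProduct, ← smul_eq_mul, ← smul_dotProduct]
    congr 1
    rw [S.costate_eq hP hR hU, S.nextMean_eq_drift_add hP hR hU, ← S.mean_response hlam hP hD hR hU,
      Finset.sum_add_distrib, ← mulVec_sum, Finset.sum_add_distrib, ← mulVec_sum]
    simp only [Finset.sum_const, Finset.card_univ, Fintype.card_fin, ← Nat.cast_smul_eq_nsmul ℝ]
    simp only [smul_add, mulVec_add, mulVec_smul, smul_smul, inv_mul_cancel₀ hN, one_smul]
  have e3 : S.costate P r x ⬝ᵥ (S.B *ᵥ d) = -(d ⬝ᵥ (S.R *ᵥ S.control P r x)) := by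
    rw [control_eq, mulVec_neg, mulVec_mulVec, dotProduct_neg, neg_neg,
      Matrix.mul_nonsing_inv _ ((Matrix.isUnit_iff_isUnit_det _).1 hR.isUnit), one_mulVec,
      dotProduct_mulVec_eq_transpose, dotProduct_comm]
  have e4 := dotProduct_mulVec_comm hR.posSemidef.transpose_eq (S.control P r x) d
  have e5 := hR.posSemidef.quad_nonneg d
  have e6 := hP0.quad_nonneg (S.B *ᵥ d)
  have e7 : (N : ℝ)⁻¹ * ∑ i,
        (quad P r (S.A *ᵥ x + S.B *ᵥ (S.control P r x + d)
            + S.Ξ *ᵥ S.response P r (S.drift P r x) (S.what i))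
          - S.lam * ((S.response P r (S.drift P r x) (S.what i) - S.what i)
            ⬝ᵥ (S.response P r (S.drift P r x) (S.what i) - S.what i)))
      = (N : ℝ)⁻¹ * ∑ i, S.envelope P r (S.drift P r x) (S.what i)
        + 2 * (S.costate P r x ⬝ᵥ (S.B *ᵥ d)) + (S.B *ᵥ d) ⬝ᵥ (P *ᵥ (S.B *ᵥ d)) := by
    rw [← e2]
    simp only [e1, envelope, Finset.sum_add_distrib, Finset.sum_sub_distrib, ← Finset.mul_sum,
      Finset.sum_const, Finset.card_univ, Fintype.card_fin, nsmul_eq_mul]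
    field_simp
    ring
  rw [e7, e3]
  simp only [mulVec_add, add_dotProduct, dotProduct_add]
  linarith

end MinimaxLQ

end OneStepValue

/-! ### Duality and moment bounds for the Wasserstein distance. -/

section Transport

variable {N k : ℕ}

theorem integrable_empirical (hN : N ≠ 0) (w : Fin N → Fin k → ℝ) {f : (Fin k → ℝ) → ℝ} :
    Integrable f (empirical w) := by
  refine Integrable.smul_measure ?_ (by simp [hN])
  rw [integrable_finsetSum_measure]
  exact fun i _ => integrable_dirac (by simp)

theorem integral_empirical (w : Fin N → Fin k → ℝ) (f : (Fin k → ℝ) → ℝ) :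
    ∫ z, f z ∂(empirical w) = (N : ℝ)⁻¹ * ∑ i, f (w i) := by
  rw [empirical, integral_smul_measure,
    integral_finsetSum_measure fun i _ => integrable_dirac (by simp)]
  simp

theorem isProbabilityMeasure_empirical (hN : N ≠ 0) (w : Fin N → Fin k → ℝ) :
    IsProbabilityMeasure (empirical w) := ⟨by
  simp only [empirical, Measure.smul_apply, Measure.finsetSum_apply, measure_univ,
    Finset.sum_const, Finset.card_univ, Fintype.card_fin, smul_eq_mul, nsmul_eq_mul, mul_one]
  exact ENNReal.inv_mul_cancel (by exact_mod_cast hN) (ENNReal.natCast_ne_top N)⟩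

/-- A pushforward from the index set, so that two samples can be coupled index by index. -/
theorem empirical_eq_map (w : Fin N → Fin k → ℝ) :
    empirical w = ((N : ENNReal)⁻¹ • ∑ i : Fin N, Measure.dirac i).map w := by
  ext s hs
  rw [Measure.map_apply (measurable_of_finite w) hs]
  simp only [empirical, Measure.smul_apply, Measure.finsetSum_apply, Measure.dirac_apply' _ hs,
    Measure.dirac_apply' _ (measurable_of_finite w hs)]
  rfl

theorem measurable_empirical {α : Type*} [MeasurableSpace α] {w : α → Fin N → Fin k → ℝ}
    (hw : ∀ i, Measurable fun x => w x i) : Measurable fun x => empirical (w x) := by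
  refine Measure.measurable_of_measurable_coe _ fun s hs => ?_
  simp only [empirical, Measure.smul_apply, Measure.finsetSum_apply, smul_eq_mul]
  refine Measurable.const_mul (Finset.measurable_sum _ fun i _ => ?_) _
  exact (Measure.measurable_coe hs).comp (Measure.measurable_dirac.comp (hw i))

/-- A linear upper bound in the cost of every coupling is an upper bound in `W2`. -/
theorem le_mul_W2_sq_add {μ ν : Measure (Fin k → ℝ)} {a K c : ENNReal} (hK : K ≠ 0)
    (hK' : K ≠ ⊤)
    (h : ∀ η : Measure ((Fin k → ℝ) × (Fin k → ℝ)), η.map Prod.fst = μ → η.map Prod.snd = ν →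
      a ≤ K * ∫⁻ z, ENNReal.ofReal ((z.1 - z.2) ⬝ᵥ (z.1 - z.2)) ∂η + c) :
    a ≤ K * W2 μ ν ^ 2 + c := by
  rw [← tsub_le_iff_right, mul_comm, ← ENNReal.div_le_iff hK hK']
  -- `W2` is an infimum of square roots, so the bound is solved for the coupling cost and its root
  -- is taken before the infimum.
  have h1 : ((a - c) / K) ^ ((1 : ℝ) / 2) ≤ W2 μ ν := by
    refine le_iInf fun η => le_iInf fun h1 => le_iInf fun h2 => ?_
    refine ENNReal.rpow_le_rpow ?_ (by norm_num)
    rw [ENNReal.div_le_iff hK hK', tsub_le_iff_right, mul_comm]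
    exact h η h1 h2
  calc (a - c) / K = (((a - c) / K) ^ ((1 : ℝ) / 2)) ^ 2 := by
        rw [← ENNReal.rpow_natCast, ← ENNReal.rpow_mul]
        norm_num
    _ ≤ W2 μ ν ^ 2 := by gcongr

/-- The cost of the coupling that pairs atoms with the same index. -/
theorem W2_empirical_sq_le (w v : Fin N → Fin k → ℝ) :
    W2 (empirical w) (empirical v) ^ 2
      ≤ (N : ENNReal)⁻¹ * ∑ i, ENNReal.ofReal ((w i - v i) ⬝ᵥ (w i - v i)) := by
  set η : Measure ((Fin k → ℝ) × (Fin k → ℝ)) :=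
    ((N : ENNReal)⁻¹ • ∑ i : Fin N, Measure.dirac i).map fun i => (w i, v i) with hη
  have h1 : η.map Prod.fst = empirical w := by
    rw [hη, Measure.map_map measurable_fst (measurable_of_finite _), empirical_eq_map]
    rfl
  have h2 : η.map Prod.snd = empirical v := by
    rw [hη, Measure.map_map measurable_snd (measurable_of_finite _), empirical_eq_map]
    rfl
  have h3 : ∫⁻ z, ENNReal.ofReal ((z.1 - z.2) ⬝ᵥ (z.1 - z.2)) ∂η
      = (N : ENNReal)⁻¹ * ∑ i, ENNReal.ofReal ((w i - v i) ⬝ᵥ (w i - v i)) := by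
    have hc : Continuous fun z : (Fin k → ℝ) × (Fin k → ℝ) => (z.1 - z.2) ⬝ᵥ (z.1 - z.2) :=
      (continuous_fst.sub continuous_snd).dotProduct (continuous_fst.sub continuous_snd)
    rw [hη, lintegral_map hc.measurable.ennreal_ofReal (measurable_of_finite _)]
    simp [lintegral_finsetSum_measure]
  have h4 : W2 (empirical w) (empirical v)
      ≤ (∫⁻ z, ENNReal.ofReal ((z.1 - z.2) ⬝ᵥ (z.1 - z.2)) ∂η) ^ ((1 : ℝ) / 2) :=
    iInf_le_of_le η (iInf_le_of_le h1 (iInf_le_of_le h2 le_rfl))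
  calc W2 (empirical w) (empirical v) ^ 2
      ≤ ((∫⁻ z, ENNReal.ofReal ((z.1 - z.2) ⬝ᵥ (z.1 - z.2)) ∂η) ^ ((1 : ℝ) / 2)) ^ 2 := by gcongr
    _ = ∫⁻ z, ENNReal.ofReal ((z.1 - z.2) ⬝ᵥ (z.1 - z.2)) ∂η := by
        rw [← ENNReal.rpow_natCast, ← ENNReal.rpow_mul]
        norm_num
    _ = _ := h3

/-- From `‖w‖² ≤ 2|w - z|² + 2‖z‖²`: a law at finite distance from the sample has a finite second
moment. -/
theorem lintegral_norm_sq_le {μ : Measure (Fin k → ℝ)} (v : Fin N → Fin k → ℝ)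
    (η : Measure ((Fin k → ℝ) × (Fin k → ℝ))) (h1 : η.map Prod.fst = μ)
    (h2 : η.map Prod.snd = empirical v) :
    ∫⁻ w, ENNReal.ofReal (‖w‖ ^ 2) ∂μ
      ≤ 2 * ∫⁻ z, ENNReal.ofReal ((z.1 - z.2) ⬝ᵥ (z.1 - z.2)) ∂η
        + 2 * ∫⁻ w, ENNReal.ofReal (‖w‖ ^ 2) ∂(empirical v) := by
  have hm : Measurable fun w : Fin k → ℝ => ENNReal.ofReal (‖w‖ ^ 2) :=
    (by fun_prop : Continuous fun w : Fin k → ℝ => ‖w‖ ^ 2).measurable.ennreal_ofReal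
  have hm2 : Measurable fun z : (Fin k → ℝ) × (Fin k → ℝ) => 2 * ENNReal.ofReal (‖z.2‖ ^ 2) :=
    (hm.comp measurable_snd).const_mul _
  rw [← h1, ← h2, lintegral_map hm measurable_fst, lintegral_map hm measurable_snd,
    ← lintegral_const_mul' _ _ (by simp), ← lintegral_const_mul' _ _ (by simp),
    ← lintegral_add_right _ hm2]
  refine lintegral_mono fun z => ?_
  rw [← ENNReal.ofReal_ofNat, ← ENNReal.ofReal_mul (by norm_num), ← ENNReal.ofReal_mul (by norm_num),
    ← ENNReal.ofReal_add (by have := dotProduct_self_nonneg' (z.1 - z.2); positivity)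
      (by positivity)]
  refine ENNReal.ofReal_le_ofReal ?_
  have h3 := norm_sq_le_dotProduct_self (z.1 - z.2)
  have h4 : ‖z.1‖ ≤ ‖z.1 - z.2‖ + ‖z.2‖ := by simpa using norm_add_le (z.1 - z.2) z.2
  have h5 : ‖z.1‖ ^ 2 ≤ (‖z.1 - z.2‖ + ‖z.2‖) ^ 2 := by gcongr
  nlinarith [sq_nonneg (‖z.1 - z.2‖ - ‖z.2‖)]

theorem integrable_of_abs_le {α : Type*} [MeasurableSpace α] {μ : Measure α}
    [IsFiniteMeasure μ] {f g : α → ℝ} (hf : Measurable f) (hg : Integrable g μ) {C : ℝ}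
    (h : ∀ y, |f y| ≤ C * (1 + g y)) : Integrable f μ :=
  (((integrable_const (1 : ℝ)).add hg).const_mul C).mono' hf.aestronglyMeasurable
    (ae_of_all _ h)

theorem integral_le_toReal_lintegral_ofReal {α : Type*} [MeasurableSpace α] {μ : Measure α}
    {f : α → ℝ} (hf : Integrable f μ) : ∫ y, f y ∂μ ≤ (∫⁻ y, ENNReal.ofReal (f y) ∂μ).toReal := by
  rw [integral_eq_lintegral_pos_part_sub_lintegral_neg_part hf]
  exact sub_le_self _ ENNReal.toReal_nonneg

theorem integrable_norm_sq_iff {α : Type*} [MeasurableSpace α] {μ : Measure α}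
    {f : α → ℝ} (hf : Measurable f) :
    Integrable (fun w => f w ^ 2) μ ↔ ∫⁻ w, ENNReal.ofReal (f w ^ 2) ∂μ ≠ ⊤ := by
  rw [← lt_top_iff_ne_top, ← hasFiniteIntegral_iff_ofReal (ae_of_all _ fun w => by positivity)]
  exact ⟨fun h => h.2, fun h => ⟨(hf.pow_const 2).aestronglyMeasurable, h⟩⟩

/-- Weak duality for the transport problem: a function dominated by the transport cost up to a
function of the target. -/
theorem ofReal_integral_sub_le_W2 (hN : N ≠ 0) {μ : Measure (Fin k → ℝ)} [IsProbabilityMeasure μ]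
    (v : Fin N → Fin k → ℝ) {f φ : (Fin k → ℝ) → ℝ} {lam C : ℝ} (hlam : 0 < lam)
    (hf : Measurable f) (hφ : Measurable φ) (hC : ∀ w, |f w| ≤ C * (1 + ‖w‖ ^ 2))
    (h : ∀ w z, f w ≤ lam * ((w - z) ⬝ᵥ (w - z)) + φ z) :
    ENNReal.ofReal (∫ w, f w ∂μ - (N : ℝ)⁻¹ * ∑ i, φ (v i))
      ≤ ENNReal.ofReal lam * W2 μ (empirical v) ^ 2 := by
  have hl0 : ENNReal.ofReal lam ≠ 0 := by simpa using hlam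
  rw [← add_zero (ENNReal.ofReal lam * _)]
  refine le_mul_W2_sq_add hl0 ENNReal.ofReal_ne_top fun η h1 h2 => ?_
  rw [add_zero]
  have hcc : Continuous fun z : (Fin k → ℝ) × (Fin k → ℝ) => (z.1 - z.2) ⬝ᵥ (z.1 - z.2) :=
    (continuous_fst.sub continuous_snd).dotProduct (continuous_fst.sub continuous_snd)
  -- A coupling of infinite cost gives no constraint; one of finite cost makes `f` integrable, so
  -- the pointwise bound can be integrated.
  by_cases hfin : ∫⁻ z, ENNReal.ofReal ((z.1 - z.2) ⬝ᵥ (z.1 - z.2)) ∂η = ⊤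
  · rw [hfin, ENNReal.mul_top hl0]
    exact le_top
  have hcost : Integrable (fun z : (Fin k → ℝ) × (Fin k → ℝ) => (z.1 - z.2) ⬝ᵥ (z.1 - z.2)) η :=
    ⟨hcc.measurable.aestronglyMeasurable, (hasFiniteIntegral_iff_ofReal
      (ae_of_all _ fun z => dotProduct_self_nonneg' _)).2 (lt_top_iff_ne_top.2 hfin)⟩
  have hint : Integrable (fun w => ‖w‖ ^ 2) μ := by
    rw [integrable_norm_sq_iff measurable_norm]
    refine ne_top_of_le_ne_top (ENNReal.add_ne_top.2 ⟨ENNReal.mul_ne_top (by simp) hfin, ?_⟩)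
      (lintegral_norm_sq_le v η h1 h2)
    refine ENNReal.mul_ne_top (by simp) ?_
    exact (integrable_norm_sq_iff measurable_norm).1 (integrable_empirical hN v)
  have hfμ : Integrable f μ := integrable_of_abs_le hf hint hC
  have hφν : Integrable φ (empirical v) := integrable_empirical hN v
  have e1 : ∫ w, f w ∂μ = ∫ z, f z.1 ∂η := by
    rw [← h1, integral_map measurable_fst.aemeasurable hf.aestronglyMeasurable]
  have e2 : (N : ℝ)⁻¹ * ∑ i, φ (v i) = ∫ z, φ z.2 ∂η := by
    rw [← integral_empirical, ← h2,
      integral_map measurable_snd.aemeasurable hφ.aestronglyMeasurable]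
  have i1 : Integrable (fun z : (Fin k → ℝ) × (Fin k → ℝ) => f z.1) η :=
    (h1 ▸ hfμ : Integrable f (η.map Prod.fst)).comp_measurable measurable_fst
  have i2 : Integrable (fun z : (Fin k → ℝ) × (Fin k → ℝ) => φ z.2) η :=
    (h2 ▸ hφν : Integrable φ (η.map Prod.snd)).comp_measurable measurable_snd
  rw [← ofReal_integral_eq_lintegral_ofReal hcost (ae_of_all _ fun z => dotProduct_self_nonneg' _),
    ← ENNReal.ofReal_mul hlam.le, e1, e2, ← integral_sub i1 i2, ← integral_const_mul]
  refine ENNReal.ofReal_le_ofReal (integral_mono (i1.sub i2) (hcost.const_mul lam) fun z => ?_)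
  have := h z.1 z.2
  simp only
  linarith

end Transport

/-! ### State transitions as images of composition products. -/

section Composition

/-- Gives the law of the next state a form to which change of variables and Fubini apply. -/
theorem bind_map_eq_map_compProd {E F G : Type*} [MeasurableSpace E] [MeasurableSpace F]
    [MeasurableSpace G] {m : Measure E} [SFinite m] {κ : Kernel E F} [IsSFiniteKernel κ]
    {g : E × F → G} (hg : Measurable g) :
    (m.bind fun y => (κ y).map fun w => g (y, w)) = (m ⊗ₘ κ).map g := by
  have hgy : ∀ y, Measurable fun w => g (y, w) := fun y => hg.comp measurable_prodMk_left
  have hmeas : Measurable fun y => (κ y).map fun w => g (y, w) := by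
    refine Measure.measurable_of_measurable_coe _ fun s hs => ?_
    simp only [Measure.map_apply (hgy _) hs]
    exact Kernel.measurable_kernel_prodMk_left (hg hs)
  ext s hs
  rw [Measure.bind_apply hs hmeas.aemeasurable, Measure.map_apply hg hs,
    Measure.compProd_apply (hg hs)]
  refine lintegral_congr fun y => ?_
  rw [Measure.map_apply (hgy y) hs]
  rfl

end Composition

/-! ### Growth bounds and the opponent's stage inequality. -/

namespace MinimaxLQ

variable {n m k N : ℕ} (S : MinimaxLQ n m k N) {P : Matrix (Fin n) (Fin n) ℝ} {r : Fin n → ℝ}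

theorem continuous_quad : Continuous (quad P r) := by
  unfold quad
  fun_prop

theorem exists_abs_quad_le (P : Matrix (Fin n) (Fin n) ℝ) (r : Fin n → ℝ) :
    ∃ C, ∀ y, |quad P r y| ≤ C * (1 + ‖y‖ ^ 2) := by
  refine ⟨∑ i, ∑ j, |P i j| + 2 * ∑ i, |r i|, fun y => ?_⟩
  have h1 := abs_quad_le P y
  have h0 : 0 ≤ ∑ i, ∑ j, |P i j| :=
    Finset.sum_nonneg fun i _ => Finset.sum_nonneg fun j _ => abs_nonneg _
  have h0' : 0 ≤ ∑ i, |r i| := Finset.sum_nonneg fun i _ => abs_nonneg _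
  have h2 : |r ⬝ᵥ y| ≤ (∑ i, |r i|) * ‖y‖ := by
    rw [Finset.sum_mul]
    refine (Finset.abs_sum_le_sum_abs _ _).trans (Finset.sum_le_sum fun i _ => ?_)
    rw [abs_mul]
    gcongr
    exact norm_le_pi_norm y i
  have h3 : ‖y‖ ≤ 1 + ‖y‖ ^ 2 := by nlinarith [sq_nonneg (‖y‖ - 1), norm_nonneg y]
  calc |quad P r y| ≤ |y ⬝ᵥ (P *ᵥ y)| + 2 * |r ⬝ᵥ y| := by
        rw [quad]
        refine (abs_add_le _ _).trans ?_
        rw [abs_mul, abs_two]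
    _ ≤ (∑ i, ∑ j, |P i j|) * ‖y‖ ^ 2 + 2 * ((∑ i, |r i|) * ‖y‖) := by gcongr
    _ ≤ (∑ i, ∑ j, |P i j|) * (1 + ‖y‖ ^ 2) + 2 * ((∑ i, |r i|) * (1 + ‖y‖ ^ 2)) := by
        gcongr
        linarith
    _ = _ := by ring

/-- The next state as a function of the state and the disturbance. -/
def nextState (u : (Fin n → ℝ) → Fin m → ℝ) (p : (Fin n → ℝ) × (Fin k → ℝ)) : Fin n → ℝ :=
  S.A *ᵥ p.1 + S.B *ᵥ u p.1 + S.Ξ *ᵥ p.2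

/-- The stage cost `xᵀ Q x + u(x)ᵀ R u(x)`. -/
def stageCost (u : (Fin n → ℝ) → Fin m → ℝ) (y : Fin n → ℝ) : ℝ :=
  y ⬝ᵥ (S.Q *ᵥ y) + u y ⬝ᵥ (S.R *ᵥ u y)

theorem measurable_nextState {u : (Fin n → ℝ) → Fin m → ℝ} (hu : Measurable u) :
    Measurable (S.nextState u) := by
  have h : Continuous fun q : (Fin n → ℝ) × (Fin m → ℝ) × (Fin k → ℝ) =>
      S.A *ᵥ q.1 + S.B *ᵥ q.2.1 + S.Ξ *ᵥ q.2.2 := by fun_prop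
  exact h.measurable.comp (measurable_fst.prodMk ((hu.comp measurable_fst).prodMk measurable_snd))

theorem measurable_stageCost {u : (Fin n → ℝ) → Fin m → ℝ} (hu : Measurable u) :
    Measurable (S.stageCost u) := by
  have h : Continuous fun q : (Fin n → ℝ) × (Fin m → ℝ) =>
      q.1 ⬝ᵥ (S.Q *ᵥ q.1) + q.2 ⬝ᵥ (S.R *ᵥ q.2) := by fun_prop
  exact h.measurable.comp (measurable_id.prodMk hu)

theorem stageCost_nonneg (hQ : S.Q.PosSemidef) (hR : S.R.PosDef)
    (u : (Fin n → ℝ) → Fin m → ℝ) (y : Fin n → ℝ) : 0 ≤ S.stageCost u y :=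
  add_nonneg (hQ.quad_nonneg y) (hR.posSemidef.quad_nonneg (u y))

theorem continuous_control : Continuous (S.control P r) := by
  unfold control
  fun_prop

theorem exists_norm_control_le (P : Matrix (Fin n) (Fin n) ℝ) (r : Fin n → ℝ) :
    ∃ c, 0 ≤ c ∧ ∀ y, ‖S.control P r y‖ ≤ c * (1 + ‖y‖) := by
  obtain ⟨K, L, hKL⟩ : ∃ (K : Matrix (Fin m) (Fin n) ℝ) (L : Fin m → ℝ),
      ∀ y, S.control P r y = K *ᵥ y + L := ⟨_, _, fun _ => rfl⟩
  have h0 : 0 ≤ ∑ i, ∑ j, |K i j| :=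
    Finset.sum_nonneg fun i _ => Finset.sum_nonneg fun j _ => abs_nonneg _
  refine ⟨∑ i, ∑ j, |K i j| + ‖L‖, by positivity, fun y => ?_⟩
  rw [hKL]
  refine (norm_add_le _ _).trans ?_
  have h1 := norm_mulVec_le_sum_abs K y
  have h2 : 0 ≤ ‖L‖ * ‖y‖ := by positivity
  linarith

theorem exists_abs_stageCost_le {u : (Fin n → ℝ) → Fin m → ℝ} {c : ℝ}
    (hc : ∀ y, ‖u y‖ ≤ c * (1 + ‖y‖)) : ∃ C, ∀ y, |S.stageCost u y| ≤ C * (1 + ‖y‖ ^ 2) := by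
  have h0 : 0 ≤ ∑ i, ∑ j, |S.Q i j| :=
    Finset.sum_nonneg fun i _ => Finset.sum_nonneg fun j _ => abs_nonneg _
  have h0' : 0 ≤ ∑ i, ∑ j, |S.R i j| :=
    Finset.sum_nonneg fun i _ => Finset.sum_nonneg fun j _ => abs_nonneg _
  refine ⟨∑ i, ∑ j, |S.Q i j| + (∑ i, ∑ j, |S.R i j|) * (2 * c ^ 2), fun y => ?_⟩
  have h1 : ‖u y‖ ^ 2 ≤ 2 * c ^ 2 * (1 + ‖y‖ ^ 2) := by
    calc ‖u y‖ ^ 2 ≤ (c * (1 + ‖y‖)) ^ 2 := by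
          gcongr
          exact hc y
      _ = c ^ 2 * (1 + ‖y‖) ^ 2 := by ring
      _ ≤ c ^ 2 * (2 * (1 + ‖y‖ ^ 2)) := by
          gcongr
          nlinarith [sq_nonneg (1 - ‖y‖)]
      _ = _ := by ring
  calc |S.stageCost u y| ≤ (∑ i, ∑ j, |S.Q i j|) * ‖y‖ ^ 2
        + (∑ i, ∑ j, |S.R i j|) * ‖u y‖ ^ 2 :=
        (abs_add_le _ _).trans (add_le_add (abs_quad_le _ _) (abs_quad_le _ _))
    _ ≤ (∑ i, ∑ j, |S.Q i j|) * (1 + ‖y‖ ^ 2)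
        + (∑ i, ∑ j, |S.R i j|) * (2 * c ^ 2 * (1 + ‖y‖ ^ 2)) := by
        gcongr
        linarith
    _ = _ := by ring

theorem exists_norm_nextState_sq_le {u : (Fin n → ℝ) → Fin m → ℝ} {c : ℝ} (hc0 : 0 ≤ c)
    (hc : ∀ y, ‖u y‖ ≤ c * (1 + ‖y‖)) :
    ∃ C, ∀ p, ‖S.nextState u p‖ ^ 2 ≤ C * (1 + (‖p.1‖ ^ 2 + ‖p.2‖ ^ 2)) := by
  have hA : 0 ≤ ∑ i, ∑ j, |S.A i j| :=
    Finset.sum_nonneg fun i _ => Finset.sum_nonneg fun j _ => abs_nonneg _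
  have hB : 0 ≤ ∑ i, ∑ j, |S.B i j| :=
    Finset.sum_nonneg fun i _ => Finset.sum_nonneg fun j _ => abs_nonneg _
  have hX : 0 ≤ ∑ i, ∑ j, |S.Ξ i j| :=
    Finset.sum_nonneg fun i _ => Finset.sum_nonneg fun j _ => abs_nonneg _
  set K := ∑ i, ∑ j, |S.A i j| + (∑ i, ∑ j, |S.B i j|) * c + ∑ i, ∑ j, |S.Ξ i j| with hK
  have hK0 : 0 ≤ K := by positivity
  refine ⟨3 * K ^ 2, fun p => ?_⟩
  have h1 : ‖S.nextState u p‖ ≤ K * (1 + ‖p.1‖ + ‖p.2‖) := by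
    calc ‖S.nextState u p‖ ≤ ‖S.A *ᵥ p.1‖ + ‖S.B *ᵥ u p.1‖ + ‖S.Ξ *ᵥ p.2‖ := norm_add₃_le
      _ ≤ (∑ i, ∑ j, |S.A i j|) * ‖p.1‖ + (∑ i, ∑ j, |S.B i j|) * (c * (1 + ‖p.1‖))
          + (∑ i, ∑ j, |S.Ξ i j|) * ‖p.2‖ := by
          gcongr
          · exact norm_mulVec_le_sum_abs _ _
          · refine (norm_mulVec_le_sum_abs _ _).trans ?_
            gcongr
            exact hc _
          · exact norm_mulVec_le_sum_abs _ _
      _ ≤ (∑ i, ∑ j, |S.A i j|) * (1 + ‖p.1‖ + ‖p.2‖)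
          + (∑ i, ∑ j, |S.B i j|) * (c * (1 + ‖p.1‖ + ‖p.2‖))
          + (∑ i, ∑ j, |S.Ξ i j|) * (1 + ‖p.1‖ + ‖p.2‖) := by
          have h1 := norm_nonneg p.1
          have h2 := norm_nonneg p.2
          refine add_le_add (add_le_add (mul_le_mul_of_nonneg_left ?_ hA)
            (mul_le_mul_of_nonneg_left (mul_le_mul_of_nonneg_left ?_ hc0) hB))
            (mul_le_mul_of_nonneg_left ?_ hX) <;> linarith
      _ = _ := by rw [hK]; ring
  calc ‖S.nextState u p‖ ^ 2 ≤ (K * (1 + ‖p.1‖ + ‖p.2‖)) ^ 2 := by gcongr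
    _ = K ^ 2 * (1 + ‖p.1‖ + ‖p.2‖) ^ 2 := by ring
    _ ≤ K ^ 2 * (3 * (1 + (‖p.1‖ ^ 2 + ‖p.2‖ ^ 2))) := by
        gcongr
        nlinarith [sq_nonneg (1 - ‖p.1‖), sq_nonneg (1 - ‖p.2‖), sq_nonneg (‖p.1‖ - ‖p.2‖)]
    _ = _ := by ring

/-- A finite expected penalty bounds the second moment of the disturbance through its distance to
the sample; the control has linear growth. -/
theorem integrable_norm_sq_nextState [NeZero N] {μ : Measure (Fin n → ℝ)} [IsProbabilityMeasure μ]
    {κ : Kernel (Fin n → ℝ) (Fin k → ℝ)} [IsMarkovKernel κ] {u : (Fin n → ℝ) → Fin m → ℝ}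
    (hu : Measurable u) {c : ℝ} (hc0 : 0 ≤ c) (hc : ∀ y, ‖u y‖ ≤ c * (1 + ‖y‖))
    (hlam : 0 < S.lam) (hμ : Integrable (fun y => ‖y‖ ^ 2) μ)
    (hpen : ∫⁻ y, ENNReal.ofReal S.lam * W2 (κ y) S.nu ^ 2 ∂μ ≠ ⊤) :
    Integrable (fun p => ‖S.nextState u p‖ ^ 2) (μ ⊗ₘ κ) := by
  have hl0 : ENNReal.ofReal S.lam ≠ 0 := by simpa using hlam
  have h1 : Integrable (fun p : (Fin n → ℝ) × (Fin k → ℝ) => ‖p.1‖ ^ 2) (μ ⊗ₘ κ) := by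
    have h : (μ ⊗ₘ κ).map Prod.fst = μ := Measure.fst_compProd μ κ
    rw [← h] at hμ
    exact hμ.comp_measurable measurable_fst
  have h2 : Integrable (fun p : (Fin n → ℝ) × (Fin k → ℝ) => ‖p.2‖ ^ 2) (μ ⊗ₘ κ) := by
    have hm : Measurable fun p : (Fin n → ℝ) × (Fin k → ℝ) => ‖p.2‖ := measurable_snd.norm
    rw [integrable_norm_sq_iff hm,
      Measure.lintegral_compProd
      (hm.pow_const 2).ennreal_ofReal]
    have hW : ∫⁻ y, W2 (κ y) S.nu ^ 2 ∂μ ≠ ⊤ := fun h => hpen (by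
      rw [lintegral_const_mul' _ _ ENNReal.ofReal_ne_top, h, ENNReal.mul_top hl0])
    have hν : ∫⁻ w, ENNReal.ofReal (‖w‖ ^ 2) ∂S.nu ≠ ⊤ :=
      (integrable_norm_sq_iff measurable_norm).1 (integrable_empirical (NeZero.ne N) S.what)
    have hle : ∀ y, ∫⁻ w, ENNReal.ofReal (‖w‖ ^ 2) ∂(κ y)
        ≤ 2 * W2 (κ y) S.nu ^ 2 + 2 * ∫⁻ w, ENNReal.ofReal (‖w‖ ^ 2) ∂S.nu := fun y =>
      le_mul_W2_sq_add (by simp) (by simp) fun η h1 h2 => lintegral_norm_sq_le S.what η h1 h2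
    refine ne_top_of_le_ne_top ?_ (lintegral_mono hle)
    rw [lintegral_add_right _ measurable_const, lintegral_const_mul' _ _ (by simp),
      lintegral_const, measure_univ, mul_one]
    exact ENNReal.add_ne_top.2 ⟨ENNReal.mul_ne_top (by simp) hW, ENNReal.mul_ne_top (by simp) hν⟩
  obtain ⟨C, hC⟩ := S.exists_norm_nextState_sq_le hc0 hc
  refine integrable_of_abs_le ((S.measurable_nextState hu).norm.pow_const 2) (h1.add h2)
    (C := C) fun p => ?_
  rw [abs_of_nonneg (by positivity)]
  exact hC p

theorem continuous_envelope (z : Fin n → ℝ) : Continuous (S.envelope P r z) := by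
  unfold envelope response quad
  fun_prop

/-- Weak duality at each state, with the envelope as dual potential, integrated over the state law.
-/
theorem integral_quad_nextState_le [NeZero N] {μ : Measure (Fin n → ℝ)} [IsProbabilityMeasure μ]
    {κ : Kernel (Fin n → ℝ) (Fin k → ℝ)} [IsMarkovKernel κ] {u : (Fin n → ℝ) → Fin m → ℝ}
    (hlam : 0 < S.lam) (hP : Pᵀ = P) (hD : (S.curvature P).PosDef)
    (hint : Integrable (fun p => quad P r (S.nextState u p)) (μ ⊗ₘ κ))
    (hpen : ∫⁻ y, ENNReal.ofReal S.lam * W2 (κ y) S.nu ^ 2 ∂μ ≠ ⊤)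
    (henv : Integrable (fun y => (N : ℝ)⁻¹ *
      ∑ i, S.envelope P r (S.A *ᵥ y + S.B *ᵥ u y) (S.what i)) μ) :
    ∫ p, quad P r (S.nextState u p) ∂(μ ⊗ₘ κ)
      ≤ ∫ y, (N : ℝ)⁻¹ * ∑ i, S.envelope P r (S.A *ᵥ y + S.B *ᵥ u y) (S.what i) ∂μ
        + (∫⁻ y, ENNReal.ofReal S.lam * W2 (κ y) S.nu ^ 2 ∂μ).toReal := by
  have hint' : Integrable (fun y => ∫ w, quad P r (S.nextState u (y, w)) ∂(κ y)) μ := by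
    have h := hint.integral_compProd
    simpa using h
  rw [Measure.integral_compProd hint, ← sub_le_iff_le_add', ← integral_sub hint' henv]
  -- Passing to the lower integral of the positive part avoids measurability of `y ↦ W₂(κ y, ν)²`.
  refine (integral_le_toReal_lintegral_ofReal (hint'.sub henv)).trans ?_
  refine ENNReal.toReal_mono hpen (lintegral_mono fun y => ?_)
  obtain ⟨C, hC⟩ : ∃ C, ∀ w, |quad P r (S.nextState u (y, w))| ≤ C * (1 + ‖w‖ ^ 2) := by
    -- As a function of `w`, the terminal value is a quadratic plus a constant. The bound may depend
    -- on `y`, since duality is applied state by state.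
    obtain ⟨C, hC⟩ := exists_abs_quad_le (S.Ξᵀ * P * S.Ξ)
      (S.Ξᵀ *ᵥ (P *ᵥ (S.A *ᵥ y + S.B *ᵥ u y) + r))
    refine ⟨|quad P r (S.A *ᵥ y + S.B *ᵥ u y)| + C, fun w => ?_⟩
    have e : quad P r (S.nextState u (y, w)) = quad P r (S.A *ᵥ y + S.B *ᵥ u y)
        + quad (S.Ξᵀ * P * S.Ξ) (S.Ξᵀ *ᵥ (P *ᵥ (S.A *ᵥ y + S.B *ᵥ u y) + r)) w := by
      rw [nextState, quad_add hP, quad, quad, ← mulVec_mulVec, ← mulVec_mulVec,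
        dotProduct_mulVec_eq_transpose S.Ξᵀ, transpose_transpose,
        ← dotProduct_mulVec_eq_transpose S.Ξ]
      ring
    rw [e]
    refine (abs_add_le _ _).trans ?_
    have h1 := hC w
    have h2 : 0 ≤ |quad P r (S.A *ᵥ y + S.B *ᵥ u y)| * ‖w‖ ^ 2 := by positivity
    linarith
  refine ofReal_integral_sub_le_W2 (NeZero.ne N) S.what hlam ?_ (S.continuous_envelope _).measurable
    hC fun w z => ?_
  · refine (continuous_quad (P := P) (r := r)).measurable.comp ?_
    have h : Continuous fun w => S.A *ᵥ y + S.B *ᵥ u y + S.Ξ *ᵥ w := by fun_prop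
    exact h.measurable
  · have := S.quad_sub_le_envelope (r := r) hP hD (S.A *ᵥ y + S.B *ᵥ u y) z w
    rw [nextState]
    linarith

end MinimaxLQ

/-! ### Dynamic programming along trajectories. -/

namespace MinimaxLQ

variable {n m k N : ℕ} (S : MinimaxLQ n m k N)

/-- Finiteness is an explicit assumption because this step is used in the induction that makes the
state laws probability measures. -/
theorem stateLaw_succ_of_sFinite (x : Fin n → ℝ) (π : ControlPolicy n m)
    (γ : OpponentPolicy n k) (t : ℕ) [SFinite (S.stateLaw x π γ t)] :
    S.stateLaw x π γ (t + 1)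
      = (S.stateLaw x π γ t ⊗ₘ γ.act t).map (S.nextState (π.act t)) := by
  have := γ.isMarkov_act t
  rw [← bind_map_eq_map_compProd (S.measurable_nextState (π.measurable_act t)), stateLaw]
  rfl

instance isProbabilityMeasure_stateLaw (x : Fin n → ℝ) (π : ControlPolicy n m)
    (γ : OpponentPolicy n k) (t : ℕ) : IsProbabilityMeasure (S.stateLaw x π γ t) := by
  induction t with
  | zero => exact Measure.dirac.isProbabilityMeasure
  | succ t ih =>
    have := γ.isMarkov_act t
    rw [S.stateLaw_succ_of_sFinite]
    exact Measure.isProbabilityMeasure_map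
      (S.measurable_nextState (π.measurable_act t)).aemeasurable

theorem stateLaw_succ (x : Fin n → ℝ) (π : ControlPolicy n m) (γ : OpponentPolicy n k) (t : ℕ) :
    S.stateLaw x π γ (t + 1)
      = (S.stateLaw x π γ t ⊗ₘ γ.act t).map (S.nextState (π.act t)) :=
  S.stateLaw_succ_of_sFinite x π γ t

theorem runningCost_succ (x : Fin n → ℝ) (π : ControlPolicy n m) (γ : OpponentPolicy n k) (t : ℕ) :
    S.runningCost x π γ (t + 1) = S.runningCost x π γ t
      + ∫⁻ y, ENNReal.ofReal (S.stageCost (π.act t) y) ∂(S.stateLaw x π γ t) :=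
  Finset.sum_range_succ _ _

theorem penaltyCost_succ (x : Fin n → ℝ) (π : ControlPolicy n m) (γ : OpponentPolicy n k) (t : ℕ) :
    S.penaltyCost x π γ (t + 1) = S.penaltyCost x π γ t
      + ∫⁻ y, ENNReal.ofReal S.lam * W2 (γ.act t y) S.nu ^ 2 ∂(S.stateLaw x π γ t) :=
  Finset.sum_range_succ _ _

/-- Coefficients `P_t`, `r_t` of quadratic value functions that solve the dynamic programming
recursion up to the horizon `T`. -/
structure IsValueSequence (T : ℕ) (P : ℕ → Matrix (Fin n) (Fin n) ℝ) (r : ℕ → Fin n → ℝ) :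
    Prop where
  posSemidef : ∀ t < T, (P (t + 1)).PosSemidef
  curvature_posDef : ∀ t < T, (S.curvature (P (t + 1))).PosDef
  isUnit_det : ∀ t < T, IsUnit (1 + P (t + 1) * S.Phi).det
  riccati_eq : ∀ t < T, P t = riccatiMap S.A S.Phi S.Q (P (t + 1))
  linear_eq : ∀ t < T, r t = S.nextLinear (P (t + 1)) (r (t + 1))

variable {S} {T : ℕ} {P : ℕ → Matrix (Fin n) (Fin n) ℝ} {r : ℕ → Fin n → ℝ}

/-- Telescoping of the stage inequality. The induction also carries finite second moments, which
make every quadratic integrable and propagate because the penalty is finite. -/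
theorem IsValueSequence.upper_bound [NeZero N] (hV : S.IsValueSequence T P r) (hQ : S.Q.PosSemidef)
    (hR : S.R.PosDef) (hlam : 0 < S.lam) (x : Fin n → ℝ) (π : ControlPolicy n m)
    (hπ : ∀ t < T, π.act t = S.control (P (t + 1)) (r (t + 1))) (γ : OpponentPolicy n k)
    (hpen : S.penaltyCost x π γ T ≠ ⊤) (t : ℕ) (ht : t ≤ T) :
    Integrable (fun y => ‖y‖ ^ 2) (S.stateLaw x π γ t) ∧ S.runningCost x π γ t ≠ ⊤ ∧
      (S.runningCost x π γ t).toReal + ∫ y, quad (P t) (r t) y ∂(S.stateLaw x π γ t)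
        ≤ quad (P 0) (r 0) x + ∑ s ∈ Finset.range t, S.stageConst (P (s + 1)) (r (s + 1))
          + (S.penaltyCost x π γ t).toReal := by
  induction t with
  | zero =>
    refine ⟨integrable_dirac (by simp), by simp [runningCost], ?_⟩
    simp [runningCost, penaltyCost, stateLaw]
  | succ t ih =>
    obtain ⟨hsq, hrun, hle⟩ := ih (by omega)
    have htT : t < T := by omega
    have := γ.isMarkov_act t
    have hfin : ∀ s < T, ∫⁻ y, ENNReal.ofReal S.lam * W2 (γ.act s y) S.nu ^ 2
        ∂(S.stateLaw x π γ s) ≠ ⊤ := fun s hs =>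
      ENNReal.sum_ne_top.1 hpen s (Finset.mem_range.2 hs)
    have hpent : S.penaltyCost x π γ t ≠ ⊤ := ENNReal.sum_ne_top.2 fun s hs =>
      hfin s ((Finset.mem_range.1 hs).trans htT)
    obtain ⟨c, hc0, hc⟩ := S.exists_norm_control_le (P (t + 1)) (r (t + 1))
    rw [← hπ t htT] at hc
    have hsym := (hV.posSemidef t htT).transpose_eq
    have hcurv := hV.curvature_posDef t htT
    have hu := π.measurable_act t
    have hnext := S.measurable_nextState (k := k) hu
    have hsq' := S.integrable_norm_sq_nextState hu hc0 hc hlam hsq (hfin t htT)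
    have hq : Integrable (quad (P t) (r t)) (S.stateLaw x π γ t) := by
      obtain ⟨C, hC⟩ := exists_abs_quad_le (P t) (r t)
      exact integrable_of_abs_le continuous_quad.measurable hsq hC
    have hcost : Integrable (S.stageCost (π.act t)) (S.stateLaw x π γ t) := by
      obtain ⟨C, hC⟩ := S.exists_abs_stageCost_le hc
      exact integrable_of_abs_le (S.measurable_stageCost hu) hsq hC
    have hq' : Integrable (fun p => quad (P (t + 1)) (r (t + 1)) (S.nextState (π.act t) p))
        (S.stateLaw x π γ t ⊗ₘ γ.act t) := by
      obtain ⟨C, hC⟩ := exists_abs_quad_le (P (t + 1)) (r (t + 1))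
      exact integrable_of_abs_le (continuous_quad.measurable.comp hnext) hsq' fun p => hC _
    -- Under the minimizing control the averaged envelope is known exactly: value plus stage
    -- constant minus stage cost.
    have henv : (fun y => (N : ℝ)⁻¹ * ∑ i, S.envelope (P (t + 1)) (r (t + 1))
          (S.A *ᵥ y + S.B *ᵥ π.act t y) (S.what i))
        = fun y => quad (P t) (r t) y + S.stageConst (P (t + 1)) (r (t + 1))
          - S.stageCost (π.act t) y := by
      funext y
      have h := S.mean_envelope (r := r (t + 1)) hlam hsym hcurv hR (hV.isUnit_det t htT) y
      rw [← hV.riccati_eq t htT, ← hV.linear_eq t htT] at h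
      rw [← h, hπ t htT, stageCost]
      exact (add_sub_cancel_left _ _).symm
    have hqc : Integrable (fun y => quad (P t) (r t) y + S.stageConst (P (t + 1)) (r (t + 1)))
        (S.stateLaw x π γ t) := hq.add (integrable_const _)
    have hstep := S.integral_quad_nextState_le hlam hsym hcurv hq' (hfin t htT)
      (by rw [henv]; exact hqc.sub hcost)
    rw [henv, integral_sub hqc hcost, integral_add hq (integrable_const _)] at hstep
    simp only [integral_const, probReal_univ, one_smul] at hstep
    have hcost' := ofReal_integral_eq_lintegral_ofReal hcost
      (ae_of_all _ (S.stageCost_nonneg hQ hR (π.act t)))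
    have hcost0 : 0 ≤ ∫ y, S.stageCost (π.act t) y ∂(S.stateLaw x π γ t) :=
      integral_nonneg (S.stageCost_nonneg hQ hR (π.act t))
    have hlaw := S.stateLaw_succ x π γ t
    refine ⟨?_, ?_, ?_⟩
    · rw [hlaw, integrable_map_measure (by fun_prop) hnext.aemeasurable]
      exact hsq'
    · rw [runningCost_succ, ← hcost']
      exact ENNReal.add_ne_top.2 ⟨hrun, ENNReal.ofReal_ne_top⟩
    · rw [runningCost_succ, ← hcost', ENNReal.toReal_add hrun ENNReal.ofReal_ne_top,
        ENNReal.toReal_ofReal hcost0, penaltyCost_succ, ENNReal.toReal_add hpent (hfin t htT),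
        hlaw, integral_map hnext.aemeasurable continuous_quad.aestronglyMeasurable,
        Finset.sum_range_succ]
      linarith

theorem continuous_response_drift (P : Matrix (Fin n) (Fin n) ℝ) (r : Fin n → ℝ)
    (v : Fin k → ℝ) : Continuous fun y => S.response P r (S.drift P r y) v := by
  unfold response drift control
  fun_prop

theorem integrable_nextState_of_empirical [NeZero N] {μ : Measure (Fin n → ℝ)} [IsProbabilityMeasure μ]
    (hμ : ∀ f : (Fin n → ℝ) → ℝ, Measurable f → Integrable f μ)
    {κ : Kernel (Fin n → ℝ) (Fin k → ℝ)} [IsMarkovKernel κ]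
    {w : (Fin n → ℝ) → Fin N → Fin k → ℝ} (hw : ∀ i, Measurable fun y => w y i)
    (hκ : ∀ y, κ y = empirical (w y)) {f : (Fin n → ℝ) × (Fin k → ℝ) → ℝ}
    (hf : Measurable f) : Integrable f (μ ⊗ₘ κ) := by
  rw [Measure.integrable_compProd_iff hf.aestronglyMeasurable]
  refine ⟨ae_of_all _ fun y => ?_, hμ _ ?_⟩
  · rw [hκ]
    exact integrable_empirical (NeZero.ne N) _
  · simp only [hκ, integral_empirical]
    exact (Finset.measurable_sum _ fun i _ =>
      (hf.comp (measurable_id.prodMk (hw i))).norm).const_mul _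

/-- Against this opponent each disturbance law has finitely many atoms and every measurable function
stays integrable, so arbitrary measurable controls are allowed without growth conditions. -/
theorem IsValueSequence.lower_bound [NeZero N] (hV : S.IsValueSequence T P r) (hQ : S.Q.PosSemidef)
    (hR : S.R.PosDef) (hlam : 0 < S.lam) (x : Fin n → ℝ) (π : ControlPolicy n m)
    (γ : OpponentPolicy n k)
    (hγ : ∀ t < T, ∀ y, γ.act t y = empirical fun i =>
      S.response (P (t + 1)) (r (t + 1)) (S.drift (P (t + 1)) (r (t + 1)) y) (S.what i))
    (t : ℕ) (ht : t ≤ T) :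
    (∀ f : (Fin n → ℝ) → ℝ, Measurable f → Integrable f (S.stateLaw x π γ t)) ∧
      S.runningCost x π γ t ≠ ⊤ ∧ S.penaltyCost x π γ t ≠ ⊤ ∧
      quad (P 0) (r 0) x + ∑ s ∈ Finset.range t, S.stageConst (P (s + 1)) (r (s + 1))
          + (S.penaltyCost x π γ t).toReal
        ≤ (S.runningCost x π γ t).toReal + ∫ y, quad (P t) (r t) y ∂(S.stateLaw x π γ t) := by
  induction t with
  | zero =>
    refine ⟨fun f hf => integrable_dirac (by simp), by simp [runningCost],
      by simp [penaltyCost], ?_⟩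
    simp [runningCost, penaltyCost, stateLaw]
  | succ t ih =>
    obtain ⟨hint, hrun, hpent, hle⟩ := ih (by omega)
    have htT : t < T := by omega
    have := γ.isMarkov_act t
    have hsym := (hV.posSemidef t htT).transpose_eq
    have hcurv := hV.curvature_posDef t htT
    have hu := π.measurable_act t
    have hnext := S.measurable_nextState (k := k) hu
    set w : (Fin n → ℝ) → Fin N → Fin k → ℝ := fun y i =>
      S.response (P (t + 1)) (r (t + 1)) (S.drift (P (t + 1)) (r (t + 1)) y) (S.what i) with hw
    have hwm : ∀ i, Measurable fun y => w y i := fun i =>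
      (continuous_response_drift _ _ _).measurable
    have hκ : ∀ y, γ.act t y = empirical (w y) := hγ t htT
    have hI : ∀ f : (Fin n → ℝ) × (Fin k → ℝ) → ℝ, Measurable f →
        Integrable f (S.stateLaw x π γ t ⊗ₘ γ.act t) := fun f hf =>
      integrable_nextState_of_empirical hint hwm hκ hf
    have hlaw := S.stateLaw_succ x π γ t
    have hd : Measurable fun y => (N : ℝ)⁻¹ * ∑ i, (w y i - S.what i) ⬝ᵥ (w y i - S.what i) := by
      have h : Continuous fun v : Fin k → ℝ => v ⬝ᵥ v := by fun_prop
      exact (Finset.measurable_sum _ fun i _ =>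
        h.measurable.comp ((hwm i).sub_const _)).const_mul _
    have hqm : Measurable fun y => (N : ℝ)⁻¹ *
        ∑ i, quad (P (t + 1)) (r (t + 1)) (S.nextState (π.act t) (y, w y i)) :=
      (Finset.measurable_sum _ fun i _ => continuous_quad.measurable.comp
        (hnext.comp (measurable_id.prodMk (hwm i)))).const_mul _
    have hd0 : ∀ y, 0 ≤ S.lam * ((N : ℝ)⁻¹ * ∑ i, (w y i - S.what i) ⬝ᵥ (w y i - S.what i)) :=
      fun y => mul_nonneg hlam.le (mul_nonneg (by positivity)
        (Finset.sum_nonneg fun i _ => dotProduct_self_nonneg' _))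
    -- Only an upper bound on the penalty is needed, and the index coupling supplies it.
    have hpen : ∫⁻ y, ENNReal.ofReal S.lam * W2 (γ.act t y) S.nu ^ 2 ∂(S.stateLaw x π γ t)
        ≤ ENNReal.ofReal (∫ y, S.lam * ((N : ℝ)⁻¹ *
          ∑ i, (w y i - S.what i) ⬝ᵥ (w y i - S.what i)) ∂(S.stateLaw x π γ t)) := by
      rw [ofReal_integral_eq_lintegral_ofReal (hint _ (hd.const_mul _)) (ae_of_all _ hd0)]
      refine lintegral_mono fun y => ?_
      rw [hκ, ENNReal.ofReal_mul hlam.le]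
      gcongr
      refine (W2_empirical_sq_le (w y) S.what).trans_eq ?_
      have hN0 : (0 : ℝ) < N := by exact_mod_cast Nat.pos_of_ne_zero (NeZero.ne N)
      rw [ENNReal.ofReal_mul (by positivity),
        ENNReal.ofReal_sum_of_nonneg fun i _ => dotProduct_self_nonneg' _,
        ENNReal.ofReal_inv_of_pos hN0, ENNReal.ofReal_natCast]
    have hcost : Integrable (S.stageCost (π.act t)) (S.stateLaw x π γ t) :=
      hint _ (S.measurable_stageCost hu)
    have hcost' := ofReal_integral_eq_lintegral_ofReal hcost
      (ae_of_all _ (S.stageCost_nonneg hQ hR (π.act t)))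
    have hcost0 : 0 ≤ ∫ y, S.stageCost (π.act t) y ∂(S.stateLaw x π γ t) :=
      integral_nonneg (S.stageCost_nonneg hQ hR (π.act t))
    have hpenfin := ne_top_of_le_ne_top ENNReal.ofReal_ne_top hpen
    refine ⟨fun f hf => ?_, ?_, ?_, ?_⟩
    · rw [hlaw, integrable_map_measure hf.aestronglyMeasurable hnext.aemeasurable]
      exact hI _ (hf.comp hnext)
    · rw [runningCost_succ, ← hcost']
      exact ENNReal.add_ne_top.2 ⟨hrun, ENNReal.ofReal_ne_top⟩
    · rw [penaltyCost_succ]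
      exact ENNReal.add_ne_top.2 ⟨hpent, hpenfin⟩
    · have hpr := ENNReal.toReal_mono ENNReal.ofReal_ne_top hpen
      rw [ENNReal.toReal_ofReal (integral_nonneg hd0)] at hpr
      have hstep : ∫ y, (quad (P t) (r t) y + S.stageConst (P (t + 1)) (r (t + 1)))
            ∂(S.stateLaw x π γ t)
          ≤ ∫ y, (S.stageCost (π.act t) y
            + ((N : ℝ)⁻¹ * ∑ i, quad (P (t + 1)) (r (t + 1)) (S.nextState (π.act t) (y, w y i))
            - S.lam * ((N : ℝ)⁻¹ * ∑ i, (w y i - S.what i) ⬝ᵥ (w y i - S.what i))))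
            ∂(S.stateLaw x π γ t) := by
        refine integral_mono ((hint _ continuous_quad.measurable).add (integrable_const _))
          (hcost.add ((hint _ hqm).sub (hint _ (hd.const_mul _)))) fun y => ?_
        have h := S.le_cost_of_response (r := r (t + 1)) hlam hsym hcurv hR
          (hV.isUnit_det t htT) (hV.posSemidef t htT) y (π.act t y)
        rw [← hV.riccati_eq t htT, ← hV.linear_eq t htT, Finset.sum_sub_distrib, mul_sub,
          ← Finset.mul_sum, mul_left_comm _ S.lam] at h
        exact h
      have hqd : Integrable (fun y => (N : ℝ)⁻¹ *
            ∑ i, quad (P (t + 1)) (r (t + 1)) (S.nextState (π.act t) (y, w y i))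
          - S.lam * ((N : ℝ)⁻¹ * ∑ i, (w y i - S.what i) ⬝ᵥ (w y i - S.what i)))
          (S.stateLaw x π γ t) := (hint _ hqm).sub (hint _ (hd.const_mul _))
      rw [integral_add (hint _ continuous_quad.measurable) (integrable_const _),
        integral_add hcost hqd,
        integral_sub (hint _ hqm) (hint _ (hd.const_mul _))] at hstep
      simp only [integral_const, probReal_univ, one_smul] at hstep
      have hnew : ∫ y, quad (P (t + 1)) (r (t + 1)) y ∂(S.stateLaw x π γ (t + 1))
          = ∫ y, (N : ℝ)⁻¹ * ∑ i, quad (P (t + 1)) (r (t + 1)) (S.nextState (π.act t) (y, w y i))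
            ∂(S.stateLaw x π γ t) := by
        have hq' : Integrable (fun p => quad (P (t + 1)) (r (t + 1)) (S.nextState (π.act t) p))
            (S.stateLaw x π γ t ⊗ₘ γ.act t) := hI _ (continuous_quad.measurable.comp hnext)
        rw [hlaw, integral_map hnext.aemeasurable continuous_quad.aestronglyMeasurable,
          Measure.integral_compProd hq']
        simp only [hκ, integral_empirical]
      rw [runningCost_succ, ← hcost', ENNReal.toReal_add hrun ENNReal.ofReal_ne_top,
        ENNReal.toReal_ofReal hcost0, penaltyCost_succ, ENNReal.toReal_add hpent hpenfin,
        Finset.sum_range_succ, hnew]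
      linarith

end MinimaxLQ

/-! ### Extended expectations and saddle points. -/

section ExtendedReal

theorem extExpect_eq_integral {E : Type*} [MeasurableSpace E] {μ : Measure E} {f : E → ℝ}
    (hf : Integrable f μ) : extExpect μ f = ((∫ x, f x ∂μ : ℝ) : EReal) := by
  have hneg : ∫⁻ x, ENNReal.ofReal (-f x) ∂μ ≠ ⊤ := hf.neg.lintegral_lt_top.ne
  rw [extExpect, ← EReal.coe_ennreal_toReal hf.lintegral_lt_top.ne,
    ← EReal.coe_ennreal_toReal hneg, ← EReal.coe_sub,
    integral_eq_lintegral_pos_part_sub_lintegral_neg_part hf]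

/-- Both saddle inequalities at the same level `v` give optimality and the value together, with no
minimax theorem. -/
theorem isMinimaxOptimal_of_saddle {α β : Type*} {J : α → β → EReal} {C : Set α} {D : Set β}
    {π₀ : α} {γ₀ : β} {v : EReal} (hπ : π₀ ∈ C) (hγ : γ₀ ∈ D) (h1 : ∀ γ ∈ D, J π₀ γ ≤ v)
    (h2 : ∀ π ∈ C, v ≤ J π γ₀) :
    IsMinimaxOptimal J C D π₀ γ₀ ∧ (⨅ π ∈ C, ⨆ γ ∈ D, J π γ) = v := by
  have h3 : ∀ π ∈ C, v ≤ ⨆ γ ∈ D, J π γ := fun π hπ' => (h2 π hπ').trans (le_iSup₂_of_le γ₀ hγ le_rfl)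
  have h4 : (⨆ γ ∈ D, J π₀ γ) ≤ v := iSup₂_le h1
  exact ⟨⟨hπ, hγ, fun γ hγ' => (h1 γ hγ').trans (h2 π₀ hπ), fun π hπ' => h4.trans (h3 π hπ')⟩,
    le_antisymm (iInf₂_le_of_le π₀ hπ h4) (le_iInf₂ h3)⟩

theorem tendsto_coe_add_div (a b : ℝ) :
    Tendsto (fun T : ℕ => ((a + b / T : ℝ) : EReal)) atTop (𝓝 (a : EReal)) := by
  have h : Tendsto (fun T : ℕ => a + b / T) atTop (𝓝 (a + 0)) :=
    (tendsto_const_div_atTop_nhds_zero_nat b).const_add a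
  rw [add_zero] at h
  exact (continuous_coe_real_ereal.tendsto a).comp h

end ExtendedReal

/-! ### Mean costs and the finite-horizon game. -/

noncomputable section

namespace MinimaxLQ

variable {n m k N : ℕ} (S : MinimaxLQ n m k N)

theorem meanCost_eq_coe {g : (Fin n → ℝ) → ℝ} {x : Fin n → ℝ} {π : ControlPolicy n m}
    {γ : OpponentPolicy n k} {T : ℕ} (hrun : S.runningCost x π γ T ≠ ⊤)
    (hpen : S.penaltyCost x π γ T ≠ ⊤) (hg : Integrable g (S.stateLaw x π γ T)) :
    S.meanCost g x π γ T = ((1 / (T : ℝ) * ((S.runningCost x π γ T).toReal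
      - (S.penaltyCost x π γ T).toReal + ∫ y, g y ∂(S.stateLaw x π γ T)) : ℝ) : EReal) := by
  rw [meanCost, extExpect_eq_integral hg, ← EReal.coe_ennreal_toReal hrun,
    ← EReal.coe_ennreal_toReal hpen, ← EReal.coe_sub, ← EReal.coe_add, ← EReal.coe_mul]

/-- `⊥` absorbs any terminal expectation. A positive `T` is needed, since for `T = 0` the prefactor
`1 / T` is zero. -/
theorem meanCost_eq_bot {g : (Fin n → ℝ) → ℝ} {x : Fin n → ℝ} {π : ControlPolicy n m}
    {γ : OpponentPolicy n k} {T : ℕ} (hT : 0 < T) (hpen : S.penaltyCost x π γ T = ⊤) :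
    S.meanCost g x π γ T = ⊥ := by
  have hT' : (0 : ℝ) < 1 / (T : ℝ) := by positivity
  rw [meanCost, hpen, EReal.coe_ennreal_top, sub_eq_add_neg, EReal.neg_top, EReal.add_bot,
    EReal.bot_add, EReal.coe_mul_bot_of_pos hT']

variable {S} {T : ℕ} {P : ℕ → Matrix (Fin n) (Fin n) ℝ} {r : ℕ → Fin n → ℝ}

/-- The slack `c` admits terminal costs other than the value function itself, in particular the zero
terminal cost. -/
theorem IsValueSequence.meanCost_le [NeZero N] (hV : S.IsValueSequence T P r)
    (hQ : S.Q.PosSemidef) (hR : S.R.PosDef) (hlam : 0 < S.lam) (x : Fin n → ℝ)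
    (π : ControlPolicy n m) (hπ : ∀ t < T, π.act t = S.control (P (t + 1)) (r (t + 1)))
    (γ : OpponentPolicy n k) (hT : 0 < T) {g : (Fin n → ℝ) → ℝ} {c : ℝ}
    (hg : Continuous g) (hgc : ∀ y, g y ≤ quad (P T) (r T) y + c)
    (hgC : ∃ C, ∀ y, |g y| ≤ C * (1 + ‖y‖ ^ 2)) :
    S.meanCost g x π γ T ≤ ((1 / (T : ℝ) * (quad (P 0) (r 0) x
      + ∑ s ∈ Finset.range T, S.stageConst (P (s + 1)) (r (s + 1)) + c) : ℝ) : EReal) := by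
  by_cases hpen : S.penaltyCost x π γ T = ⊤
  · rw [S.meanCost_eq_bot hT hpen]
    exact bot_le
  obtain ⟨hsq, hrun, hle⟩ := hV.upper_bound hQ hR hlam x π hπ γ hpen T le_rfl
  obtain ⟨C, hC⟩ := hgC
  obtain ⟨C', hC'⟩ := exists_abs_quad_le (P T) (r T)
  have hgi : Integrable g (S.stateLaw x π γ T) := integrable_of_abs_le hg.measurable hsq hC
  have hqi : Integrable (quad (P T) (r T)) (S.stateLaw x π γ T) :=
    integrable_of_abs_le continuous_quad.measurable hsq hC'
  have hmono := integral_mono hgi (hqi.add (integrable_const c)) hgc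
  rw [integral_add' hqi (integrable_const c)] at hmono
  simp only [integral_const, probReal_univ, one_smul] at hmono
  rw [S.meanCost_eq_coe hrun hpen hgi, EReal.coe_le_coe_iff]
  refine mul_le_mul_of_nonneg_left ?_ (by positivity)
  linarith

theorem IsValueSequence.le_meanCost [NeZero N] (hV : S.IsValueSequence T P r)
    (hQ : S.Q.PosSemidef) (hR : S.R.PosDef) (hlam : 0 < S.lam) (x : Fin n → ℝ)
    (π : ControlPolicy n m) (γ : OpponentPolicy n k)
    (hγ : ∀ t < T, ∀ y, γ.act t y = empirical fun i =>
      S.response (P (t + 1)) (r (t + 1)) (S.drift (P (t + 1)) (r (t + 1)) y) (S.what i))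
    {g : (Fin n → ℝ) → ℝ} (hg : Continuous g) :
    ((1 / (T : ℝ) * (quad (P 0) (r 0) x
      + ∑ s ∈ Finset.range T, S.stageConst (P (s + 1)) (r (s + 1))
      - ∫ y, quad (P T) (r T) y ∂(S.stateLaw x π γ T)
      + ∫ y, g y ∂(S.stateLaw x π γ T)) : ℝ) : EReal) ≤ S.meanCost g x π γ T := by
  obtain ⟨hint, hrun, hpen, hle⟩ := hV.lower_bound hQ hR hlam x π γ hγ T le_rfl
  rw [S.meanCost_eq_coe hrun hpen (hint _ hg.measurable), EReal.coe_le_coe_iff]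
  refine mul_le_mul_of_nonneg_left ?_ (by positivity)
  linarith

variable (S) in
/-- The linear coefficients of the finite-horizon value functions, in time-to-go. -/
def linearTerm : ℕ → Fin n → ℝ
  | 0 => 0
  | j + 1 => S.nextLinear (S.riccati j) (linearTerm j)

variable (S) in
/-- The minimizing control policy for the horizon `T`. -/
def finiteControlPolicy (T : ℕ) : ControlPolicy n m where
  act := fun t => S.control (S.riccati (T - (t + 1))) (S.linearTerm (T - (t + 1)))
  measurable_act := fun _ => S.continuous_control.measurable

variable (S) in
/-- The maximizing opponent policy for the horizon `T`. -/
def finiteOpponentPolicy [NeZero N] (T : ℕ) : OpponentPolicy n k where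
  act := fun t => ⟨fun y => empirical fun i =>
      S.response (S.riccati (T - (t + 1))) (S.linearTerm (T - (t + 1)))
        (S.drift (S.riccati (T - (t + 1))) (S.linearTerm (T - (t + 1))) y) (S.what i),
    measurable_empirical fun _ => (continuous_response_drift _ _ _).measurable⟩
  isMarkov_act := fun _ => ⟨fun _ => isProbabilityMeasure_empirical (NeZero.ne N) _⟩

theorem riccati_eq_iterate (j : ℕ) : S.riccati j = (riccatiMap S.A S.Phi S.Q)^[j] S.Qf := by
  induction j with
  | zero => rfl
  | succ j ih => rw [Function.iterate_succ_apply', ← ih]; rfl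

theorem isValueSequence_finite {F : Matrix (Fin n) (Fin n) ℝ} (hF : IsPSDSqrt F S.Phi)
    (hQ : S.Q.PosSemidef) (hQf : S.Qf.PosSemidef) (hpen : ∀ j, (S.curvature (S.riccati j)).PosDef)
    (T : ℕ) :
    S.IsValueSequence T (fun t => S.riccati (T - t)) (fun t => S.linearTerm (T - t)) := by
  have hps : ∀ j, (S.riccati j).PosSemidef := fun j => by
    rw [riccati_eq_iterate, ← hF.2]
    exact posSemidef_iterate_riccatiMap hQ hQf hF.1.transpose_eq j
  refine ⟨fun t _ => hps _, fun t _ => hpen _, fun t _ => ?_, fun t ht => ?_, fun t ht => ?_⟩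
  · rw [← hF.2]
    exact isUnit_det_one_add_mul (hps _) hF.1.transpose_eq
  · rw [show T - t = T - (t + 1) + 1 by omega]
    rfl
  · rw [show T - t = T - (t + 1) + 1 by omega]
    rfl

/-- The value of the finite-horizon game. -/
theorem iInf_iSup_finiteCost [NeZero N] {F : Matrix (Fin n) (Fin n) ℝ} (hF : IsPSDSqrt F S.Phi)
    (hQ : S.Q.PosSemidef) (hQf : S.Qf.PosSemidef) (hR : S.R.PosDef) (hlam : 0 < S.lam)
    (hpen : ∀ j, (S.curvature (S.riccati j)).PosDef) (x : Fin n → ℝ) {T : ℕ} (hT : 0 < T) :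
    ⨅ π : ControlPolicy n m, ⨆ γ : OpponentPolicy n k, S.finiteCost x π γ T
      = ((1 / (T : ℝ) * (quad (S.riccati T) (S.linearTerm T) x
        + ∑ j ∈ Finset.range T, S.stageConst (S.riccati j) (S.linearTerm j)) : ℝ) : EReal) := by
  have hV := isValueSequence_finite hF hQ hQf hpen T
  have hsum : ∑ s ∈ Finset.range T, S.stageConst (S.riccati (T - (s + 1)))
        (S.linearTerm (T - (s + 1)))
      = ∑ j ∈ Finset.range T, S.stageConst (S.riccati j) (S.linearTerm j) := by
    refine Eq.trans (Finset.sum_congr rfl fun s _ => ?_)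
      (Finset.sum_range_reflect (fun j => S.stageConst (S.riccati j) (S.linearTerm j)) T)
    simp only [Nat.sub_sub, add_comm 1 s]
  have hterm : (fun y : Fin n → ℝ => y ⬝ᵥ (S.Qf *ᵥ y))
      = quad (S.riccati (T - T)) (S.linearTerm (T - T)) := by
    funext y
    simp [quad, linearTerm, riccati]
  refine le_antisymm (iInf_le_of_le (S.finiteControlPolicy T) (iSup_le fun γ => ?_))
    (le_iInf fun π => le_iSup_of_le (S.finiteOpponentPolicy T) ?_)
  · have h := hV.meanCost_le hQ hR hlam x (S.finiteControlPolicy T) (fun _ _ => rfl) γ hT (c := 0)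
      continuous_quad (fun y => (add_zero _).ge) (exists_abs_quad_le _ _)
    rw [finiteCost, hterm]
    simpa only [hsum, add_zero, Nat.sub_zero] using h
  · have h := hV.le_meanCost hQ hR hlam x π (S.finiteOpponentPolicy T) (fun _ _ _ => rfl)
      (continuous_quad (P := S.riccati (T - T)) (r := S.linearTerm (T - T)))
    rw [finiteCost, hterm]
    simpa only [hsum, sub_add_cancel, Nat.sub_zero] using h

/-- All three inverses in the stage constant have invertible limits, by `hU` and by positive
definiteness of the limiting curvature. -/
theorem tendsto_stageConst [NeZero N] {α : Type*} {l : Filter α}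
    {P : α → Matrix (Fin n) (Fin n) ℝ} {r : α → Fin n → ℝ} {X : Matrix (Fin n) (Fin n) ℝ}
    {y : Fin n → ℝ} (hP : Tendsto P l (𝓝 X)) (hr : Tendsto r l (𝓝 y)) (hlam : 0 < S.lam)
    (hD : (S.curvature X).PosDef) (hU : IsUnit (1 + X * S.Phi).det) :
    Tendsto (fun a => S.stageConst (P a) (r a)) l (𝓝 (S.stageConst X y)) := by
  have hc {p q : ℕ} (M : Matrix (Fin p) (Fin q) ℝ) : Tendsto (fun _ : α => M) l (𝓝 M) :=
    tendsto_const_nhds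
  have hgain : Tendsto (fun a => S.gain (P a)) l (𝓝 (S.gain X)) :=
    tendsto_matrix_inv ((hc 1).add (tendsto_matrix_mul hP (hc _))) hU
  have h1 : Tendsto (fun a => S.Ξᵀ * P a * S.Ξ) l (𝓝 (S.Ξᵀ * X * S.Ξ)) :=
    tendsto_matrix_mul (tendsto_matrix_mul (hc _) hP) (hc _)
  have h2 : Tendsto (fun a => (1 - (1 / S.lam) • (S.Ξᵀ * P a * S.Ξ))⁻¹) l
      (𝓝 (1 - (1 / S.lam) • (S.Ξᵀ * X * S.Ξ))⁻¹) :=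
    tendsto_matrix_inv ((hc 1).sub (h1.const_smul _)) (S.isUnit_det_one_sub hlam hD)
  have h3 : Tendsto (fun a => (1 - (1 / S.lam) • (P a * S.Ξ * S.Ξᵀ))⁻¹) l
      (𝓝 (1 - (1 / S.lam) • (X * S.Ξ * S.Ξᵀ))⁻¹) :=
    tendsto_matrix_inv ((hc 1).sub ((tendsto_matrix_mul (tendsto_matrix_mul hP (hc _))
      (hc _)).const_smul _)) (S.isUnit_det_one_sub' hlam hD)
  refine Tendsto.add (Tendsto.add ?_ ?_) ?_
  · exact ((continuous_id.matrix_trace).tendsto _).comp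
      (tendsto_matrix_mul (tendsto_matrix_mul h2 h1) (hc _))
  · exact tendsto_dotProduct tendsto_const_nhds (tendsto_matrix_mulVec (tendsto_matrix_mul
      (tendsto_matrix_mul (tendsto_matrix_mul (hc _) (hgain.sub h3)) hP) (hc _)) tendsto_const_nhds)
  · exact tendsto_dotProduct (tendsto_const_nhds.sub (tendsto_matrix_mulVec (hc _) hr))
      (tendsto_matrix_mulVec hgain hr)

end MinimaxLQ

end

/-! ### The steady state. -/

namespace MinimaxLQ

variable {n m k N : ℕ} {S : MinimaxLQ n m k N} {F G : Matrix (Fin n) (Fin n) ℝ}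

theorem exists_steadyState (hQ : S.Q.PosSemidef) (hQf : S.Qf.PosSemidef)
    (hF : IsPSDSqrt F S.Phi) (hstab : IsStabilizable S.A F) (hG : IsPSDSqrt G S.Q)
    (hobs : IsObservablePair S.A G) :
    Tendsto S.riccati atTop (𝓝 S.Pss) ∧ S.Pss.PosDef ∧
      riccatiMap S.A S.Phi S.Q S.Pss = S.Pss ∧
      Tendsto (fun j => (S.Aᵀ * S.gain S.Pss) ^ j) atTop (𝓝 0) := by
  have hFt := hF.1.transpose_eq
  obtain ⟨X, hX, hfix, hlim⟩ := exists_posDef_fixedPoint hQ hFt hstab hG hobs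
  have hric : Tendsto S.riccati atTop (𝓝 X) := by
    refine (tendsto_iterate_riccatiMap hQ hQf hFt hX hfix hlim).congr fun j => ?_
    rw [riccati_eq_iterate, hF.2]
  have hP : S.Pss = X := hric.limUnder_eq
  have hcl := tendsto_quad_closedLoop_pow hQ hFt hX hfix hlim
  have hPhi : S.Phiᵀ = S.Phi := by rw [← hF.2, transpose_mul, hFt]
  rw [hP]
  refine ⟨hric, hX, by rw [← hF.2, hfix], ?_⟩
  -- `AᵀM` is the transpose of the closed-loop matrix, so its powers decay as well.
  have ht : ∀ j, (S.Aᵀ * S.gain X) ^ j = (closedLoop S.A (F * F) X ^ j)ᵀ := fun j => by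
    rw [transpose_pow, closedLoop, transpose_mul, hF.2, gain,
      ← transpose_inv_one_add_mul hX.posSemidef.transpose_eq hPhi, transpose_transpose]
  simp only [ht]
  refine tendsto_pi_nhds.2 fun i => tendsto_pi_nhds.2 fun l => ?_
  have h := tendsto_pi_nhds.1 (hcl (Pi.single i 1)) l
  simpa using h

/-- Decay of the powers makes `I - AᵀM` invertible, so `r_ss` solves the stationary linear equation.
-/
theorem rss_eq_nextLinear (h : Tendsto (fun j => (S.Aᵀ * S.gain S.Pss) ^ j) atTop (𝓝 0)) :
    S.rss = S.nextLinear S.Pss S.rss := by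
  have hu := isUnit_det_one_sub_of_tendsto h
  have h1 : (1 - S.Aᵀ * S.gain S.Pss) *ᵥ S.rss
      = (S.Aᵀ * S.gain S.Pss) *ᵥ (S.Pss *ᵥ (S.Ξ *ᵥ S.wbar)) := by
    have e : (1 - S.Aᵀ * S.Mss)⁻¹ * S.Aᵀ * S.Mss * S.Pss * S.Ξ
        = (1 - S.Aᵀ * S.gain S.Pss)⁻¹ * (S.Aᵀ * S.gain S.Pss * (S.Pss * S.Ξ)) := by
      simp only [Matrix.mul_assoc]
      rfl
    rw [rss, e, mulVec_mulVec, ← Matrix.mul_assoc, Matrix.mul_nonsing_inv _ hu, Matrix.one_mul,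
      ← mulVec_mulVec _ _ (S.Pss * S.Ξ), ← mulVec_mulVec _ S.Pss]
  rw [sub_mulVec, one_mulVec, sub_eq_iff_eq_add, ← mulVec_add] at h1
  exact h1

/-- The error `linearTerm j - r_ss` follows a recursion with matrices tending to the stable `AᵀM`
and an input tending to zero, because `r_ss` is stationary. -/
theorem tendsto_linearTerm (hric : Tendsto S.riccati atTop (𝓝 S.Pss))
    (hU : IsUnit (1 + S.Pss * S.Phi).det)
    (h : Tendsto (fun j => (S.Aᵀ * S.gain S.Pss) ^ j) atTop (𝓝 0)) :
    Tendsto S.linearTerm atTop (𝓝 S.rss) := by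
  have hc {p q : ℕ} (M : Matrix (Fin p) (Fin q) ℝ) : Tendsto (fun _ : ℕ => M) atTop (𝓝 M) :=
    tendsto_const_nhds
  have hgain : Tendsto (fun j => S.Aᵀ * S.gain (S.riccati j)) atTop (𝓝 (S.Aᵀ * S.gain S.Pss)) :=
    tendsto_matrix_mul (hc _) (tendsto_matrix_inv ((hc 1).add (tendsto_matrix_mul hric (hc _))) hU)
  have hfix := rss_eq_nextLinear h
  have hd : Tendsto (fun j => S.nextLinear (S.riccati j) S.rss - S.rss) atTop (𝓝 0) := by
    have h1 : Tendsto (fun j => S.nextLinear (S.riccati j) S.rss) atTop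
        (𝓝 (S.nextLinear S.Pss S.rss)) :=
      tendsto_matrix_mulVec hgain
        ((tendsto_matrix_mulVec hric tendsto_const_nhds).add tendsto_const_nhds)
    rw [← hfix] at h1
    simpa using h1.sub_const S.rss
  have he := tendsto_zero_of_recursion (e := fun j => S.linearTerm j - S.rss) h hgain hd
    fun j => by
      rw [linearTerm, nextLinear, nextLinear, mulVec_sub, mulVec_add, mulVec_add]
      abel
  simpa using he.add_const S.rss

/-- A limit of positive definite matrices is only semidefinite; nonsingularity restores
definiteness. -/
theorem curvature_Pss_posDef (hric : Tendsto S.riccati atTop (𝓝 S.Pss)) (hP : S.Pssᵀ = S.Pss)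
    (hpen : ∀ j, (S.curvature (S.riccati j)).PosDef) (hss : IsUnit (S.curvature S.Pss)) :
    (S.curvature S.Pss).PosDef := by
  have hlim : Tendsto (fun j => S.curvature (S.riccati j)) atTop (𝓝 (S.curvature S.Pss)) :=
    tendsto_const_nhds.sub (tendsto_matrix_mul (tendsto_matrix_mul tendsto_const_nhds hric)
      tendsto_const_nhds)
  have hps : (S.curvature S.Pss).PosSemidef := by
    refine posSemidef_of_quad ?_ fun x => ge_of_tendsto' (tendsto_quad hlim x)
      fun j => (hpen j).posSemidef.quad_nonneg x
    rw [curvature, transpose_sub, transpose_smul, transpose_one, transpose_mul, transpose_mul,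
      hP, transpose_transpose, Matrix.mul_assoc]
  exact hps.posDef_iff_isUnit.2 hss

/-- Completing the square in `δ‖y‖² - 2s‖y‖`, with `s` the `ℓ¹` norm of `r_ss`, gives the bound
`s²/δ`. -/
theorem exists_le_bias (hP : S.Pss.PosDef) : ∃ K, ∀ y, -K ≤ S.bias y := by
  obtain ⟨δ, hδ, hle⟩ := hP.exists_pos_le_quad
  set s := ∑ i, |S.rss i| with hs
  refine ⟨s ^ 2 / δ, fun y => ?_⟩
  have h1 : |S.rss ⬝ᵥ y| ≤ s * ‖y‖ := by
    rw [hs, Finset.sum_mul]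
    refine (Finset.abs_sum_le_sum_abs _ _).trans (Finset.sum_le_sum fun i _ => ?_)
    rw [abs_mul]
    gcongr
    exact norm_le_pi_norm y i
  have h2 := hle y
  have h3 := neg_abs_le (S.rss ⬝ᵥ y)
  have h4 : 0 ≤ (δ * ‖y‖ - s) ^ 2 / δ := by positivity
  have h5 : (δ * ‖y‖ - s) ^ 2 / δ = δ * ‖y‖ ^ 2 - 2 * (s * ‖y‖) + s ^ 2 / δ := by
    field_simp
    ring
  rw [bias]
  linarith

theorem opponentPolicySS_act [NeZero N] (t : ℕ) (y : Fin n → ℝ) :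
    S.opponentPolicySS.act t y = empirical fun i =>
      S.response S.Pss S.rss (S.drift S.Pss S.rss y) (S.what i) := by
  have h : S.worstPoint y = fun i =>
      S.response S.Pss S.rss (S.drift S.Pss S.rss y) (S.what i) := by
    funext i
    have e : S.drift S.Pss S.rss y
        = S.A *ᵥ y + S.B *ᵥ (S.Kss *ᵥ y) + S.B *ᵥ S.Lss := by
      rw [add_assoc, ← mulVec_add]
      rfl
    rw [response, e]
    rfl
  rw [← h]
  rfl

/-- The quadratic part of the game value stays bounded and disappears after division by `T`; the
stage constants average to their limit `ρ`. -/
theorem steadyStateCost_eq [NeZero N] (hF : IsPSDSqrt F S.Phi) (hQ : S.Q.PosSemidef)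
    (hQf : S.Qf.PosSemidef) (hR : S.R.PosDef) (hlam : 0 < S.lam)
    (hpen : ∀ j, (S.curvature (S.riccati j)).PosDef)
    (hric : Tendsto S.riccati atTop (𝓝 S.Pss)) (hlin : Tendsto S.linearTerm atTop (𝓝 S.rss))
    (hU : IsUnit (1 + S.Pss * S.Phi).det) (hD : (S.curvature S.Pss).PosDef) (x : Fin n → ℝ) :
    S.steadyStateCost x = (S.rho : EReal) := by
  have h1 : Tendsto (fun T : ℕ => (T : ℝ)⁻¹ * quad (S.riccati T) (S.linearTerm T) x) atTop
      (𝓝 0) := by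
    have h2 : Tendsto (fun T => quad (S.riccati T) (S.linearTerm T) x) atTop
        (𝓝 (quad S.Pss S.rss x)) :=
      (tendsto_quad hric x).add ((tendsto_dotProduct hlin tendsto_const_nhds).const_mul 2)
    simpa using tendsto_inv_atTop_nhds_zero_nat.mul h2
  have h3 := (tendsto_stageConst hric hlin hlam hD hU).cesaro
  have h4 := h1.add h3
  rw [zero_add] at h4
  refine Tendsto.limsup_eq (Tendsto.congr' ?_ ((continuous_coe_real_ereal.tendsto _).comp h4))
  filter_upwards [eventually_gt_atTop 0] with T hT
  rw [iInf_iSup_finiteCost hF hQ hQf hR hlam hpen x hT, one_div, mul_add]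
  rfl

/-! ### Bounds for the stationary policies. -/

section Stationary

variable [NeZero N] (hQ : S.Q.PosSemidef) (hR : S.R.PosDef) (hlam : 0 < S.lam)
  (hV : ∀ T, S.IsValueSequence T (fun _ => S.Pss) (fun _ => S.rss)) (x : Fin n → ℝ)

include hQ hR hlam hV

theorem meanCost_controlPolicySS_le (γ : OpponentPolicy n k) {T : ℕ} (hT : 0 < T)
    {g : (Fin n → ℝ) → ℝ} {c : ℝ} (hg : Continuous g) (hgc : ∀ y, g y ≤ S.bias y + c)
    (hgC : ∃ C, ∀ y, |g y| ≤ C * (1 + ‖y‖ ^ 2)) :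
    S.meanCost g x S.controlPolicySS γ T ≤ ((S.rho + (S.bias x + c) / T : ℝ) : EReal) := by
  have hT' : (T : ℝ) ≠ 0 := by positivity
  refine ((hV T).meanCost_le hQ hR hlam x S.controlPolicySS (fun _ _ => rfl) γ hT hg hgc
    hgC).trans_eq ?_
  rw [Finset.sum_const, Finset.card_range, nsmul_eq_mul]
  -- By definition the stage constant at `P_ss`, `r_ss` is `ρ`, and the value function there is the
  -- bias.
  change ((1 / (T : ℝ) * (S.bias x + T * S.rho + c) : ℝ) : EReal) = _
  congr 1
  field_simp
  ring

theorem le_meanCost_opponentPolicySS (π : ControlPolicy n m) {T : ℕ} (hT : 0 < T)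
    {g : (Fin n → ℝ) → ℝ} (hg : Continuous g) :
    ((S.rho + (S.bias x) / T - 1 / (T : ℝ) * (∫ y, S.bias y
        ∂(S.stateLaw x π S.opponentPolicySS T) - ∫ y, g y
        ∂(S.stateLaw x π S.opponentPolicySS T)) : ℝ) : EReal)
      ≤ S.meanCost g x π S.opponentPolicySS T := by
  have hT' : (T : ℝ) ≠ 0 := by positivity
  refine Eq.trans_le ?_ ((hV T).le_meanCost hQ hR hlam x π S.opponentPolicySS
    (fun t _ y => opponentPolicySS_act t y) hg)
  rw [Finset.sum_const, Finset.card_range, nsmul_eq_mul]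
  change _ = ((1 / (T : ℝ) * (S.bias x + T * S.rho
    - ∫ y, S.bias y ∂(S.stateLaw x π S.opponentPolicySS T)
    + ∫ y, g y ∂(S.stateLaw x π S.opponentPolicySS T)) : ℝ) : EReal)
  congr 1
  field_simp
  ring

theorem extAverageCost_controlPolicySS_le (γ : OpponentPolicy n k) :
    S.extAverageCost x S.controlPolicySS γ ≤ (S.rho : EReal) := by
  rw [← (tendsto_coe_add_div S.rho (S.bias x + 0)).limsup_eq]
  refine limsup_le_limsup ?_
  filter_upwards [eventually_gt_atTop 0] with T hT
  exact meanCost_controlPolicySS_le hQ hR hlam hV x γ hT continuous_quad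
    (fun y => (add_zero _).ge) (exists_abs_quad_le _ _)

theorem le_extAverageCost_opponentPolicySS (π : ControlPolicy n m) :
    (S.rho : EReal) ≤ S.extAverageCost x π S.opponentPolicySS := by
  rw [← (tendsto_coe_add_div S.rho (S.bias x)).limsup_eq]
  refine limsup_le_limsup ?_
  filter_upwards [eventually_gt_atTop 0] with T hT
  have h := le_meanCost_opponentPolicySS hQ hR hlam hV x π hT
    (continuous_quad (P := S.Pss) (r := S.rss))
  refine Eq.trans_le ?_ h
  congr 1
  change _ = S.rho + S.bias x / T - 1 / (T : ℝ) * (∫ y, S.bias y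
        ∂(S.stateLaw x π S.opponentPolicySS T) - ∫ y, S.bias y
        ∂(S.stateLaw x π S.opponentPolicySS T))
  rw [sub_self, mul_zero, sub_zero]

/-- The zero terminal cost is at most `h + K`, and the constant `K` vanishes after division by `T`.
-/
theorem averageCost_controlPolicySS_le (hP : S.Pss.PosDef) (γ : OpponentPolicy n k) :
    S.averageCost x S.controlPolicySS γ ≤ (S.rho : EReal) := by
  obtain ⟨K, hK⟩ := exists_le_bias hP
  rw [← (tendsto_coe_add_div S.rho (S.bias x + K)).limsup_eq]
  refine limsup_le_limsup ?_
  filter_upwards [eventually_gt_atTop 0] with T hT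
  exact meanCost_controlPolicySS_le hQ hR hlam hV x γ hT continuous_const
    (fun y => by linarith [hK y]) ⟨0, fun y => by simp⟩

theorem le_averageCost_opponentPolicySS (π : ControlPolicy n m)
    (h0 : S.biasGrowth x π S.opponentPolicySS = 0) :
    (S.rho : EReal) ≤ S.averageCost x π S.opponentPolicySS := by
  have hε : ∀ ε : ℝ, 0 < ε → ((S.rho - ε : ℝ) : EReal)
      ≤ S.averageCost x π S.opponentPolicySS := fun ε hε => by
    -- Dropping the terminal bias from the lower bound loses `E[h(x_T)]/T`, and zero upper growth
    -- makes this eventually less than `ε`.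
    have hev : ∀ᶠ T : ℕ in atTop, ((1 / (T : ℝ) : ℝ) : EReal)
        * extExpect (S.stateLaw x π S.opponentPolicySS T) S.bias < (ε : EReal) :=
      eventually_lt_of_limsup_lt (by
        change S.biasGrowth x π S.opponentPolicySS < (ε : EReal)
        rw [h0]
        exact_mod_cast hε)
    rw [← (tendsto_coe_add_div (S.rho - ε) (S.bias x)).limsup_eq]
    refine limsup_le_limsup ?_
    filter_upwards [eventually_gt_atTop 0, hev] with T hT hlt
    have hint := ((hV T).lower_bound hQ hR hlam x π S.opponentPolicySS
      (fun t _ y => opponentPolicySS_act t y) T le_rfl).1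
    rw [extExpect_eq_integral (f := S.bias)
        (hint _ (continuous_quad (P := S.Pss) (r := S.rss)).measurable),
      ← EReal.coe_mul, EReal.coe_lt_coe_iff] at hlt
    refine le_trans ?_ (le_meanCost_opponentPolicySS hQ hR hlam hV x π hT
      (continuous_const (y := (0 : ℝ))))
    rw [EReal.coe_le_coe_iff, integral_zero, sub_zero]
    linarith
  have hlim : Tendsto (fun j : ℕ => ((S.rho - 1 / ((j : ℝ) + 1) : ℝ) : EReal)) atTop
      (𝓝 (S.rho : EReal)) := by
    have h1 := (tendsto_one_div_add_atTop_nhds_zero_nat (𝕜 := ℝ)).const_sub S.rho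
    rw [sub_zero] at h1
    exact (continuous_coe_real_ereal.tendsto _).comp h1
  exact le_of_tendsto' hlim fun j => hε _ (by positivity)

end Stationary

end MinimaxLQ

theorem mainTheorem4 {n m k N : ℕ} [NeZero N] (S : MinimaxLQ n m k N)
    (hQ : S.Q.PosSemidef) (hQf : S.Qf.PosSemidef) (hR : S.R.PosDef) (hlam : 0 < S.lam)
    (hpen : ∀ j, (S.lam • (1 : Matrix (Fin k) (Fin k) ℝ) - S.Ξᵀ * S.riccati j * S.Ξ).PosDef)
    (hPhi : S.Phi.PosSemidef)
    (hstab : ∃ F, IsPSDSqrt F S.Phi ∧ IsStabilizable S.A F)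
    (hobs : ∃ G, IsPSDSqrt G S.Q ∧ IsObservablePair S.A G)
    (hss : IsUnit (S.lam • (1 : Matrix (Fin k) (Fin k) ℝ) - S.Ξᵀ * S.Pss * S.Ξ))
    (x : Fin n → ℝ) :
    -- the steady-state objects are well defined, and `ρ` is given by its closed form
    (Tendsto S.riccati atTop (𝓝 S.Pss) ∧ S.steadyStateCost x = (S.rho : EReal)) ∧
    -- (a)
    (∀ (π : ControlPolicy n m) (γ : OpponentPolicy n k),
      S.extAverageCost x S.controlPolicySS γ ≤ (S.rho : EReal) ∧
      (S.rho : EReal) ≤ S.extAverageCost x π S.opponentPolicySS) ∧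
    -- (b)
    (IsMinimaxOptimal (S.extAverageCost x) Set.univ Set.univ
        S.controlPolicySS S.opponentPolicySS ∧
      (⨅ π : ControlPolicy n m, ⨆ γ : OpponentPolicy n k, S.extAverageCost x π γ)
        = (S.rho : EReal)) ∧
    -- (c)
    (∀ (C : Set (ControlPolicy n m)) (D : Set (OpponentPolicy n k)),
      S.controlPolicySS ∈ C → S.opponentPolicySS ∈ D →
      (∀ γ ∈ D, S.biasGrowth x S.controlPolicySS γ = 0) →
      (∀ π ∈ C, S.biasGrowth x π S.opponentPolicySS = 0) →
      IsMinimaxOptimal (S.averageCost x) C D S.controlPolicySS S.opponentPolicySS ∧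
      (⨅ π ∈ C, ⨆ γ ∈ D, S.averageCost x π γ) = (S.rho : EReal)) := by
  obtain ⟨F, hF, hFs⟩ := hstab
  obtain ⟨G, hG, hGo⟩ := hobs
  obtain ⟨hric, hP, hfix, hpow⟩ := MinimaxLQ.exists_steadyState hQ hQf hF hFs hG hGo
  have hD := MinimaxLQ.curvature_Pss_posDef hric hP.posSemidef.transpose_eq hpen hss
  have hU : IsUnit (1 + S.Pss * S.Phi).det := by
    rw [← hF.2]
    exact isUnit_det_one_add_mul hP.posSemidef hF.1.transpose_eq
  have hlin := MinimaxLQ.tendsto_linearTerm hric hU hpow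
  -- The constant coefficients solve the recursion at every horizon, so both telescoped bounds apply
  -- to the stationary policies.
  have hV : ∀ T, S.IsValueSequence T (fun _ => S.Pss) (fun _ => S.rss) := fun T =>
    ⟨fun _ _ => hP.posSemidef, fun _ _ => hD, fun _ _ => hU, fun _ _ => hfix.symm,
      fun _ _ => MinimaxLQ.rss_eq_nextLinear hpow⟩
  have ha1 := MinimaxLQ.extAverageCost_controlPolicySS_le hQ hR hlam hV x
  have ha2 := MinimaxLQ.le_extAverageCost_opponentPolicySS hQ hR hlam hV x
  refine ⟨⟨hric, MinimaxLQ.steadyStateCost_eq hF hQ hQf hR hlam hpen hric hlin hU hD x⟩,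
    fun π γ => ⟨ha1 γ, ha2 π⟩, ?_, fun C D hC hD' _ hCb => ?_⟩
  · have h := isMinimaxOptimal_of_saddle (J := S.extAverageCost x)
      (Set.mem_univ S.controlPolicySS) (Set.mem_univ S.opponentPolicySS)
      (fun γ _ => ha1 γ) (fun π _ => ha2 π)
    refine ⟨h.1, ?_⟩
    simpa only [Set.mem_univ, iInf_pos, iSup_pos] using h.2
  · exact isMinimaxOptimal_of_saddle hC hD'
      (fun γ _ => MinimaxLQ.averageCost_controlPolicySS_le hQ hR hlam hV x hP γ)
      (fun π hπ => MinimaxLQ.le_averageCost_opponentPolicySS hQ hR hlam hV x π (hCb π hπ))
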